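/- Let $n\ge 7$ be an integer and let $p\ge 2$ be a real number. For a finite simple graph $G$ with vertices $v_1,\dots,v_n$ of degrees $d_1,\dots,d_n$, let $\mathbf{S}_{\mathbf p}(G)$ be the $n\times n$ matrix whose $(i,j)$ entry is $(d_i^p+d_j^p)^{1/p}$ if $v_iv_j$ is an edge of $G$ and $0$ otherwise, and let $\rho(\mathbf{S}_{\mathbf p}(G))$ be its largest eigenvalue (the $p$-Sombor spectral radius of $G$). A unicyclic graph is a connected graph with as many edges as vertices. Consider the following graphs of order $n$: - $S_n+e$ is the star of order $n$ with one additional edge joining two of its leaves, i.e. a triangle with $n-3$ pendent vertices attached to one of its vertices; - $U_1$ is a triangle with $n-4$ pendent vertices attached to one of its vertices and one pendent vertex attached to another; - $U_2$ is a triangle with $n-5$ pendent vertices and one pendent path of length $2$ all attached to the same vertex of the triangle; - $U_3$ is a $4$-cycle with $n-4$ pendent vertices attached to one of its vertices; - $U_4$ is a triangle with $n-5$ pendent vertices attached to one of its vertices and two pendent vertices attached to another. Then $S_n+e$, $U_1$, $U_2$, $U_3$, $U_4$ are unicyclic and are, in this order, the unique (up to isomorphism) unicyclic graphs of order $n$ with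 the first five maximum $p$-Sombor spectral radii. That is, $$\rho(\mathbf{S}_{\mathbf p}(U_4))<\rho(\mathbf{S}_{\mathbf p}(U_3))<\rho(\mathbf{S}_{\mathbf p}(U_2))<\rho(\mathbf{S}_{\mathbf p}(U_1))<\rho(\mathbf{S}_{\mathbf p}(S_n+e)),$$ and every unicyclic graph $G$ of order $n$ that is isomorphic to none of these five graphs satisfies $$\rho(\mathbf{S}_{\mathbf p}(G))<\rho(\mathbf{S}_{\mathbf p}(U_4)).$$ -/

import Mathlib

namespace PSombor

/-- The `p`-Sombor matrix of a finite simple graph `G`: the entry at `(i, j)` is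
`(d_i ^ p + d_j ^ p) ^ (1 / p)` if `i` and `j` are adjacent, and `0` otherwise,
where `d_i` is the degree of the vertex `i` in `G`. -/
noncomputable def pSomborMatrix {V : Type*} [Fintype V] (p : ℝ) (G : SimpleGraph V) :
    Matrix V V ℝ :=
  open Classical in
  Matrix.of fun i j =>
    if G.Adj i j then ((G.degree i : ℝ) ^ p + (G.degree j : ℝ) ^ p) ^ (1 / p) else 0

/-- The `p`-Sombor spectral radius of `G`: the largest (real) eigenvalue of its `p`-Sombor
matrix. -/
noncomputable def pSomborRadius {V : Type*} [Fintype V] (p : ℝ) (G : SimpleGraph V) : ℝ :=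
  open Classical in
  sSup {μ : ℝ | Module.End.HasEigenvalue (Matrix.toLin' (pSomborMatrix p G)) μ}

/-- The supremum in the definition of `pSomborRadius` is attained: on a nonempty vertex set it
is the greatest eigenvalue. -/
theorem isGreatest_pSomborRadius {V : Type*} [Fintype V] [DecidableEq V] [Nonempty V]
    (p : ℝ) (G : SimpleGraph V) :
    IsGreatest {μ : ℝ | Module.End.HasEigenvalue (Matrix.toLin' (pSomborMatrix p G)) μ}
      (pSomborRadius p G) := by
  have hH : (pSomborMatrix p G).IsHermitian := by
    ext i j
    by_cases h : G.Adj i j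
    · simp [pSomborMatrix, Matrix.conjTranspose_apply, h, h.symm, add_comm]
    · have h2 : ¬ G.Adj j i := fun h3 => h h3.symm
      simp [pSomborMatrix, Matrix.conjTranspose_apply, h, h2]
  have hS : {μ : ℝ | Module.End.HasEigenvalue (Matrix.toLin' (pSomborMatrix p G)) μ}
      = Set.range hH.eigenvalues := by
    rw [← hH.spectrum_real_eq_range_eigenvalues, ← Matrix.spectrum_toLin']
    ext μ
    exact Module.End.hasEigenvalue_iff_mem_spectrum
  have hR : pSomborRadius p G
      = sSup {μ : ℝ | Module.End.HasEigenvalue (Matrix.toLin' (pSomborMatrix p G)) μ} := by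
    unfold pSomborRadius
    congr!
  rw [hR, hS]
  exact ⟨(Set.range_nonempty _).csSup_mem (Set.finite_range _),
    fun _ hx => le_csSup (Set.finite_range _).bddAbove hx⟩

/-- A finite graph is unicyclic if it is connected and has as many edges as vertices. -/
def IsUnicyclic {V : Type*} [Fintype V] (G : SimpleGraph V) : Prop :=
  G.Connected ∧ G.edgeSet.ncard = Fintype.card V

/-- `S_n + e`: the star with centre `0`, together with the edge `12`. -/
def starPlusEdge (n : ℕ) : SimpleGraph (Fin n) :=
  SimpleGraph.fromRel fun i j =>
    i.val = 0 ∨ (i.val = 1 ∧ j.val = 2)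

/-- `U_1`: the triangle `012` with `n - 4` pendent vertices at `0` and one pendent vertex
(namely `3`) at `1`. -/
def U1 (n : ℕ) : SimpleGraph (Fin n) :=
  SimpleGraph.fromRel fun i j =>
    (i.val = 0 ∧ j.val ≠ 3) ∨ (i.val = 1 ∧ j.val = 2) ∨ (i.val = 1 ∧ j.val = 3)

/-- `U_2`: the triangle `012` with `n - 5` pendent vertices and one pendent path `0, 4, 3`
of length two at `0`. -/
def U2 (n : ℕ) : SimpleGraph (Fin n) :=
  SimpleGraph.fromRel fun i j =>
    (i.val = 0 ∧ j.val ≠ 3) ∨ (i.val = 1 ∧ j.val = 2) ∨ (i.val = 4 ∧ j.val = 3)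

/-- `U_3`: the 4-cycle `0, 1, 3, 2` with `n - 4` pendent vertices at `0`. -/
def U3 (n : ℕ) : SimpleGraph (Fin n) :=
  SimpleGraph.fromRel fun i j =>
    (i.val = 0 ∧ j.val ≠ 3) ∨ (i.val = 1 ∧ j.val = 3) ∨ (i.val = 2 ∧ j.val = 3)

/-- `U_4`: the triangle `012` with `n - 5` pendent vertices at `0` and two pendent vertices
(namely `3` and `4`) at `1`. -/
def U4 (n : ℕ) : SimpleGraph (Fin n) :=
  SimpleGraph.fromRel fun i j =>
    (i.val = 0 ∧ j.val ≠ 3 ∧ j.val ≠ 4) ∨ (i.val = 1 ∧ j.val = 2) ∨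
      (i.val = 1 ∧ j.val = 3) ∨ (i.val = 1 ∧ j.val = 4)

end PSombor

/-!
# The unicyclic graphs with the five largest `p`-Sombor spectral radii

The `p`-Sombor matrix of a connected graph has a positive eigenvector for its largest eigenvalue
(`PSombor.IsPerron`). If another graph on the same vertices has a larger quadratic form at this
vector, then its spectral radius is larger (`IsPerron.lt_of_sum_pos`). The comparisons below are
of this kind, except that of `U4` with `U3`. The main move takes two vertices `u`, `v` whose Perron
entries satisfy `x v ≤ x u` and which both have private neighbours, and hands all private neighbours
of `v` over to `u` (`radius_lt_shift_privateNbrs`). Monotonicity and convexity of the edge weight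
`(a ^ p + b ^ p) ^ (1 / p)` in each degree show that this increases the spectral radius; if `u` and
`v` are adjacent or have a common neighbour, the graph stays unicyclic.

A unicyclic graph of order `n` with a vertex of degree at least `n - 2` is one of `S_n + e`, `U1`,
`U2`, `U3` (`nonempty_iso_of_le_deg`). It remains to order the five graphs, and to show that `U4` is
the unique maximizer among the unicyclic graphs with all degrees at most `n - 3`. For the latter,
let `G` be a maximizer (`IsExtremal`). No move may keep the degrees below the bound, so any
two adjacent vertices of `G` with private neighbours on both sides dominate all but at most one
vertex (`IsExtremal.false_of_adj`), and any two such vertices at distance two dominate all other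
vertices (`IsExtremal.false_of_not_adj`). Take a vertex `c` of maximum degree, a spanning tree of
`G` centred at `c`, and the one edge of `G` outside this tree. The two domination properties exclude
almost all positions of this edge, leaving only two families: a triangle with pendent vertices at
two of its vertices, and a triangle hanging by an edge on the centre of a star. In the first, a
pendent vertex can be moved (`radius_lt_shift_pendant`) unless the graph is `U4`; in the second, an
edge of the triangle can be replaced (`radius_lt_rotate`).

In the order of the five graphs, `U4 < U3` (`radius_U4_lt`) is the delicate inequality. Eliminating
the pendent vertices from the eigenvalue equations turns it into an inequality between the edge
weights, which are estimated using that they decrease in `p`.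
-/

namespace PSombor

/-! ### The edge weight -/

/-- The weight `(a ^ p + b ^ p) ^ (1 / p)` of an edge whose ends have degrees `a` and `b`. -/
noncomputable def wt (p a b : ℝ) : ℝ := (a ^ p + b ^ p) ^ (1 / p)

lemma wt_comm (p a b : ℝ) : wt p a b = wt p b a := by
  unfold wt; rw [add_comm]

lemma wt_nonneg (p : ℝ) {a b : ℝ} (ha : 0 ≤ a) (hb : 0 ≤ b) : 0 ≤ wt p a b := by
  unfold wt; positivity

lemma wt_le_wt {p a b a' b' : ℝ} (hp : 2 ≤ p) (ha : 0 ≤ a) (hb : 0 ≤ b) (haa : a ≤ a')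
    (hbb : b ≤ b') : wt p a b ≤ wt p a' b' := by
  unfold wt
  have h0 : (0 : ℝ) ≤ p := by linarith
  gcongr

lemma wt_lt_wt {p a b a' : ℝ} (hp : 2 ≤ p) (ha : 0 ≤ a) (hb : 0 ≤ b) (haa : a < a') :
    wt p a b < wt p a' b := by
  unfold wt
  have h0 : (0 : ℝ) < p := by linarith
  have h1 : a ^ p < a' ^ p := Real.rpow_lt_rpow ha haa h0
  exact Real.rpow_lt_rpow (by positivity) (by linarith) (by positivity)

lemma le_wt {p a b : ℝ} (hp : 2 ≤ p) (ha : 0 ≤ a) (hb : 0 ≤ b) : a ≤ wt p a b := by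
  unfold wt
  have h0 : (0 : ℝ) < p := by linarith
  calc a = (a ^ p) ^ (1 / p) := by
        rw [← Real.rpow_mul ha, mul_one_div_cancel h0.ne', Real.rpow_one]
    _ ≤ _ := by
        have : 0 ≤ b ^ p := by positivity
        gcongr; linarith

/-- The `ℓ^p` norm decreases in `p`. -/
lemma wt_antitone {p q a b : ℝ} (hp : 0 < p) (hpq : p ≤ q) (ha : 0 ≤ a) (hb : 0 ≤ b) :
    wt q a b ≤ wt p a b :=
  Real.rpow_add_rpow_le ha hb hp hpq

lemma wt_sq_le {p a b : ℝ} (hp : 2 ≤ p) (ha : 0 ≤ a) (hb : 0 ≤ b) :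
    wt p a b ^ 2 ≤ a ^ 2 + b ^ 2 := by
  have h := wt_antitone (by norm_num) hp ha hb
  have h2 : wt 2 a b ^ 2 = a ^ 2 + b ^ 2 := by
    unfold wt
    rw [← Real.sqrt_eq_rpow, Real.sq_sqrt (by positivity)]
    norm_cast
  rw [← h2]
  have := wt_nonneg p ha hb
  gcongr

/-- By convexity of `t ↦ t ^ p`, spreading the two degrees of an edge further apart at constant
sum does not decrease its weight. -/
lemma wt_le_wt_of_spread {p a b k : ℝ} (hp : 2 ≤ p) (hk : 0 ≤ k) (hkb : k ≤ b) (ha : 0 ≤ a)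
    (h : b ≤ a + k) : wt p a b ≤ wt p (a + k) (b - k) := by
  have hc := convexOn_rpow (p := p) (by linarith)
  have key : a ^ p + b ^ p ≤ (a + k) ^ p + (b - k) ^ p := by
    rcases hk.eq_or_lt with rfl | hk
    · simp
    have hpos : 0 < a + k - (b - k) := by linarith
    set t := k / (a + k - (b - k)) with ht
    have ht0 : 0 ≤ t := by positivity
    have ht1 : t ≤ 1 := by rw [ht, div_le_one hpos]; linarith
    have e : t * (a + k - (b - k)) = k := by rw [ht]; field_simp
    have m1 : a + k ∈ Set.Ici (0 : ℝ) := by simp only [Set.mem_Ici]; linarith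
    have m2 : b - k ∈ Set.Ici (0 : ℝ) := by simp only [Set.mem_Ici]; linarith
    have h1 := hc.2 m1 m2 (sub_nonneg.2 ht1) ht0 (by ring)
    have h2 := hc.2 m1 m2 ht0 (sub_nonneg.2 ht1) (by ring)
    simp only [smul_eq_mul] at h1 h2
    rw [show (1 - t) * (a + k) + t * (b - k) = a by linarith] at h1
    rw [show t * (a + k) + (1 - t) * (b - k) = b by linarith] at h2
    linarith
  have h0 : (0 : ℝ) < p := by linarith
  have hb : 0 ≤ b := by linarith
  unfold wt
  exact Real.rpow_le_rpow (by positivity) key (by positivity)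

/-- Minkowski's inequality makes the weight convex in one degree. -/
lemma convexOn_wt {p c : ℝ} (hp : 2 ≤ p) (hc : 0 ≤ c) :
    ConvexOn ℝ (Set.Ici 0) fun t => wt p t c := by
  refine ⟨convex_Ici 0, ?_⟩
  intro x hx y hy s t hs ht hst
  simp only [Set.mem_Ici] at hx hy
  have h0 : (0 : ℝ) < p := by linarith
  have hscale : ∀ r z : ℝ, 0 ≤ r → 0 ≤ z →
      ((r * z) ^ p + (r * c) ^ p) ^ (1 / p) = r * wt p z c := by
    intro r z hr hz
    rw [Real.mul_rpow hr hz, Real.mul_rpow hr hc, ← mul_add,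
      Real.mul_rpow (by positivity) (by positivity), ← Real.rpow_mul hr,
      mul_one_div_cancel h0.ne', Real.rpow_one]
    rfl
  have h := Real.Lp_add_le_of_nonneg (s := (Finset.univ : Finset (Fin 2))) (p := p)
    (f := ![s * x, s * c]) (g := ![t * y, t * c]) (by linarith)
    (by intro i _; fin_cases i <;> simp <;> positivity)
    (by intro i _; fin_cases i <;> simp <;> positivity)
  simp only [Fin.sum_univ_two, Matrix.cons_val_zero, Matrix.cons_val_one] at h
  rw [hscale s x hs hx, hscale t y ht hy, ← add_mul, hst, one_mul] at h
  simpa [wt, smul_eq_mul] using h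

/-- Increments of the weight in one degree grow with that degree. -/
lemma wt_increment_mono {p c a b k : ℝ} (hp : 2 ≤ p) (hc : 0 ≤ c) (ha : 0 ≤ a) (hab : a ≤ b)
    (hk : 0 ≤ k) : wt p (a + k) c - wt p a c ≤ wt p (b + k) c - wt p b c := by
  rcases hk.eq_or_lt with rfl | hk
  · simp
  have hcv := convexOn_wt hp hc
  have hpos : 0 < b + k - a := by linarith
  set t := k / (b + k - a) with ht
  have ht0 : 0 ≤ t := by positivity
  have ht1 : t ≤ 1 := by rw [ht, div_le_one hpos]; linarith
  have e : t * (b + k - a) = k := by rw [ht]; field_simp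
  have m1 : a ∈ Set.Ici (0 : ℝ) := ha
  have m2 : b + k ∈ Set.Ici (0 : ℝ) := by simp only [Set.mem_Ici]; linarith
  have h1 := hcv.2 m1 m2 (sub_nonneg.2 ht1) ht0 (by ring)
  have h2 := hcv.2 m1 m2 ht0 (sub_nonneg.2 ht1) (by ring)
  simp only [smul_eq_mul] at h1 h2
  rw [show (1 - t) * a + t * (b + k) = a + k by linarith] at h1
  rw [show t * a + (1 - t) * (b + k) = b by linarith] at h2
  linarith

end PSombor

namespace PSombor

open scoped Matrix

/-! ### The Sombor matrix and its Perron vector -/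

/-- The degree of `i`, as the cardinality of its neighbour set. -/
noncomputable def deg {V : Type*} (G : SimpleGraph V) (i : V) : ℕ := (G.neighborSet i).ncard

variable {V : Type*} {p : ℝ} {G G' : SimpleGraph V}

/-- The weight of the pair `i`, `j`, computed from the degrees of its ends. -/
noncomputable def edgeWt (p : ℝ) (G : SimpleGraph V) (i j : V) : ℝ :=
  wt p (deg G i) (deg G j)

lemma edgeWt_comm (p : ℝ) (G : SimpleGraph V) (i j : V) : edgeWt p G i j = edgeWt p G j i :=
  wt_comm _ _ _

lemma edgeWt_nonneg (p : ℝ) (G : SimpleGraph V) (i j : V) : 0 ≤ edgeWt p G i j :=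
  wt_nonneg _ (by positivity) (by positivity)

lemma deg_congr {W : Type*} {H : SimpleGraph W} (e : G ≃g H) (i : V) : deg H (e i) = deg G i := by
  unfold deg
  rw [← Set.ncard_image_of_injective _ e.injective]
  congr 1
  ext j
  simp only [SimpleGraph.mem_neighborSet, Set.mem_image]
  constructor
  · intro h
    refine ⟨e.symm j, ?_, by simp⟩
    rw [← e.map_adj_iff]; simpa using h
  · rintro ⟨k, hk, rfl⟩
    exact e.map_adj_iff.2 hk

variable [Fintype V]

lemma deg_pos_of_adj {i j : V} (h : G.Adj i j) : 0 < deg G i :=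
  (Set.ncard_pos (Set.toFinite _)).2 ⟨j, h⟩

lemma edgeWt_pos (hp : 2 ≤ p) {i j : V} (h : G.Adj i j) : 0 < edgeWt p G i j :=
  lt_of_lt_of_le (by exact_mod_cast deg_pos_of_adj h) (le_wt hp (by positivity) (by positivity))

lemma pSomborMatrix_of_adj {i j : V} (h : G.Adj i j) :
    pSomborMatrix p G i j = edgeWt p G i j := by
  classical
  have hd : ∀ k (_ : Fintype (G.neighborSet k)), G.degree k = deg G k := by
    intro k _
    rw [deg, Set.ncard_eq_toFinset_card', ← SimpleGraph.card_neighborFinset_eq_degree]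
    rfl
  simp only [pSomborMatrix, Matrix.of_apply, h, if_true, edgeWt, wt]
  rw [hd i, hd j]

lemma pSomborMatrix_of_not_adj {i j : V} (h : ¬ G.Adj i j) : pSomborMatrix p G i j = 0 := by
  simp [pSomborMatrix, h]

lemma pSomborMatrix_nonneg (i j : V) : 0 ≤ pSomborMatrix p G i j := by
  by_cases h : G.Adj i j
  · rw [pSomborMatrix_of_adj h]; exact edgeWt_nonneg _ _ _ _
  · rw [pSomborMatrix_of_not_adj h]

lemma pSomborMatrix_comm (i j : V) : pSomborMatrix p G i j = pSomborMatrix p G j i := by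
  by_cases h : G.Adj i j
  · rw [pSomborMatrix_of_adj h, pSomborMatrix_of_adj h.symm, edgeWt_comm]
  · rw [pSomborMatrix_of_not_adj h, pSomborMatrix_of_not_adj fun h' => h h'.symm]

lemma pSomborMatrix_isHermitian : (pSomborMatrix p G).IsHermitian := by
  ext i j
  simp [Matrix.conjTranspose_apply, pSomborMatrix_comm j i]

/-- `ρ - S` is positive semidefinite. -/
lemma posSemidef_pSomborRadius_sub [DecidableEq V] [Nonempty V] :
    (pSomborRadius p G • (1 : Matrix V V ℝ) - pSomborMatrix p G).PosSemidef := by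
  have hH : (pSomborRadius p G • (1 : Matrix V V ℝ) - pSomborMatrix p G).IsHermitian := by
    refine Matrix.IsHermitian.sub ?_ pSomborMatrix_isHermitian
    ext i j
    simp [Matrix.conjTranspose_apply, Matrix.one_apply, eq_comm]
  rw [hH.posSemidef_iff_eigenvalues_nonneg]
  intro i
  have hv := hH.mulVec_eigenvectorBasis i
  set v : V → ℝ := ⇑(hH.eigenvectorBasis i) with hvdef
  have hv0 : v ≠ 0 := by
    intro h0
    have := hH.eigenvectorBasis.orthonormal.ne_zero i
    apply this
    ext j
    exact congrFun h0 j
  have hS : pSomborMatrix p G *ᵥ v = (pSomborRadius p G - hH.eigenvalues i) • v := by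
    rw [Matrix.sub_mulVec, Matrix.smul_mulVec, Matrix.one_mulVec] at hv
    rw [sub_smul, ← hv]
    abel
  have hle := (isGreatest_pSomborRadius p G).2
    (show Module.End.HasEigenvalue (Matrix.toLin' (pSomborMatrix p G)) _ from
      Module.End.hasEigenvalue_of_hasEigenvector (x := v)
        ⟨Module.End.mem_eigenspace_iff.2 (by rw [Matrix.toLin'_apply, hS]), hv0⟩)
  simpa using hle

lemma dotProduct_mulVec_le (x : V → ℝ) [Nonempty V] :
    x ⬝ᵥ (pSomborMatrix p G *ᵥ x) ≤ pSomborRadius p G * (x ⬝ᵥ x) := by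
  classical
  have h := (posSemidef_pSomborRadius_sub (p := p) (G := G)).dotProduct_mulVec_nonneg x
  rw [Matrix.sub_mulVec, Matrix.smul_mulVec, Matrix.one_mulVec, dotProduct_sub,
    dotProduct_smul] at h
  simpa using h

/-- An everywhere positive eigenvector of the `p`-Sombor matrix for its spectral radius. -/
structure IsPerron (p : ℝ) (G : SimpleGraph V) (x : V → ℝ) : Prop where
  pos : ∀ i, 0 < x i
  eigen : pSomborMatrix p G *ᵥ x = pSomborRadius p G • x

lemma IsPerron.sum_eq {x : V → ℝ} (hx : IsPerron p G x) (i : V) :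
    ∑ j, pSomborMatrix p G i j * x j = pSomborRadius p G * x i :=
  congrFun hx.eigen i

/-- Perron's theorem: the absolute value of an eigenvector for the largest eigenvalue maximizes
the quadratic form as well, hence is an eigenvector; connectedness makes it positive. -/
lemma exists_isPerron (hp : 2 ≤ p) (hG : G.Connected) : ∃ x, IsPerron p G x := by
  classical
  have := hG.nonempty
  obtain ⟨v, hv⟩ := (isGreatest_pSomborRadius p G).1.exists_hasEigenvector
  have hv1 : pSomborMatrix p G *ᵥ v = pSomborRadius p G • v := by
    rw [← Matrix.toLin'_apply]; exact hv.apply_eq_smul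
  set x : V → ℝ := fun i => |v i| with hx
  have hxx : x ⬝ᵥ x = v ⬝ᵥ v := by simp [dotProduct, hx]
  have hge : v ⬝ᵥ (pSomborMatrix p G *ᵥ v) ≤ x ⬝ᵥ (pSomborMatrix p G *ᵥ x) := by
    simp only [dotProduct, Matrix.mulVec, Finset.mul_sum]
    refine Finset.sum_le_sum fun i _ => Finset.sum_le_sum fun j _ => ?_
    calc v i * (pSomborMatrix p G i j * v j)
        ≤ |v i * (pSomborMatrix p G i j * v j)| := le_abs_self _
      _ = _ := by rw [abs_mul, abs_mul, abs_of_nonneg (pSomborMatrix_nonneg i j)]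
  have hle := dotProduct_mulVec_le (p := p) (G := G) x
  rw [hv1, dotProduct_smul, ← hxx, smul_eq_mul] at hge
  have h0 : (pSomborRadius p G • (1 : Matrix V V ℝ) - pSomborMatrix p G) *ᵥ x = 0 := by
    rw [← (posSemidef_pSomborRadius_sub (p := p) (G := G)).dotProduct_mulVec_zero_iff x,
      Matrix.sub_mulVec, Matrix.smul_mulVec, Matrix.one_mulVec, dotProduct_sub, dotProduct_smul]
    simp only [star_trivial, smul_eq_mul]
    linarith
  have hS : pSomborMatrix p G *ᵥ x = pSomborRadius p G • x := by
    rw [Matrix.sub_mulVec, Matrix.smul_mulVec, Matrix.one_mulVec, sub_eq_zero] at h0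
    exact h0.symm
  have hx0 : ∀ i, 0 ≤ x i := fun i => abs_nonneg _
  have hstep : ∀ i j, G.Adj i j → x i = 0 → x j = 0 := by
    intro i j hij hi
    have h1 : ∑ k, pSomborMatrix p G i k * x k = 0 := by
      have := congrFun hS i
      simpa [Matrix.mulVec, dotProduct, hi] using this
    rw [Finset.sum_eq_zero_iff_of_nonneg
      fun k _ => mul_nonneg (pSomborMatrix_nonneg i k) (hx0 k)] at h1
    have h2 := h1 j (Finset.mem_univ _)
    rw [pSomborMatrix_of_adj hij] at h2
    exact (mul_eq_zero.1 h2).resolve_left (edgeWt_pos hp hij).ne'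
  refine ⟨x, fun i => lt_of_le_of_ne (hx0 i) fun hi => hv.2 ?_, hS⟩
  have hall : ∀ j, x j = 0 := by
    intro j
    obtain ⟨w⟩ := hG.preconnected i j
    have : ∀ {a b : V}, G.Walk a b → x a = 0 → x b = 0 := by
      intro a b w
      induction w with
      | nil => exact id
      | cons h _ ih => exact fun ha => ih (hstep _ _ h ha)
    exact this w hi.symm
  ext j
  simpa [hx] using hall j

/-- The Rayleigh principle, in the form in which two graphs on the same vertices are compared. -/
lemma IsPerron.lt_of_sum_pos {x : V → ℝ} (hx : IsPerron p G x) [Nonempty V]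
    (h : 0 < ∑ i, ∑ j, (pSomborMatrix p G' i j - pSomborMatrix p G i j) * (x i * x j)) :
    pSomborRadius p G < pSomborRadius p G' := by
  have h1 := dotProduct_mulVec_le (p := p) (G := G') x
  have h2 : x ⬝ᵥ (pSomborMatrix p G *ᵥ x) = pSomborRadius p G * (x ⬝ᵥ x) := by
    rw [hx.eigen, dotProduct_smul, smul_eq_mul]
  have h3 : 0 < x ⬝ᵥ x := by
    obtain ⟨i⟩ := (inferInstance : Nonempty V)
    exact Finset.sum_pos (fun i _ => mul_pos (hx.pos i) (hx.pos i)) ⟨i, Finset.mem_univ _⟩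
  have h4 : ∑ i, ∑ j, (pSomborMatrix p G' i j - pSomborMatrix p G i j) * (x i * x j)
      = x ⬝ᵥ (pSomborMatrix p G' *ᵥ x) - x ⬝ᵥ (pSomborMatrix p G *ᵥ x) := by
    simp only [dotProduct, Matrix.mulVec, Finset.mul_sum, ← Finset.sum_sub_distrib]
    refine Finset.sum_congr rfl fun i _ => Finset.sum_congr rfl fun j _ => by ring
  rw [h4, h2] at h
  exact lt_of_mul_lt_mul_right (by linarith) h3.le

lemma IsPerron.radius_nonneg {x : V → ℝ} (hx : IsPerron p G x) (i : V) :
    0 ≤ pSomborRadius p G := by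
  have h := hx.sum_eq i
  have h2 : 0 ≤ ∑ j, pSomborMatrix p G i j * x j :=
    Finset.sum_nonneg fun j _ => mul_nonneg (pSomborMatrix_nonneg _ _) (hx.pos j).le
  rw [h] at h2
  exact nonneg_of_mul_nonneg_left h2 (hx.pos i)

/-- The square of the spectral radius bounds the diagonal of `S ^ 2`. -/
lemma IsPerron.sum_sq_le {x : V → ℝ} (hx : IsPerron p G x) (i : V) :
    ∑ j, pSomborMatrix p G i j ^ 2 ≤ pSomborRadius p G ^ 2 := by
  have h1 : ∀ j, pSomborMatrix p G i j * x i ≤ pSomborRadius p G * x j := by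
    intro j
    rw [← hx.sum_eq j, pSomborMatrix_comm]
    exact Finset.single_le_sum (f := fun k => pSomborMatrix p G j k * x k)
      (fun k _ => mul_nonneg (pSomborMatrix_nonneg _ _) (hx.pos k).le) (Finset.mem_univ i)
  refine le_of_mul_le_mul_right ?_ (hx.pos i)
  calc (∑ j, pSomborMatrix p G i j ^ 2) * x i
      = ∑ j, pSomborMatrix p G i j * (pSomborMatrix p G i j * x i) := by
        rw [Finset.sum_mul]; exact Finset.sum_congr rfl fun j _ => by ring
    _ ≤ ∑ j, pSomborMatrix p G i j * (pSomborRadius p G * x j) :=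
        Finset.sum_le_sum fun j _ => mul_le_mul_of_nonneg_left (h1 j) (pSomborMatrix_nonneg _ _)
    _ = pSomborRadius p G * ∑ j, pSomborMatrix p G i j * x j := by
        rw [Finset.mul_sum]; exact Finset.sum_congr rfl fun j _ => by ring
    _ = _ := by rw [hx.sum_eq]; ring

lemma pSomborRadius_le_of_iso {W : Type*} [Fintype W] [Nonempty V] {H : SimpleGraph W}
    (e : G ≃g H) : pSomborRadius p G ≤ pSomborRadius p H := by
  classical
  have : Nonempty W := Nonempty.map e inferInstance
  obtain ⟨v, hv⟩ := (isGreatest_pSomborRadius p G).1.exists_hasEigenvector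
  have hv1 : pSomborMatrix p G *ᵥ v = pSomborRadius p G • v := by
    rw [← Matrix.toLin'_apply]; exact hv.apply_eq_smul
  have hS : ∀ i j, pSomborMatrix p H (e i) (e j) = pSomborMatrix p G i j := by
    intro i j
    by_cases h : G.Adj i j
    · rw [pSomborMatrix_of_adj h, pSomborMatrix_of_adj (e.map_adj_iff.2 h), edgeWt, edgeWt,
        deg_congr, deg_congr]
    · rw [pSomborMatrix_of_not_adj h, pSomborMatrix_of_not_adj (mt e.map_adj_iff.1 h)]
  refine (isGreatest_pSomborRadius p H).2 ?_
  refine Module.End.hasEigenvalue_of_hasEigenvector (x := fun j => v (e.symm j))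
    ⟨Module.End.mem_eigenspace_iff.2 ?_, ?_⟩
  · rw [Matrix.toLin'_apply]
    ext j
    have h := congrFun hv1 (e.symm j)
    simp only [Matrix.mulVec, dotProduct, Pi.smul_apply, smul_eq_mul] at h ⊢
    rw [← h, ← Equiv.sum_comp e.toEquiv]
    refine Finset.sum_congr rfl fun i _ => ?_
    have := hS (e.symm j) i
    simp only [RelIso.apply_symm_apply] at this
    simp [← this]
  · intro h0
    apply hv.2
    ext i
    have := congrFun h0 (e i)
    simpa using this

lemma pSomborRadius_congr {W : Type*} [Fintype W] [Nonempty V] {H : SimpleGraph W}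
    (e : G ≃g H) : pSomborRadius p G = pSomborRadius p H := by
  have : Nonempty W := Nonempty.map e inferInstance
  exact le_antisymm (pSomborRadius_le_of_iso e) (pSomborRadius_le_of_iso e.symm)

end PSombor

namespace PSombor

open scoped Matrix

/-! ### Moving edges from one vertex to another -/

variable {V : Type*} {p : ℝ} {G : SimpleGraph V} {u v : V} {A : Set V}

/-- The graph obtained from `G` by replacing, for each `a ∈ A`, the edge `va` by the edge `ua`. -/
def shift (G : SimpleGraph V) (u v : V) (A : Set V) : SimpleGraph V :=
  G.deleteEdges ((fun a => s(v, a)) '' A) ⊔ SimpleGraph.fromEdgeSet ((fun a => s(u, a)) '' A)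

/-- The neighbours of `v` in `A` can be moved to `u`: none of them is `u` or a neighbour of `u`. -/
structure Shiftable (G : SimpleGraph V) (u v : V) (A : Set V) : Prop where
  ne : u ≠ v
  adj : ∀ a ∈ A, G.Adj v a
  not_adj : ∀ a ∈ A, ¬ G.Adj u a
  notMem : u ∉ A

lemma Shiftable.notMem_right (h : Shiftable G u v A) : v ∉ A := fun hv => (h.adj v hv).ne rfl

lemma Shiftable.shift_adj (h : Shiftable G u v A) (x y : V) :
    (shift G u v A).Adj x y ↔
      (G.Adj x y ∧ ¬ (x = v ∧ y ∈ A) ∧ ¬ (y = v ∧ x ∈ A)) ∨ (x = u ∧ y ∈ A) ∨ (y = u ∧ x ∈ A) := by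
  simp only [shift, SimpleGraph.sup_adj, SimpleGraph.deleteEdges_adj, Set.mem_image, Sym2.eq,
    Sym2.rel_iff', Prod.mk.injEq, Prod.swap_prod_mk, SimpleGraph.fromEdgeSet_adj, not_exists,
    not_and, not_or]
  have hu := h.notMem
  constructor
  · rintro (⟨h1, h2⟩ | ⟨⟨a, ha, (⟨rfl, rfl⟩ | ⟨rfl, rfl⟩)⟩, hne⟩)
    · refine Or.inl ⟨h1, fun hx hy => ?_, fun hy hx => ?_⟩
      · exact (h2 y hy).1 hx.symm rfl
      · exact (h2 x hx).2 hy.symm rfl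
    · exact Or.inr (Or.inl ⟨rfl, ha⟩)
    · exact Or.inr (Or.inr ⟨rfl, ha⟩)
  · rintro (⟨h1, h2, h3⟩ | ⟨rfl, h1⟩ | ⟨rfl, h1⟩)
    · refine Or.inl ⟨h1, fun a ha => ⟨?_, ?_⟩⟩
      · rintro rfl rfl; exact h2 rfl ha
      · rintro rfl rfl; exact h3 rfl ha
    · exact Or.inr ⟨⟨y, h1, Or.inl ⟨rfl, rfl⟩⟩, fun e => hu (e ▸ h1)⟩
    · exact Or.inr ⟨⟨x, h1, Or.inr ⟨rfl, rfl⟩⟩, fun e => hu (e ▸ h1)⟩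

lemma Shiftable.shift_adj_left (h : Shiftable G u v A) (w : V) :
    (shift G u v A).Adj u w ↔ G.Adj u w ∨ w ∈ A := by
  rw [h.shift_adj]
  have h1 := h.ne
  have h2 := h.notMem
  tauto

lemma Shiftable.shift_adj_right (h : Shiftable G u v A) (w : V) :
    (shift G u v A).Adj v w ↔ G.Adj v w ∧ w ∉ A := by
  rw [h.shift_adj]
  have h1 := h.ne.symm
  have h2 := h.notMem_right
  tauto

lemma Shiftable.shift_adj_of_ne (h : Shiftable G u v A) {x y : V} (hxu : x ≠ u) (hxv : x ≠ v)
    (hyu : y ≠ u) (hyv : y ≠ v) : (shift G u v A).Adj x y ↔ G.Adj x y := by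
  rw [h.shift_adj]
  tauto

/-- Moving edges to `u` keeps a graph connected as soon as `v` keeps a path to `u`. -/
lemma Shiftable.shift_connected (h : Shiftable G u v A) (hG : G.Connected)
    (huv : G.Adj u v ∨ ∃ w, G.Adj u w ∧ G.Adj v w) : (shift G u v A).Connected := by
  have hr : (shift G u v A).Reachable u v := by
    rcases huv with huv | ⟨w, hu, hv⟩
    · exact (((h.shift_adj_left v).2 (Or.inl huv))).reachable
    · have hwA : w ∉ A := fun hw => h.not_adj w hw hu
      exact ((h.shift_adj_left w).2 (Or.inl hu)).reachable.trans
        ((h.shift_adj_right w).2 ⟨hv, hwA⟩).symm.reachable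
  have hstep : ∀ x y, G.Adj x y → (shift G u v A).Reachable x y := by
    intro x y hxy
    by_cases h1 : x = v ∧ y ∈ A
    · obtain ⟨rfl, hy⟩ := h1
      exact hr.symm.trans ((h.shift_adj_left y).2 (Or.inr hy)).reachable
    by_cases h2 : y = v ∧ x ∈ A
    · obtain ⟨rfl, hx⟩ := h2
      exact ((h.shift_adj_left x).2 (Or.inr hx)).symm.reachable.trans hr
    exact ((h.shift_adj x y).2 (Or.inl ⟨hxy, h1, h2⟩)).reachable
  have := hG.nonempty
  refine ⟨fun x y => ?_⟩
  obtain ⟨w⟩ := hG.preconnected x y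
  induction w with
  | nil => exact SimpleGraph.Reachable.refl _
  | cons h' _ ih => exact (hstep _ _ h').trans ih

variable [Fintype V]

lemma Shiftable.shift_ncard_edgeSet (h : Shiftable G u v A) :
    (shift G u v A).edgeSet.ncard = G.edgeSet.ncard := by
  have hD : ((fun a => s(v, a)) '' A) ⊆ G.edgeSet := by
    rintro _ ⟨a, ha, rfl⟩; exact h.adj a ha
  have hinj : ∀ w : V, Function.Injective fun a => s(w, a) := fun w a b hab =>
    Sym2.congr_right.1 hab
  have hF : SimpleGraph.edgeSet (SimpleGraph.fromEdgeSet ((fun a => s(u, a)) '' A))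
      = (fun a => s(u, a)) '' A := by
    rw [SimpleGraph.edgeSet_fromEdgeSet, sdiff_eq_left, Set.disjoint_left]
    rintro _ ⟨a, ha, rfl⟩ hd
    exact h.notMem ((Sym2.mk_isDiag_iff.1 hd : u = a) ▸ ha)
  have hdisj : Disjoint (G.edgeSet \ (fun a => s(v, a)) '' A) ((fun a => s(u, a)) '' A) := by
    rw [Set.disjoint_left]
    rintro _ he ⟨a, ha, rfl⟩
    exact h.not_adj a ha he.1
  rw [shift, SimpleGraph.edgeSet_sup, SimpleGraph.edgeSet_deleteEdges, hF,
    Set.ncard_union_eq hdisj (Set.toFinite _) (Set.toFinite _),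
    Set.ncard_image_of_injective _ (hinj u), ← Set.ncard_image_of_injective A (hinj v)]
  exact Set.ncard_sdiff_add_ncard_of_subset hD

lemma Shiftable.shift_isUnicyclic (h : Shiftable G u v A) (hG : IsUnicyclic G)
    (huv : G.Adj u v ∨ ∃ w, G.Adj u w ∧ G.Adj v w) : IsUnicyclic (shift G u v A) :=
  ⟨h.shift_connected hG.1 huv, by rw [h.shift_ncard_edgeSet, hG.2]⟩

lemma Shiftable.deg_shift_left (h : Shiftable G u v A) :
    deg (shift G u v A) u = deg G u + A.ncard := by
  have : (shift G u v A).neighborSet u = G.neighborSet u ∪ A := by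
    ext w; simp [h.shift_adj_left]
  rw [deg, this, Set.ncard_union_eq _ (Set.toFinite _) (Set.toFinite _), deg]
  rw [Set.disjoint_left]
  exact fun w hw hA => h.not_adj w hA hw

lemma Shiftable.deg_shift_right (h : Shiftable G u v A) :
    deg (shift G u v A) v + A.ncard = deg G v := by
  have : (shift G u v A).neighborSet v = G.neighborSet v \ A := by
    ext w; simp [h.shift_adj_right]
  rw [deg, this, deg]
  exact Set.ncard_sdiff_add_ncard_of_subset h.adj

lemma Shiftable.deg_shift_of_ne (h : Shiftable G u v A) {w : V} (hu : w ≠ u) (hv : w ≠ v) :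
    deg (shift G u v A) w = deg G w := by
  by_cases hw : w ∈ A
  · have h1 : (shift G u v A).neighborSet w = insert u (G.neighborSet w \ {v}) := by
      ext y
      simp only [SimpleGraph.mem_neighborSet, h.shift_adj, Set.mem_insert_iff, Set.mem_sdiff,
        Set.mem_singleton_iff]
      tauto
    have h2 : u ∉ G.neighborSet w \ {v} := fun hu' => h.not_adj w hw hu'.1.symm
    have h3 : v ∈ G.neighborSet w := (h.adj w hw).symm
    rw [deg, h1, Set.ncard_insert_of_notMem h2, Set.ncard_sdiff_singleton_add_one h3, deg]
  · have h1 : (shift G u v A).neighborSet w = G.neighborSet w := by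
      ext y
      simp only [SimpleGraph.mem_neighborSet, h.shift_adj]
      tauto
    rw [deg, h1, deg]

lemma Shiftable.shift_matrix_left (h : Shiftable G u v A) {w : V} (hu : w ≠ u) (hv : w ≠ v)
    (hw : G.Adj u w ∨ w ∈ A) :
    pSomborMatrix p (shift G u v A) u w = wt p (deg G u + A.ncard) (deg G w) := by
  rw [pSomborMatrix_of_adj ((h.shift_adj_left w).2 hw), edgeWt, h.deg_shift_left,
    h.deg_shift_of_ne hu hv, Nat.cast_add]

lemma Shiftable.shift_matrix_right (h : Shiftable G u v A) {w : V} (hu : w ≠ u) (hv : w ≠ v)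
    (hw : G.Adj v w) (hwA : w ∉ A) :
    pSomborMatrix p (shift G u v A) v w = wt p (deg G v - A.ncard) (deg G w) := by
  rw [pSomborMatrix_of_adj ((h.shift_adj_right w).2 ⟨hw, hwA⟩), edgeWt, ← h.deg_shift_right,
    h.deg_shift_of_ne hu hv, Nat.cast_add, add_sub_cancel_right]

omit [Fintype V] in
lemma sum_sum_eq_of_support [Fintype V] [DecidableEq V] {E : V → V → ℝ} (x : V → ℝ) (huv : u ≠ v)
    (hE : ∀ i j, E i j = E j i)
    (h0 : ∀ i j, i ≠ u → i ≠ v → j ≠ u → j ≠ v → E i j = 0) (hu : E u u = 0) (hv : E v v = 0) :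
    ∑ i, ∑ j, E i j * (x i * x j)
      = 2 * ∑ w ∈ ({u, v} : Finset V)ᶜ, (E u w * x u + E v w * x v) * x w
        + 2 * (E u v * (x u * x v)) := by
  have hsplit : ∀ f : V → ℝ, ∑ i, f i = f u + f v + ∑ w ∈ ({u, v} : Finset V)ᶜ, f w := by
    intro f
    rw [← Finset.sum_add_sum_compl {u, v} f, Finset.sum_pair huv]
  have hrow : ∀ i ∈ ({u, v} : Finset V)ᶜ, ∑ j, E i j * (x i * x j)
      = (E u i * x u + E v i * x v) * x i := by
    intro i hi
    simp only [Finset.mem_compl, Finset.mem_insert, Finset.mem_singleton, not_or] at hi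
    rw [hsplit, Finset.sum_eq_zero, hE i u, hE i v]
    · ring
    · intro j hj
      simp only [Finset.mem_compl, Finset.mem_insert, Finset.mem_singleton, not_or] at hj
      rw [h0 i j hi.1 hi.2 hj.1 hj.2, zero_mul]
  rw [hsplit, Finset.sum_congr rfl hrow, hsplit fun j => E u j * (x u * x j),
    hsplit fun j => E v j * (x v * x j), hu, hv, hE v u, two_mul, two_mul]
  have : ∑ w ∈ ({u, v} : Finset V)ᶜ, (E u w * x u + E v w * x v) * x w
      = ∑ w ∈ ({u, v} : Finset V)ᶜ, E u w * (x u * x w)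
        + ∑ w ∈ ({u, v} : Finset V)ᶜ, E v w * (x v * x w) := by
    rw [← Finset.sum_add_distrib]
    exact Finset.sum_congr rfl fun w _ => by ring
  rw [this]
  ring

/-- The gain of the quadratic form at the vertex `w` when the edges `va`, `a ∈ A`, are moved
to `u`. -/
noncomputable def shiftGain (p : ℝ) (G : SimpleGraph V) (u v : V) (A : Set V) (x : V → ℝ)
    (w : V) : ℝ :=
  (pSomborMatrix p (shift G u v A) u w - pSomborMatrix p G u w) * x u
    + (pSomborMatrix p (shift G u v A) v w - pSomborMatrix p G v w) * x v

/-- Only the gains at vertices other than `u` and `v` need to be added up, since the edge `uv`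
itself does not lose weight. -/
lemma Shiftable.radius_lt_of_gain [DecidableEq V] (h : Shiftable G u v A) (hp : 2 ≤ p) {x : V → ℝ}
    (hx : IsPerron p G x) (hdeg : deg G v ≤ deg G u + A.ncard)
    (hgain : 0 < ∑ w ∈ ({u, v} : Finset V)ᶜ, shiftGain p G u v A x w * x w) :
    pSomborRadius p G < pSomborRadius p (shift G u v A) := by
  have : Nonempty V := ⟨u⟩
  refine hx.lt_of_sum_pos ?_
  rw [sum_sum_eq_of_support (u := u) (v := v) x h.ne]
  · have h1 : 0 ≤ pSomborMatrix p (shift G u v A) u v - pSomborMatrix p G u v := by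
      by_cases huv : G.Adj u v
      · rw [pSomborMatrix_of_adj huv, pSomborMatrix_of_adj ((h.shift_adj_left v).2 (Or.inl huv)),
          edgeWt, edgeWt, h.deg_shift_left, ← h.deg_shift_right, sub_nonneg]
        rw [← h.deg_shift_right] at hdeg
        have := wt_le_wt_of_spread (p := p) (a := deg G u)
          (b := (deg (shift G u v A) v + A.ncard : ℕ)) (k := A.ncard) hp (by positivity)
          (by push_cast; linarith [(deg (shift G u v A) v).cast_nonneg (α := ℝ)])
          (by positivity) (by exact_mod_cast hdeg)
        simpa using this
      · rw [pSomborMatrix_of_not_adj huv, sub_zero]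
        exact pSomborMatrix_nonneg _ _
    have h2 := mul_nonneg h1 (mul_pos (hx.pos u) (hx.pos v)).le
    simp only [shiftGain] at hgain
    linarith
  · intro i j
    rw [pSomborMatrix_comm, pSomborMatrix_comm (G := G)]
  · intro i j hiu hiv hju hjv
    by_cases hij : G.Adj i j
    · rw [pSomborMatrix_of_adj hij,
        pSomborMatrix_of_adj ((h.shift_adj_of_ne hiu hiv hju hjv).2 hij), edgeWt, edgeWt,
        h.deg_shift_of_ne hiu hiv, h.deg_shift_of_ne hju hjv, sub_self]
    · rw [pSomborMatrix_of_not_adj hij,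
        pSomborMatrix_of_not_adj (mt (h.shift_adj_of_ne hiu hiv hju hjv).1 hij), sub_self]
  · simp [pSomborMatrix_of_not_adj]
  · simp [pSomborMatrix_of_not_adj]

/-- The private neighbours of `v` relative to `u`. -/
def privateNbrs (G : SimpleGraph V) (u v : V) : Set V := {a | G.Adj v a ∧ ¬ G.Adj u a ∧ a ≠ u}

omit [Fintype V] in
lemma shiftable_privateNbrs (huv : u ≠ v) : Shiftable G u v (privateNbrs G u v) :=
  ⟨huv, fun _ h => h.1, fun _ h => h.2.1, fun h => h.2.2 rfl⟩

/-- Moving all private neighbours of `v` to a vertex `u` with a private neighbour and a Perron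
entry at least as large increases the spectral radius. -/
lemma radius_lt_shift_privateNbrs (hp : 2 ≤ p) {x : V → ℝ} (hx : IsPerron p G x) (huv : u ≠ v)
    (hxuv : x v ≤ x u) {a b : V} (ha : a ∈ privateNbrs G u v) (hb : b ∈ privateNbrs G v u) :
    pSomborRadius p G < pSomborRadius p (shift G u v (privateNbrs G u v)) := by
  classical
  set A := privateNbrs G u v with hA
  have h : Shiftable G u v A := shiftable_privateNbrs huv
  have hdeg' : deg (shift G u v A) v ≤ deg G u := by
    have hsub : (shift G u v A).neighborSet v ⊆ insert u (G.neighborSet u \ {b}) := by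
      intro w hw
      rw [SimpleGraph.mem_neighborSet, h.shift_adj_right] at hw
      simp only [Set.mem_insert_iff, Set.mem_sdiff, SimpleGraph.mem_neighborSet,
        Set.mem_singleton_iff]
      by_cases hwu : w = u
      · exact Or.inl hwu
      · refine Or.inr ⟨?_, fun hwb => hb.2.1 (hwb ▸ hw.1)⟩
        by_contra hn
        exact hw.2 ⟨hw.1, hn, hwu⟩
    calc deg (shift G u v A) v ≤ (insert u (G.neighborSet u \ {b})).ncard :=
          Set.ncard_le_ncard hsub (Set.toFinite _)
      _ ≤ (G.neighborSet u \ {b}).ncard + 1 := Set.ncard_insert_le _ _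
      _ = deg G u := Set.ncard_sdiff_singleton_add_one (by exact hb.1)
  have hdv := h.deg_shift_right
  refine h.radius_lt_of_gain hp hx (by omega) ?_
  have hdv' : (deg G v : ℝ) = deg (shift G u v A) v + A.ncard := by exact_mod_cast hdv.symm
  have hdeg'' : (deg (shift G u v A) v : ℝ) ≤ deg G u := by exact_mod_cast hdeg'
  -- the gain at a neighbour of `u`
  have hinc : ∀ w, wt p (deg G u) (deg G w) ≤ wt p (deg G u + A.ncard) (deg G w) := fun w =>
    wt_le_wt hp (by positivity) (by positivity) (by linarith [(A.ncard).cast_nonneg (α := ℝ)])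
      le_rfl
  have hnonneg : ∀ w, w ≠ u → w ≠ v → 0 ≤ shiftGain p G u v A x w := by
    intro w hwu hwv
    unfold shiftGain
    by_cases hwA : w ∈ A
    · rw [h.shift_matrix_left hwu hwv (Or.inr hwA), pSomborMatrix_of_not_adj (h.not_adj w hwA),
        pSomborMatrix_of_not_adj (mt (h.shift_adj_right w).1 fun h' => h'.2 hwA),
        pSomborMatrix_of_adj (h.adj w hwA), edgeWt]
      have h1 : wt p (deg G v) (deg G w) ≤ wt p (deg G u + A.ncard) (deg G w) :=
        wt_le_wt hp (by positivity) (by positivity) (by linarith) le_rfl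
      have h2 := mul_le_mul h1 hxuv (hx.pos v).le
        (wt_nonneg p (by positivity) (by positivity))
      linarith
    · by_cases hu : G.Adj u w
      · rw [h.shift_matrix_left hwu hwv (Or.inl hu), pSomborMatrix_of_adj hu, edgeWt]
        by_cases hv : G.Adj v w
        · rw [h.shift_matrix_right hwu hwv hv hwA, pSomborMatrix_of_adj hv, edgeWt]
          have h1 := wt_increment_mono (p := p) (c := deg G w) (a := deg (shift G u v A) v)
            (b := deg G u) (k := A.ncard) hp (by positivity) (by positivity) hdeg''
            (by positivity)
          rw [← hdv'] at h1
          rw [show (deg G v : ℝ) - A.ncard = deg (shift G u v A) v by linarith]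
          have h2 := hinc w
          nlinarith [hx.pos v, mul_le_mul_of_nonneg_left hxuv (sub_nonneg.2 h2),
            mul_le_mul_of_nonneg_right h1 (hx.pos v).le]
        · rw [pSomborMatrix_of_not_adj hv,
            pSomborMatrix_of_not_adj (mt (h.shift_adj_right w).1 fun h' => hv h'.1), sub_self,
            zero_mul, add_zero]
          exact mul_nonneg (sub_nonneg.2 (hinc w)) (hx.pos u).le
      · have hv : ¬ G.Adj v w := fun hv => hwA ⟨hv, hu, hwu⟩
        rw [pSomborMatrix_of_not_adj hu, pSomborMatrix_of_not_adj hv,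
          pSomborMatrix_of_not_adj (mt (h.shift_adj_left w).1 (not_or.2 ⟨hu, hwA⟩)),
          pSomborMatrix_of_not_adj (mt (h.shift_adj_right w).1 fun h' => hv h'.1)]
        simp
  have hbu : b ≠ u := hb.1.ne'
  have hA0 : A.Nonempty := ⟨a, ha⟩
  refine Finset.sum_pos' (fun w hw => ?_) ⟨b, ?_, ?_⟩
  · simp only [Finset.mem_compl, Finset.mem_insert, Finset.mem_singleton, not_or] at hw
    exact mul_nonneg (hnonneg w hw.1 hw.2) (hx.pos w).le
  · simp only [Finset.mem_compl, Finset.mem_insert, Finset.mem_singleton, not_or]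
    exact ⟨hbu, hb.2.2⟩
  · refine mul_pos ?_ (hx.pos b)
    unfold shiftGain
    rw [h.shift_matrix_left hbu hb.2.2 (Or.inl hb.1), pSomborMatrix_of_adj hb.1,
      edgeWt, pSomborMatrix_of_not_adj hb.2.1,
      pSomborMatrix_of_not_adj (mt (h.shift_adj_right b).1 fun h' => hb.2.1 h'.1), sub_self,
      zero_mul, add_zero]
    have h1 : (0 : ℝ) < A.ncard := by exact_mod_cast (Set.ncard_pos (Set.toFinite _)).2 hA0
    exact mul_pos (sub_pos.2 (wt_lt_wt hp (by positivity) (by positivity) (by linarith)))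
      (hx.pos u)

end PSombor

namespace PSombor

/-! ### Spanning trees given by a parent map -/

variable {V : Type*} {G : SimpleGraph V} {r : V} {f : V → V} {h : V → ℕ}

/-- `f` assigns to every vertex other than the root `r` a neighbour of smaller height. -/
def IsParentMap (G : SimpleGraph V) (r : V) (f : V → V) (h : V → ℕ) : Prop :=
  ∀ x, x ≠ r → G.Adj x (f x) ∧ h (f x) < h x

/-- The pair `x`, `y` is an edge of the tree with parent map `f`. -/
def TreeAdj (r : V) (f : V → V) (x y : V) : Prop := (x ≠ r ∧ y = f x) ∨ (y ≠ r ∧ x = f y)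

/-- The edges of the tree with parent map `f`. -/
def treeEdges (r : V) (f : V → V) : Set (Sym2 V) := (fun x => s(x, f x)) '' {x | x ≠ r}

lemma mem_treeEdges {x y : V} : s(x, y) ∈ treeEdges r f ↔ TreeAdj r f x y := by
  simp only [treeEdges, Set.mem_image, Set.mem_ofPred_eq, TreeAdj, Sym2.eq_iff]
  constructor
  · rintro ⟨z, hz, ⟨rfl, rfl⟩ | ⟨rfl, rfl⟩⟩
    · exact Or.inl ⟨hz, rfl⟩
    · exact Or.inr ⟨hz, rfl⟩
  · rintro (⟨h1, rfl⟩ | ⟨h1, rfl⟩)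
    · exact ⟨x, h1, Or.inl ⟨rfl, rfl⟩⟩
    · exact ⟨y, h1, Or.inr ⟨rfl, rfl⟩⟩

lemma IsParentMap.treeEdges_subset (hf : IsParentMap G r f h) : treeEdges r f ⊆ G.edgeSet := by
  rintro _ ⟨x, hx, rfl⟩
  exact (hf x hx).1

lemma IsParentMap.connected (hf : IsParentMap G r f h) : G.Connected := by
  have hr : ∀ k x, h x ≤ k → G.Reachable x r := by
    intro k
    induction k with
    | zero =>
      intro x hx
      by_cases hxr : x = r
      · rw [hxr]
      · have := (hf x hxr).2
        omega
    | succ k ih =>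
      intro x hx
      by_cases hxr : x = r
      · rw [hxr]
      · have h1 := hf x hxr
        exact h1.1.reachable.trans (ih _ (by omega))
  have : Nonempty V := ⟨r⟩
  exact ⟨fun x y => (hr _ x le_rfl).trans (hr _ y le_rfl).symm⟩

variable [Fintype V]

lemma IsParentMap.ncard_treeEdges (hf : IsParentMap G r f h) :
    (treeEdges r f).ncard + 1 = Fintype.card V := by
  have hinj : Set.InjOn (fun x => s(x, f x)) {x | x ≠ r} := by
    intro x hx y hy hxy
    simp only [Sym2.eq_iff] at hxy
    rcases hxy with h1 | ⟨h1, h2⟩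
    · exact h1.1
    · have h3 := (hf x hx).2
      have h4 := (hf y hy).2
      rw [h2] at h3
      rw [← h1] at h4
      omega
  rw [treeEdges, hinj.ncard_image]
  have h1 : {x | x ≠ r} = Set.univ \ {r} := by ext; simp
  rw [h1, Set.ncard_sdiff_singleton_add_one (Set.mem_univ r), Set.ncard_univ,
    Nat.card_eq_fintype_card]

/-- A graph with as many edges as vertices has exactly one edge outside a spanning tree. -/
lemma IsParentMap.exists_extra_edge (hf : IsParentMap G r f h)
    (hG : G.edgeSet.ncard = Fintype.card V) :
    ∃ a b, G.Adj a b ∧ ¬ TreeAdj r f a b ∧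
      ∀ x y, G.Adj x y → TreeAdj r f x y ∨ (x = a ∧ y = b) ∨ (x = b ∧ y = a) := by
  have h1 := Set.ncard_sdiff_add_ncard_of_subset hf.treeEdges_subset
  have h2 := hf.ncard_treeEdges
  have h3 : (G.edgeSet \ treeEdges r f).ncard = 1 := by omega
  obtain ⟨e, he⟩ := Set.ncard_eq_one.1 h3
  induction e with
  | _ a b =>
    have hab : s(a, b) ∈ G.edgeSet \ treeEdges r f := by rw [he]; rfl
    refine ⟨a, b, hab.1, fun ht => hab.2 (mem_treeEdges.2 ht), fun x y hxy => ?_⟩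
    by_cases ht : TreeAdj r f x y
    · exact Or.inl ht
    · have : s(x, y) ∈ G.edgeSet \ treeEdges r f := ⟨hxy, fun hm => ht (mem_treeEdges.1 hm)⟩
      rw [he, Set.mem_singleton_iff, Sym2.eq_iff] at this
      exact Or.inr this

lemma IsParentMap.isUnicyclic (hf : IsParentMap G r f h) {a b : V} (hab : G.Adj a b)
    (hT : ¬ TreeAdj r f a b)
    (hall : ∀ x y, G.Adj x y → TreeAdj r f x y ∨ (x = a ∧ y = b) ∨ (x = b ∧ y = a)) :
    IsUnicyclic G := by
  refine ⟨hf.connected, ?_⟩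
  have h1 : G.edgeSet = insert s(a, b) (treeEdges r f) := by
    ext e
    induction e with
    | _ x y =>
      rw [SimpleGraph.mem_edgeSet, Set.mem_insert_iff, mem_treeEdges, Sym2.eq_iff]
      constructor
      · intro hxy
        have := hall x y hxy
        tauto
      · rintro ((⟨rfl, rfl⟩ | ⟨rfl, rfl⟩) | ht)
        · exact hab
        · exact hab.symm
        · exact hf.treeEdges_subset (mem_treeEdges.2 ht)
  rw [h1, Set.ncard_insert_of_notMem fun hm => hT (mem_treeEdges.1 hm), hf.ncard_treeEdges]

/-! ### Recognizing the five extremal graphs -/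

lemma nonempty_iso_of_le {W : Type*} [Fintype W] {H : SimpleGraph W} (hG : IsUnicyclic G)
    (hH : IsUnicyclic H) (φ : W ≃ V) (hφ : ∀ i j, H.Adj i j → G.Adj (φ i) (φ j)) :
    Nonempty (G ≃g H) := by
  have hsub : Sym2.map φ '' H.edgeSet ⊆ G.edgeSet := by
    rintro _ ⟨e, he, rfl⟩
    induction e with
    | _ x y => exact hφ x y he
  have heq := Set.eq_of_subset_of_ncard_le hsub (by
    rw [Set.ncard_image_of_injective _ (Sym2.map.injective φ.injective), hG.2, hH.2,
      Fintype.card_congr φ]) (Set.toFinite _)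
  refine ⟨(⟨φ, fun {i j} => ⟨fun hij => ?_, hφ i j⟩⟩ : H ≃g G).symm⟩
  have h1 : s(φ i, φ j) ∈ Sym2.map φ '' H.edgeSet := by rw [heq]; exact hij
  obtain ⟨e, he, hee⟩ := h1
  have h2 : e = s(i, j) := Sym2.map.injective φ.injective hee
  rwa [h2] at he

/-- The vertices can be labelled so that the labels `0`, `1`, … go to a given list. -/
lemma exists_labelling {n : ℕ} (hV : Fintype.card V = n) {l : List V} (hl : l.Nodup) :
    ∃ φ : Fin n ≃ V, ∀ i : Fin n, ∀ hi : i.val < l.length, φ i = l[i.val] := by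
  classical
  rcases l.eq_nil_or_concat with rfl | ⟨l', x, hlx⟩
  · exact ⟨Fintype.equivOfCardEq (by simp [hV]), fun i hi => absurd hi (by simp)⟩
  obtain ⟨g, hg⟩ := Finset.exists_equiv_extend_of_card_eq (α := Fin n) (β := V)
    (t := Finset.univ) (by simp [hV]) (s := Finset.univ.filter fun i => i.val < l.length)
    (f := fun i => if hi : i.val < l.length then l[i.val] else x) (by simp) (by
      intro i hi j hj hij
      simp only [Finset.coe_filter, Finset.mem_univ, true_and, Set.mem_ofPred_eq] at hi hj
      simp only [hi, hj, dif_pos] at hij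
      exact Fin.ext ((hl.getElem_inj_iff).1 hij))
  refine ⟨g.trans (Equiv.subtypeUnivEquiv fun x => Finset.mem_univ x), fun i hi => ?_⟩
  have h2 := hg i (by simp [hi])
  simp only [Equiv.trans_apply, Equiv.subtypeUnivEquiv_apply]
  rw [h2, dif_pos hi]

lemma isUnicyclic_starPlusEdge {n : ℕ} (hn : 7 ≤ n) : IsUnicyclic (starPlusEdge n) := by
  refine IsParentMap.isUnicyclic (r := ⟨0, by omega⟩) (f := fun _ => ⟨0, by omega⟩)
    (h := fun x => x.val) (a := ⟨1, by omega⟩) (b := ⟨2, by omega⟩) ?_ ?_ ?_ ?_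
  · intro x hx
    simp only [starPlusEdge, SimpleGraph.fromRel_adj, ne_eq, Fin.ext_iff] at *
    grind
  · simp [starPlusEdge, SimpleGraph.fromRel_adj]
  · simp [TreeAdj, Fin.ext_iff]
  · intro x y hxy
    simp only [starPlusEdge, SimpleGraph.fromRel_adj, ne_eq, TreeAdj, Fin.ext_iff] at *
    grind

lemma isUnicyclic_U1 {n : ℕ} (hn : 7 ≤ n) : IsUnicyclic (U1 n) := by
  refine IsParentMap.isUnicyclic (r := ⟨0, by omega⟩)
    (f := fun x => if x.val = 3 then ⟨1, by omega⟩ else ⟨0, by omega⟩)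
    (h := fun x => x.val) (a := ⟨1, by omega⟩) (b := ⟨2, by omega⟩) ?_ ?_ ?_ ?_
  · intro x hx
    simp only [U1, SimpleGraph.fromRel_adj, ne_eq, Fin.ext_iff] at *
    grind
  · simp [U1, SimpleGraph.fromRel_adj]
  · simp [TreeAdj, Fin.ext_iff]
  · intro x y hxy
    simp only [U1, SimpleGraph.fromRel_adj, ne_eq, TreeAdj, Fin.ext_iff] at *
    grind

lemma isUnicyclic_U2 {n : ℕ} (hn : 7 ≤ n) : IsUnicyclic (U2 n) := by
  refine IsParentMap.isUnicyclic (r := ⟨0, by omega⟩)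
    (f := fun x => if x.val = 3 then ⟨4, by omega⟩ else ⟨0, by omega⟩)
    (h := fun x => if x.val = 3 then 5 else x.val) (a := ⟨1, by omega⟩) (b := ⟨2, by omega⟩)
    ?_ ?_ ?_ ?_
  · intro x hx
    simp only [U2, SimpleGraph.fromRel_adj, ne_eq, Fin.ext_iff] at *
    grind
  · simp [U2, SimpleGraph.fromRel_adj]
  · simp [TreeAdj, Fin.ext_iff]
  · intro x y hxy
    simp only [U2, SimpleGraph.fromRel_adj, ne_eq, TreeAdj, Fin.ext_iff] at *
    grind

lemma isUnicyclic_U3 {n : ℕ} (hn : 7 ≤ n) : IsUnicyclic (U3 n) := by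
  refine IsParentMap.isUnicyclic (r := ⟨0, by omega⟩)
    (f := fun x => if x.val = 3 then ⟨1, by omega⟩ else ⟨0, by omega⟩)
    (h := fun x => x.val) (a := ⟨2, by omega⟩) (b := ⟨3, by omega⟩) ?_ ?_ ?_ ?_
  · intro x hx
    simp only [U3, SimpleGraph.fromRel_adj, ne_eq, Fin.ext_iff] at *
    grind
  · simp [U3, SimpleGraph.fromRel_adj]
  · simp [TreeAdj, Fin.ext_iff]
  · intro x y hxy
    simp only [U3, SimpleGraph.fromRel_adj, ne_eq, TreeAdj, Fin.ext_iff] at *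
    grind

lemma isUnicyclic_U4 {n : ℕ} (hn : 7 ≤ n) : IsUnicyclic (U4 n) := by
  refine IsParentMap.isUnicyclic (r := ⟨0, by omega⟩)
    (f := fun x => if x.val = 3 ∨ x.val = 4 then ⟨1, by omega⟩ else ⟨0, by omega⟩)
    (h := fun x => x.val) (a := ⟨1, by omega⟩) (b := ⟨2, by omega⟩) ?_ ?_ ?_ ?_
  · intro x hx
    simp only [U4, SimpleGraph.fromRel_adj, ne_eq, Fin.ext_iff] at *
    grind
  · simp [U4, SimpleGraph.fromRel_adj]
  · simp [TreeAdj, Fin.ext_iff]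
  · intro x y hxy
    simp only [U4, SimpleGraph.fromRel_adj, ne_eq, TreeAdj, Fin.ext_iff] at *
    grind

lemma nonempty_iso_starPlusEdge {n : ℕ} (hn : 7 ≤ n) (hV : Fintype.card V = n)
    (hG : IsUnicyclic G) {c a b : V} (hd : [c, a, b].Nodup) (hc : ∀ y, y ≠ c → G.Adj c y)
    (hab : G.Adj a b) : Nonempty (G ≃g starPlusEdge n) := by
  obtain ⟨φ, hφ⟩ := exists_labelling hV hd
  have h0 : ∀ i : Fin n, i.val = 0 → φ i = c := fun i hi => by simpa [hi] using hφ i (by simp [hi])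
  have h1 : ∀ i : Fin n, i.val = 1 → φ i = a := fun i hi => by simpa [hi] using hφ i (by simp [hi])
  have h2 : ∀ i : Fin n, i.val = 2 → φ i = b := fun i hi => by simpa [hi] using hφ i (by simp [hi])
  have key : ∀ i j : Fin n, i ≠ j → (i.val = 0 ∨ (i.val = 1 ∧ j.val = 2)) →
      G.Adj (φ i) (φ j) := by
    rintro i j hij (hi | ⟨hi, hj⟩)
    · rw [h0 i hi]
      exact hc _ fun hj => hij (φ.injective (by rw [h0 i hi, hj]))
    · rw [h1 i hi, h2 j hj]; exact hab
  refine nonempty_iso_of_le hG (isUnicyclic_starPlusEdge hn) φ fun i j hij => ?_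
  rw [starPlusEdge, SimpleGraph.fromRel_adj] at hij
  exact hij.2.elim (key i j hij.1) fun h => (key j i hij.1.symm h).symm

lemma nonempty_iso_U1 {n : ℕ} (hn : 7 ≤ n) (hV : Fintype.card V = n)
    (hG : IsUnicyclic G) {c a b z : V} (hd : [c, a, b, z].Nodup)
    (hc : ∀ y, y ≠ c → y ≠ z → G.Adj c y) (hab : G.Adj a b) (haz : G.Adj a z) :
    Nonempty (G ≃g U1 n) := by
  obtain ⟨φ, hφ⟩ := exists_labelling hV hd
  have h0 : ∀ i : Fin n, i.val = 0 → φ i = c := fun i hi => by simpa [hi] using hφ i (by simp [hi])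
  have h1 : ∀ i : Fin n, i.val = 1 → φ i = a := fun i hi => by simpa [hi] using hφ i (by simp [hi])
  have h2 : ∀ i : Fin n, i.val = 2 → φ i = b := fun i hi => by simpa [hi] using hφ i (by simp [hi])
  have h3 : ∀ i : Fin n, i.val = 3 → φ i = z := fun i hi => by simpa [hi] using hφ i (by simp [hi])
  have key : ∀ i j : Fin n, i ≠ j → ((i.val = 0 ∧ j.val ≠ 3) ∨ (i.val = 1 ∧ j.val = 2) ∨
      (i.val = 1 ∧ j.val = 3)) → G.Adj (φ i) (φ j) := by
    rintro i j hij (⟨hi, hj⟩ | ⟨hi, hj⟩ | ⟨hi, hj⟩)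
    · rw [h0 i hi]
      refine hc _ (fun hj' => hij (φ.injective (by rw [h0 i hi, hj']))) fun hj' => hj ?_
      rw [φ.injective (hj'.trans (h3 ⟨3, by omega⟩ rfl).symm)]
    · rw [h1 i hi, h2 j hj]; exact hab
    · rw [h1 i hi, h3 j hj]; exact haz
  refine nonempty_iso_of_le hG (isUnicyclic_U1 hn) φ fun i j hij => ?_
  rw [U1, SimpleGraph.fromRel_adj] at hij
  exact hij.2.elim (key i j hij.1) fun h => (key j i hij.1.symm h).symm

lemma nonempty_iso_U2 {n : ℕ} (hn : 7 ≤ n) (hV : Fintype.card V = n)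
    (hG : IsUnicyclic G) {c a b z t : V} (hd : [c, a, b, z, t].Nodup)
    (hc : ∀ y, y ≠ c → y ≠ z → G.Adj c y) (hab : G.Adj a b) (htz : G.Adj t z) :
    Nonempty (G ≃g U2 n) := by
  obtain ⟨φ, hφ⟩ := exists_labelling hV hd
  have h0 : ∀ i : Fin n, i.val = 0 → φ i = c := fun i hi => by simpa [hi] using hφ i (by simp [hi])
  have h1 : ∀ i : Fin n, i.val = 1 → φ i = a := fun i hi => by simpa [hi] using hφ i (by simp [hi])
  have h2 : ∀ i : Fin n, i.val = 2 → φ i = b := fun i hi => by simpa [hi] using hφ i (by simp [hi])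
  have h3 : ∀ i : Fin n, i.val = 3 → φ i = z := fun i hi => by simpa [hi] using hφ i (by simp [hi])
  have h4 : ∀ i : Fin n, i.val = 4 → φ i = t := fun i hi => by simpa [hi] using hφ i (by simp [hi])
  have key : ∀ i j : Fin n, i ≠ j → ((i.val = 0 ∧ j.val ≠ 3) ∨ (i.val = 1 ∧ j.val = 2) ∨
      (i.val = 4 ∧ j.val = 3)) → G.Adj (φ i) (φ j) := by
    rintro i j hij (⟨hi, hj⟩ | ⟨hi, hj⟩ | ⟨hi, hj⟩)
    · rw [h0 i hi]
      refine hc _ (fun hj' => hij (φ.injective (by rw [h0 i hi, hj']))) fun hj' => hj ?_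
      rw [φ.injective (hj'.trans (h3 ⟨3, by omega⟩ rfl).symm)]
    · rw [h1 i hi, h2 j hj]; exact hab
    · rw [h4 i hi, h3 j hj]; exact htz
  refine nonempty_iso_of_le hG (isUnicyclic_U2 hn) φ fun i j hij => ?_
  rw [U2, SimpleGraph.fromRel_adj] at hij
  exact hij.2.elim (key i j hij.1) fun h => (key j i hij.1.symm h).symm

lemma nonempty_iso_U3 {n : ℕ} (hn : 7 ≤ n) (hV : Fintype.card V = n)
    (hG : IsUnicyclic G) {c a b z : V} (hd : [c, a, b, z].Nodup)
    (hc : ∀ y, y ≠ c → y ≠ z → G.Adj c y) (haz : G.Adj a z) (hbz : G.Adj b z) :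
    Nonempty (G ≃g U3 n) := by
  obtain ⟨φ, hφ⟩ := exists_labelling hV hd
  have h0 : ∀ i : Fin n, i.val = 0 → φ i = c := fun i hi => by simpa [hi] using hφ i (by simp [hi])
  have h1 : ∀ i : Fin n, i.val = 1 → φ i = a := fun i hi => by simpa [hi] using hφ i (by simp [hi])
  have h2 : ∀ i : Fin n, i.val = 2 → φ i = b := fun i hi => by simpa [hi] using hφ i (by simp [hi])
  have h3 : ∀ i : Fin n, i.val = 3 → φ i = z := fun i hi => by simpa [hi] using hφ i (by simp [hi])
  have key : ∀ i j : Fin n, i ≠ j → ((i.val = 0 ∧ j.val ≠ 3) ∨ (i.val = 1 ∧ j.val = 3) ∨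
      (i.val = 2 ∧ j.val = 3)) → G.Adj (φ i) (φ j) := by
    rintro i j hij (⟨hi, hj⟩ | ⟨hi, hj⟩ | ⟨hi, hj⟩)
    · rw [h0 i hi]
      refine hc _ (fun hj' => hij (φ.injective (by rw [h0 i hi, hj']))) fun hj' => hj ?_
      rw [φ.injective (hj'.trans (h3 ⟨3, by omega⟩ rfl).symm)]
    · rw [h1 i hi, h3 j hj]; exact haz
    · rw [h2 i hi, h3 j hj]; exact hbz
  refine nonempty_iso_of_le hG (isUnicyclic_U3 hn) φ fun i j hij => ?_
  rw [U3, SimpleGraph.fromRel_adj] at hij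
  exact hij.2.elim (key i j hij.1) fun h => (key j i hij.1.symm h).symm

lemma nonempty_iso_U4 {n : ℕ} (hn : 7 ≤ n) (hV : Fintype.card V = n)
    (hG : IsUnicyclic G) {c a b z z' : V} (hd : [c, a, b, z, z'].Nodup)
    (hc : ∀ y, y ≠ c → y ≠ z → y ≠ z' → G.Adj c y) (hab : G.Adj a b) (haz : G.Adj a z)
    (haz' : G.Adj a z') : Nonempty (G ≃g U4 n) := by
  obtain ⟨φ, hφ⟩ := exists_labelling hV hd
  have h0 : ∀ i : Fin n, i.val = 0 → φ i = c := fun i hi => by simpa [hi] using hφ i (by simp [hi])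
  have h1 : ∀ i : Fin n, i.val = 1 → φ i = a := fun i hi => by simpa [hi] using hφ i (by simp [hi])
  have h2 : ∀ i : Fin n, i.val = 2 → φ i = b := fun i hi => by simpa [hi] using hφ i (by simp [hi])
  have h3 : ∀ i : Fin n, i.val = 3 → φ i = z := fun i hi => by simpa [hi] using hφ i (by simp [hi])
  have h4 : ∀ i : Fin n, i.val = 4 → φ i = z' := fun i hi => by simpa [hi] using hφ i (by simp [hi])
  have key : ∀ i j : Fin n, i ≠ j → ((i.val = 0 ∧ j.val ≠ 3 ∧ j.val ≠ 4) ∨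
      (i.val = 1 ∧ j.val = 2) ∨ (i.val = 1 ∧ j.val = 3) ∨ (i.val = 1 ∧ j.val = 4)) →
      G.Adj (φ i) (φ j) := by
    rintro i j hij (⟨hi, hj, hj4⟩ | ⟨hi, hj⟩ | ⟨hi, hj⟩ | ⟨hi, hj⟩)
    · rw [h0 i hi]
      refine hc _ (fun hj' => hij (φ.injective (by rw [h0 i hi, hj']))) (fun hj' => hj ?_)
        fun hj' => hj4 ?_
      · rw [φ.injective (hj'.trans (h3 ⟨3, by omega⟩ rfl).symm)]
      · rw [φ.injective (hj'.trans (h4 ⟨4, by omega⟩ rfl).symm)]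
    · rw [h1 i hi, h2 j hj]; exact hab
    · rw [h1 i hi, h3 j hj]; exact haz
    · rw [h1 i hi, h4 j hj]; exact haz'
  refine nonempty_iso_of_le hG (isUnicyclic_U4 hn) φ fun i j hij => ?_
  rw [U4, SimpleGraph.fromRel_adj] at hij
  exact hij.2.elim (key i j hij.1) fun h => (key j i hij.1.symm h).symm

omit [Fintype V] in
lemma exists_adj_of_ne (hG : G.Connected) {x y : V} (hxy : x ≠ y) : ∃ z, G.Adj x z := by
  obtain ⟨w⟩ := hG.preconnected x y
  cases w with
  | nil => exact absurd rfl hxy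
  | cons h _ => exact ⟨_, h⟩

lemma nonempty_iso_starPlusEdge_of_adj {n : ℕ} (hn : 7 ≤ n) (hV : Fintype.card V = n)
    (hG : IsUnicyclic G) {c : V} (hc : ∀ y, y ≠ c → G.Adj c y) :
    Nonempty (G ≃g starPlusEdge n) := by
  classical
  have hf : IsParentMap G c (fun _ => c) (fun x => if x = c then 0 else 1) := by
    intro x hx
    exact ⟨(hc x hx).symm, by simp [hx]⟩
  obtain ⟨a, b, hab, hT, -⟩ := hf.exists_extra_edge hG.2
  have h1 := hab.ne
  simp only [TreeAdj, not_or, not_and] at hT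
  have hac : a ≠ c := by rintro rfl; exact hT.2 h1.symm rfl
  have hbc : b ≠ c := by rintro rfl; exact hT.1 h1 rfl
  refine nonempty_iso_starPlusEdge hn hV hG (c := c) (a := a) (b := b) ?_ hc hab
  simp [h1, hac.symm, hbc.symm]

/-- A unicyclic graph of order `n` with a vertex of degree at least `n - 2` is one of the first
four extremal graphs. -/
lemma nonempty_iso_of_le_deg {n : ℕ} (hn : 7 ≤ n) (hV : Fintype.card V = n)
    (hG : IsUnicyclic G) {c : V} (hc : n ≤ deg G c + 2) :
    Nonempty (G ≃g starPlusEdge n) ∨ Nonempty (G ≃g U1 n) ∨ Nonempty (G ≃g U2 n) ∨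
      Nonempty (G ≃g U3 n) := by
  classical
  by_cases hall : ∀ y, y ≠ c → G.Adj c y
  · exact Or.inl (nonempty_iso_starPlusEdge_of_adj hn hV hG hall)
  right
  push Not at hall
  obtain ⟨z, hzc, hz⟩ := hall
  have hcy : ∀ y, y ≠ c → y ≠ z → G.Adj c y := by
    intro y hyc hyz
    by_contra hy
    have h1 : (G.neighborSet c ∪ {c, z, y}).ncard ≤ n := by
      rw [← hV, ← Nat.card_eq_fintype_card]; exact Set.ncard_le_card _
    rw [Set.ncard_union_eq] at h1
    · have h2 : ({c, z, y} : Set V).ncard = 3 := by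
        rw [Set.ncard_eq_three]
        exact ⟨c, z, y, hzc.symm, hyc.symm, hyz.symm, rfl⟩
      unfold deg at hc
      omega
    · rw [Set.disjoint_left]
      rintro w hw (rfl | rfl | rfl)
      · exact hw.ne rfl
      · exact hz hw
      · exact hy hw
  obtain ⟨t, ht⟩ := exists_adj_of_ne hG.1 hzc
  have htc : t ≠ c := by rintro rfl; exact hz ht.symm
  have hf : IsParentMap G c (fun x => if x = z then t else c)
      (fun x => if x = c then 0 else if x = z then 2 else 1) := by
    intro x hx
    by_cases hxz : x = z
    · subst hxz
      simp [hx, ht, htc, ht.ne']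
    · simp [hx, hxz, (hcy x hx hxz).symm]
  obtain ⟨a, b, hab, hT, -⟩ := hf.exists_extra_edge hG.2
  simp only [TreeAdj, not_or, not_and] at hT
  obtain ⟨hT1, hT2⟩ := hT
  have hne := hab.ne
  -- the extra edge avoids the centre
  have hac : a ≠ c := by
    rintro rfl
    by_cases hbz : b = z
    · exact hz (hbz ▸ hab)
    · exact hT2 hne.symm (by simp [hbz])
  have hbc : b ≠ c := by
    rintro rfl
    by_cases haz : a = z
    · exact hz (haz ▸ hab.symm)
    · exact hT1 hne (by simp [haz])
  by_cases haz : a = z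
  · subst haz
    have hbt : b ≠ t := by simpa using hT1 hac
    exact Or.inr (Or.inr (nonempty_iso_U3 hn hV hG (c := c) (a := t) (b := b) (z := a)
      (by simp [htc.symm, hbc.symm, hzc.symm, hbt.symm, ht.ne', hne.symm]) hcy ht.symm hab.symm))
  by_cases hbz : b = z
  · subst hbz
    have hat : a ≠ t := by simpa using hT2 hbc
    exact Or.inr (Or.inr (nonempty_iso_U3 hn hV hG (c := c) (a := t) (b := a) (z := b)
      (by simp [htc.symm, hac.symm, hzc.symm, hat.symm, ht.ne', hne]) hcy ht.symm hab))
  by_cases hat : a = t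
  · subst hat
    exact Or.inl (nonempty_iso_U1 hn hV hG (c := c) (a := a) (b := b) (z := z)
      (by simp [hac.symm, hbc.symm, hzc.symm, haz, hbz, hne]) hcy hab ht.symm)
  by_cases hbt : b = t
  · subst hbt
    exact Or.inl (nonempty_iso_U1 hn hV hG (c := c) (a := b) (b := a) (z := z)
      (by simp [hac.symm, hbc.symm, hzc.symm, haz, hbz, hne.symm]) hcy hab.symm ht.symm)
  exact Or.inr (Or.inl (nonempty_iso_U2 hn hV hG (c := c) (a := a) (b := b) (z := z) (t := t)
    (by simp [hac.symm, hbc.symm, hzc.symm, htc.symm, haz, hbz, hat, hbt, hne, ht.ne])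
    hcy hab ht.symm))

end PSombor

namespace PSombor

open scoped Matrix

/-! ### The order of the first four graphs -/

variable {V : Type*} [Fintype V] {p : ℝ} {G : SimpleGraph V}

/-- The eigenvalue equation at a vertex whose neighbours are listed. -/
lemma IsPerron.sum_neighbors {x : V → ℝ} (hx : IsPerron p G x) {i : V} {s : Finset V}
    (hs : ∀ j, G.Adj i j ↔ j ∈ s) :
    ∑ j ∈ s, edgeWt p G i j * x j = pSomborRadius p G * x i := by
  rw [← hx.sum_eq i, ← Finset.sum_subset (Finset.subset_univ s)]
  · exact Finset.sum_congr rfl fun j hj => by rw [pSomborMatrix_of_adj ((hs j).2 hj)]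
  · intro j _ hj
    rw [pSomborMatrix_of_not_adj (mt (hs j).1 hj), zero_mul]

omit [Fintype V] in
lemma deg_eq_card {i : V} {s : Finset V} (hs : ∀ j, G.Adj i j ↔ j ∈ s) : deg G i = s.card := by
  have : G.neighborSet i = s := by ext j; simpa using hs j
  rw [deg, this, Set.ncard_coe_finset]

/-- The star at a vertex of degree `d` forces `d ^ 3 ≤ ρ ^ 2`. -/
lemma IsPerron.deg_pow_three_le {x : V → ℝ} (hx : IsPerron p G x) (hp : 2 ≤ p) (i : V) :
    (deg G i : ℝ) ^ 3 ≤ pSomborRadius p G ^ 2 := by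
  classical
  refine le_trans ?_ (hx.sum_sq_le i)
  set s := Finset.univ.filter fun j => G.Adj i j
  have hs : deg G i = s.card := deg_eq_card fun j => by simp [s]
  calc (deg G i : ℝ) ^ 3 = ∑ _j ∈ s, (deg G i : ℝ) ^ 2 := by
        rw [Finset.sum_const, ← hs, nsmul_eq_mul]; ring
    _ ≤ ∑ j ∈ s, pSomborMatrix p G i j ^ 2 := by
        refine Finset.sum_le_sum fun j hj => ?_
        rw [pSomborMatrix_of_adj (by simpa [s] using hj)]
        exact pow_le_pow_left₀ (by positivity) (le_wt hp (by positivity) (by positivity)) 2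
    _ ≤ _ := Finset.sum_le_sum_of_subset_of_nonneg (Finset.subset_univ s)
        fun _ _ _ => sq_nonneg _

/-- In `U_1` the two vertices of the triangle with pendent vertices are adjacent and have private
neighbours; moving those of either one to the other gives `S_n + e`. -/
lemma radius_U1_lt {n : ℕ} (hn : 7 ≤ n) (hp : 2 ≤ p) :
    pSomborRadius p (U1 n) < pSomborRadius p (starPlusEdge n) := by
  have hU := isUnicyclic_U1 hn
  obtain ⟨x, hx⟩ := exists_isPerron hp hU.1
  have : Nonempty (Fin n) := hU.1.nonempty
  set c : Fin n := ⟨0, by omega⟩ with hc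
  set a : Fin n := ⟨1, by omega⟩ with ha
  have hca : (U1 n).Adj c a := by simp [U1, SimpleGraph.fromRel_adj, hc, ha]
  have hz : (⟨3, by omega⟩ : Fin n) ∈ privateNbrs (U1 n) c a := by
    simp [privateNbrs, U1, SimpleGraph.fromRel_adj, hc, ha]
  have hy : (⟨4, by omega⟩ : Fin n) ∈ privateNbrs (U1 n) a c := by
    simp [privateNbrs, U1, SimpleGraph.fromRel_adj, hc, ha]
  -- `c` and `a` together dominate the graph
  have hdom : ∀ y : Fin n, y ≠ c → y ≠ a → (U1 n).Adj c y ∨ (U1 n).Adj a y := by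
    intro y h1 h2
    simp only [U1, SimpleGraph.fromRel_adj, hc, ha, ne_eq, Fin.ext_iff] at *
    grind
  have hmain : ∀ u v : Fin n, (U1 n).Adj u v → (∀ y, y ≠ u → y ≠ v →
      (U1 n).Adj u y ∨ (U1 n).Adj v y) →
      pSomborRadius p (shift (U1 n) u v (privateNbrs (U1 n) u v))
        = pSomborRadius p (starPlusEdge n) := by
    intro u v huv hd
    have hs := shiftable_privateNbrs (G := U1 n) huv.ne
    obtain ⟨e⟩ := nonempty_iso_starPlusEdge_of_adj hn (by simp)
      (hs.shift_isUnicyclic hU (Or.inl huv)) (c := u) (fun y hy => by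
        rw [hs.shift_adj_left]
        by_cases hyv : y = v
        · exact Or.inl (hyv ▸ huv)
        · by_cases huy : (U1 n).Adj u y
          · exact Or.inl huy
          · exact Or.inr ⟨(hd y hy hyv).resolve_left huy, huy, hy⟩)
    exact pSomborRadius_congr e
  rcases le_total (x a) (x c) with hxx | hxx
  · rw [← hmain c a hca hdom]
    exact radius_lt_shift_privateNbrs hp hx hca.ne hxx hz hy
  · rw [← hmain a c hca.symm fun y h1 h2 => (hdom y h2 h1).symm]
    exact radius_lt_shift_privateNbrs hp hx hca.ne' hxx hy hz

/-- In `U_2` a vertex of the triangle other than the centre and the middle vertex of the pendent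
path have private neighbours; moving that of either one to the other gives `U_1`. -/
lemma radius_U2_lt {n : ℕ} (hn : 7 ≤ n) (hp : 2 ≤ p) :
    pSomborRadius p (U2 n) < pSomborRadius p (U1 n) := by
  have hU := isUnicyclic_U2 hn
  obtain ⟨x, hx⟩ := exists_isPerron hp hU.1
  have : Nonempty (Fin n) := hU.1.nonempty
  set c : Fin n := ⟨0, by omega⟩ with hc
  set a : Fin n := ⟨1, by omega⟩ with ha
  set b : Fin n := ⟨2, by omega⟩ with hb
  set z : Fin n := ⟨3, by omega⟩ with hz
  set t : Fin n := ⟨4, by omega⟩ with ht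
  have hadj : ∀ y, y ≠ c → y ≠ z → (U2 n).Adj c y := by
    intro y h1 h2
    simp only [U2, SimpleGraph.fromRel_adj, hc, hz, ne_eq, Fin.ext_iff] at *
    grind
  have hat : a ≠ t := by simp [ha, ht]
  have hza : z ∈ privateNbrs (U2 n) a t := by
    simp [privateNbrs, U2, SimpleGraph.fromRel_adj, ha, hz, ht]
  have hbt : b ∈ privateNbrs (U2 n) t a := by
    simp [privateNbrs, U2, SimpleGraph.fromRel_adj, ha, hb, ht]
  have hca := hadj a (by simp [ha, hc]) (by simp [ha, hz])
  have hct := hadj t (by simp [ht, hc]) (by simp [ht, hz])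
  have hmain : ∀ u v : Fin n, u ≠ v → u ≠ c → v ≠ c → u ≠ b → u ≠ z → (U2 n).Adj c u →
      (U2 n).Adj c v →
      ((U2 n).Adj u b ∨ (U2 n).Adj v b) → ((U2 n).Adj u z ∨ (U2 n).Adj v z) →
      pSomborRadius p (shift (U2 n) u v (privateNbrs (U2 n) u v)) = pSomborRadius p (U1 n) := by
    intro u v huv huc hvc hub huz hcu hcv h1 h2
    have hs := shiftable_privateNbrs (G := U2 n) huv
    have hu : ∀ y, y ≠ u → ((U2 n).Adj u y ∨ (U2 n).Adj v y) →
        (shift (U2 n) u v (privateNbrs (U2 n) u v)).Adj u y := by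
      intro y hy hd
      rw [hs.shift_adj_left]
      by_cases huy : (U2 n).Adj u y
      · exact Or.inl huy
      · exact Or.inr ⟨hd.resolve_left huy, huy, hy⟩
    obtain ⟨e⟩ := nonempty_iso_U1 hn (by simp)
      (hs.shift_isUnicyclic hU (Or.inr ⟨c, hcu.symm, hcv.symm⟩)) (c := c) (a := u) (b := b)
      (z := z) (by
        have : c ≠ b := by simp [hc, hb]
        have h3 : c ≠ z := by simp [hc, hz]
        have h4 : b ≠ z := by simp [hb, hz]
        simp [huc.symm, this, h3, h4, hub, huz]) (fun y h3 h4 => by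
        rw [hs.shift_adj]
        refine Or.inl ⟨hadj y h3 h4, fun h => hvc h.1.symm, ?_⟩
        rintro ⟨-, h⟩
        exact h.2.1 hcu.symm) (hu b hub.symm h1) (hu z huz.symm h2)
    exact pSomborRadius_congr e
  rcases le_total (x t) (x a) with hxx | hxx
  · rw [← hmain a t hat (by simp [ha, hc]) (by simp [ht, hc]) (by simp [ha, hb])
      (by simp [ha, hz]) hca hct (Or.inl hbt.1) (Or.inr hza.1)]
    exact radius_lt_shift_privateNbrs hp hx hat hxx hza hbt
  · rw [← hmain t a hat.symm (by simp [ht, hc]) (by simp [ha, hc]) (by simp [ht, hb])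
      (by simp [ht, hz]) hct hca (Or.inr hbt.1) (Or.inl hza.1)]
    exact radius_lt_shift_privateNbrs hp hx hat.symm hxx hbt hza

lemma deg_U3_zero {n : ℕ} (hn : 7 ≤ n) : deg (U3 n) ⟨0, by omega⟩ = n - 2 := by
  rw [deg_eq_card (s := {(⟨0, by omega⟩ : Fin n), ⟨3, by omega⟩}ᶜ), Finset.card_compl,
    Finset.card_pair (by simp), Fintype.card_fin]
  intro j
  simp only [U3, SimpleGraph.fromRel_adj, ne_eq, Fin.ext_iff, Finset.mem_compl, Finset.mem_insert,
    Finset.mem_singleton]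
  grind

/-- In the Perron vector of `U_3` the entry `xz` at the vertex opposite the centre is a small
multiple of the entry `xt` at a pendent vertex. -/
lemma lt_of_cycle_equations {m lam cc d W W1 xa xb xz xc xt : ℝ} (hm : 5 ≤ m)
    (hlam : m ^ 3 ≤ lam ^ 2) (hlam0 : 0 ≤ lam) (hc2 : cc ^ 2 ≤ 8) (hc0 : 2 ≤ cc) (hd : 2 ≤ d)
    (hW : W ^ 2 ≤ 2 ^ 2 + m ^ 2) (hW0 : 0 ≤ W) (hW1 : m ≤ W1) (hxc : 0 < xc)
    (hEa : W * xc + cc * xz = lam * xa) (hEb : W * xc + cc * xz = lam * xb)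
    (hEz : cc * xa + cc * xb = lam * xz) (hEt : W1 * xc = lam * xt) :
    xb = xa ∧ (2 * cc - d) * xz < cc * xt := by
  have hlam11 : 11 ≤ lam := by
    have : (125 : ℝ) ≤ m ^ 3 := by
      calc (125 : ℝ) = 5 ^ 3 := by norm_num
        _ ≤ m ^ 3 := by gcongr
    nlinarith
  have hxab : xb = xa := mul_left_cancel₀ (by linarith : lam ≠ 0) (by rw [← hEa, ← hEb])
  refine ⟨hxab, ?_⟩
  rw [hxab] at hEz
  have hcc : cc ≤ 2.83 := by nlinarith
  have hWW : W ≤ 1.08 * W1 := by nlinarith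
  have h1 : (lam ^ 2 - 2 * cc ^ 2) * xz = 2 * cc * W * xc := by
    linear_combination (-lam) * hEz + (-2 * cc) * hEa
  have h3 : (2 * cc - d) * W ≤ 3.66 * (1.08 * W1) :=
    mul_le_mul (by linarith) hWW hW0 (by norm_num)
  have h4 : 7.92 * lam < lam ^ 2 - 2 * cc ^ 2 := by nlinarith
  have hW1' : 0 < W1 := by linarith
  have h2 : 2 * (2 * cc - d) * W * lam < W1 * (lam ^ 2 - 2 * cc ^ 2) := by
    have h5 := mul_lt_mul_of_pos_left h4 hW1'
    have h6 := mul_le_mul_of_nonneg_right h3 hlam0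
    have h7 : 0 < W1 * lam := by positivity
    linarith
  have h5 : 0 < lam ^ 2 - 2 * cc ^ 2 := by linarith
  have h6 : lam * (lam ^ 2 - 2 * cc ^ 2) * ((2 * cc - d) * xz)
      < lam * (lam ^ 2 - 2 * cc ^ 2) * (cc * xt) := by
    have e1 : lam * (lam ^ 2 - 2 * cc ^ 2) * ((2 * cc - d) * xz)
        = cc * xc * (2 * (2 * cc - d) * W * lam) := by
      linear_combination (lam * (2 * cc - d)) * h1
    have e2 : lam * (lam ^ 2 - 2 * cc ^ 2) * (cc * xt)
        = cc * xc * (W1 * (lam ^ 2 - 2 * cc ^ 2)) := by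
      linear_combination (-(lam ^ 2 - 2 * cc ^ 2) * cc) * hEt
    rw [e1, e2]
    exact mul_lt_mul_of_pos_left h2 (by positivity)
  exact lt_of_mul_lt_mul_left h6 (by positivity)

/-- Replacing one of the two edges at the vertex `z` of `U_3` opposite the centre by an edge to a
pendent vertex `t` gives `U_2`. The Perron entry is small at `z`, so the quadratic form
increases. -/
lemma radius_U3_lt {n : ℕ} (hn : 7 ≤ n) (hp : 2 ≤ p) :
    pSomborRadius p (U3 n) < pSomborRadius p (U2 n) := by
  have hU := isUnicyclic_U3 hn
  obtain ⟨x, hx⟩ := exists_isPerron hp hU.1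
  have : Nonempty (Fin n) := hU.1.nonempty
  have hd0 := deg_U3_zero hn
  set c : Fin n := ⟨0, by omega⟩ with hc
  set a : Fin n := ⟨1, by omega⟩ with ha
  set b : Fin n := ⟨2, by omega⟩ with hb
  set z : Fin n := ⟨3, by omega⟩ with hz
  set t : Fin n := ⟨4, by omega⟩ with ht
  have hNa : ∀ j, (U3 n).Adj a j ↔ j ∈ ({c, z} : Finset (Fin n)) := by
    intro j
    simp only [U3, SimpleGraph.fromRel_adj, ha, hc, hz, ne_eq, Fin.ext_iff, Finset.mem_insert,
      Finset.mem_singleton]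
    grind
  have hNb : ∀ j, (U3 n).Adj b j ↔ j ∈ ({c, z} : Finset (Fin n)) := by
    intro j
    simp only [U3, SimpleGraph.fromRel_adj, hb, hc, hz, ne_eq, Fin.ext_iff, Finset.mem_insert,
      Finset.mem_singleton]
    grind
  have hNz : ∀ j, (U3 n).Adj z j ↔ j ∈ ({a, b} : Finset (Fin n)) := by
    intro j
    simp only [U3, SimpleGraph.fromRel_adj, ha, hb, hz, ne_eq, Fin.ext_iff, Finset.mem_insert,
      Finset.mem_singleton]
    grind
  have hNt : ∀ j, (U3 n).Adj t j ↔ j ∈ ({c} : Finset (Fin n)) := by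
    intro j
    simp only [U3, SimpleGraph.fromRel_adj, ht, hc, ne_eq, Fin.ext_iff, Finset.mem_singleton]
    grind
  have hcz : c ≠ z := by simp [hc, hz]
  have hab : a ≠ b := by simp [ha, hb]
  have hat : a ≠ t := by simp [ha, ht]
  have hbt : b ≠ t := by simp [hb, ht]
  have haz : a ≠ z := by simp [ha, hz]
  have hbz : b ≠ z := by simp [hb, hz]
  have hct : c ≠ t := by simp [hc, ht]
  have htz : t ≠ z := by simp [hz, ht]
  have hca : c ≠ a := by simp [hc, ha]
  have hcb : c ≠ b := by simp [hc, hb]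
  have hda : deg (U3 n) a = 2 := by rw [deg_eq_card hNa, Finset.card_pair hcz]
  have hdb : deg (U3 n) b = 2 := by rw [deg_eq_card hNb, Finset.card_pair hcz]
  have hdz : deg (U3 n) z = 2 := by rw [deg_eq_card hNz, Finset.card_pair hab]
  have hdt : deg (U3 n) t = 1 := by rw [deg_eq_card hNt, Finset.card_singleton]
  set A : Set (Fin n) := {b} with hA
  have hs : Shiftable (U3 n) t z A := by
    refine ⟨htz, ?_, ?_, ?_⟩
    · rintro _ rfl; exact (hNz b).2 (by simp)
    · rintro _ rfl; rw [hNt]; simpa using hcb.symm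
    · simpa [hA] using hbt.symm
  have hA1 : A.ncard = 1 := Set.ncard_singleton _
  -- the shifted graph is `U2`
  have hU' : IsUnicyclic (shift (U3 n) t z A) := by
    refine ⟨?_, by rw [hs.shift_ncard_edgeSet, hU.2]⟩
    have htr : ∀ y, y ≠ c → y ≠ z → (shift (U3 n) t z A).Adj c y := by
      intro y h1 h2
      rw [hs.shift_adj]
      refine Or.inl ⟨?_, fun h => hcz h.1, fun h => h2 h.1⟩
      simp only [U3, SimpleGraph.fromRel_adj, hc, hz, ne_eq, Fin.ext_iff] at *
      grind
    have haz' : (shift (U3 n) t z A).Adj z a :=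
      (hs.shift_adj_right a).2 ⟨(hNz a).2 (by simp), by simpa [hA] using hab⟩
    have hr : ∀ y, (shift (U3 n) t z A).Reachable c y := by
      intro y
      by_cases h1 : y = c
      · rw [h1]
      by_cases h2 : y = z
      · rw [h2]; exact (htr a hca.symm haz).reachable.trans haz'.symm.reachable
      · exact (htr y h1 h2).reachable
    exact ⟨fun y w => (hr y).symm.trans (hr w)⟩
  obtain ⟨e⟩ := nonempty_iso_U2 hn (by simp) hU' (c := c) (a := t) (b := b) (z := z) (t := a)
    (by simp [hct, hcb, hcz, hca, hbt.symm, htz, hat.symm, hbz, hab.symm, haz.symm])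
    (by
      intro y h1 h2
      rw [hs.shift_adj]
      refine Or.inl ⟨?_, fun h => hcz h.1, fun h => h2 h.1⟩
      simp only [U3, SimpleGraph.fromRel_adj, hc, hz, ne_eq, Fin.ext_iff] at *
      grind)
    ((hs.shift_adj_left b).2 (Or.inr rfl))
    ((hs.shift_adj_right a).2 ⟨(hNz a).2 (by simp), by simpa [hA] using hab⟩).symm
  rw [← pSomborRadius_congr e]
  -- eigenvalue equations
  have hEa := hx.sum_neighbors hNa
  have hEb := hx.sum_neighbors hNb
  have hEz := hx.sum_neighbors hNz
  have hEt := hx.sum_neighbors hNt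
  rw [Finset.sum_pair hcz] at hEa hEb
  rw [Finset.sum_pair hab] at hEz
  rw [Finset.sum_singleton] at hEt
  have hlam := hx.deg_pow_three_le hp c
  have hlam0 := hx.radius_nonneg c
  simp only [edgeWt, hda, hdb, hdz, hdt, hd0] at hEa hEb hEz hEt hlam
  set m : ℝ := ((n - 2 : ℕ) : ℝ) with hm
  have hm5 : 5 ≤ m := by rw [hm]; exact_mod_cast (by omega : 5 ≤ n - 2)
  refine hs.radius_lt_of_gain hp hx (by rw [hdz, hdt, hA1]) ?_
  have hsub : ({a, b} : Finset (Fin n)) ⊆ ({t, z} : Finset (Fin n))ᶜ := by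
    intro y hy
    simp only [Finset.mem_insert, Finset.mem_singleton] at hy
    rcases hy with rfl | rfl <;> simp [*]
  have hnonneg : ∀ w ∈ ({t, z} : Finset (Fin n))ᶜ, w ∉ ({a, b} : Finset (Fin n)) →
      0 ≤ shiftGain p (U3 n) t z A x w * x w := by
    intro w hw hwab
    simp only [Finset.mem_compl, Finset.mem_insert, Finset.mem_singleton, not_or] at hw hwab
    refine mul_nonneg ?_ (hx.pos w).le
    have hzw : ¬ (U3 n).Adj z w := by rw [hNz]; simp [hwab]
    have hzw' : ¬ (shift (U3 n) t z A).Adj z w := fun h => hzw ((hs.shift_adj_right w).1 h).1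
    rw [shiftGain, pSomborMatrix_of_not_adj hzw, pSomborMatrix_of_not_adj hzw', sub_self, zero_mul,
      add_zero]
    refine mul_nonneg (sub_nonneg.2 ?_) (hx.pos t).le
    by_cases htw : (U3 n).Adj t w
    · rw [hs.shift_matrix_left hw.1 hw.2 (Or.inl htw), pSomborMatrix_of_adj htw, edgeWt]
      exact wt_le_wt hp (by positivity) (by positivity)
        (by linarith [(A.ncard).cast_nonneg (α := ℝ)]) le_rfl
    · rw [pSomborMatrix_of_not_adj htw]
      exact pSomborMatrix_nonneg _ _
  refine lt_of_lt_of_le ?_ (Finset.sum_le_sum_of_subset_of_nonneg hsub hnonneg)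
  have hta : ¬ (U3 n).Adj t a := by rw [hNt]; simpa using hca.symm
  have htb : ¬ (U3 n).Adj t b := by rw [hNt]; simpa using hcb.symm
  have hza : (U3 n).Adj z a := (hNz a).2 (by simp)
  have hzb : (U3 n).Adj z b := (hNz b).2 (by simp)
  have haA : a ∉ A := by simpa [hA] using hab
  have hbA : b ∈ A := by simp [hA]
  rw [Finset.sum_pair hab, shiftGain, shiftGain, hs.shift_matrix_right hat haz hza haA,
    pSomborMatrix_of_adj hza, edgeWt, pSomborMatrix_of_not_adj hta,
    pSomborMatrix_of_not_adj (mt (hs.shift_adj_left a).1 (not_or.2 ⟨hta, haA⟩)),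
    hs.shift_matrix_left hbt hbz (Or.inr hbA), pSomborMatrix_of_not_adj htb,
    pSomborMatrix_of_not_adj (mt (hs.shift_adj_right b).1 fun h => h.2 hbA),
    pSomborMatrix_of_adj hzb, edgeWt, hda, hdb, hdz, hdt, hA1]
  norm_num only [Nat.cast_ofNat, Nat.cast_one] at hEa hEb hEz hEt hlam ⊢
  have hc2 : wt p 2 2 ^ 2 ≤ 8 := (wt_sq_le hp (by norm_num) (by norm_num)).trans (by norm_num)
  have hc0 : 2 ≤ wt p 2 2 := le_wt hp (by norm_num) (by norm_num)
  have hd2 : 2 ≤ wt p 1 2 := by rw [wt_comm]; exact le_wt hp (by norm_num) (by norm_num)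
  have hW : wt p 2 m ^ 2 ≤ 2 ^ 2 + m ^ 2 := wt_sq_le hp (by norm_num) (by linarith)
  have hW1 : m ≤ wt p 1 m := by rw [wt_comm]; exact le_wt hp (by linarith) (by norm_num)
  have hW0 : 0 ≤ wt p 2 m := wt_nonneg p (by norm_num) (by linarith)
  have key := lt_of_cycle_equations hm5 hlam hlam0 hc2 hc0 hd2 hW hW0 hW1 (hx.pos c) hEa hEb hEz hEt
  have hxa := hx.pos a
  rw [key.1]
  have h2 := mul_pos (sub_pos.2 key.2) hxa
  linarith

end PSombor

namespace PSombor

open scoped Matrix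

/-! ### The fifth graph -/

variable {V : Type*} [Fintype V] {p : ℝ} {G : SimpleGraph V}

/-- The eigenvalue equation at a vertex `i`, after the entries at the pendent neighbours `P` of `i`
have been eliminated. -/
lemma IsPerron.sum_neighbors_pendant [DecidableEq V] {x : V → ℝ} (hx : IsPerron p G x) {i : V}
    {P s : Finset V} (hs : ∀ j, G.Adj i j ↔ j ∈ P ∪ s) (hd : Disjoint P s)
    (hP : ∀ j ∈ P, ∀ y, G.Adj j y ↔ y = i) :
    (pSomborRadius p G ^ 2 - P.card * wt p (deg G i) 1 ^ 2) * x i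
      = pSomborRadius p G * ∑ j ∈ s, edgeWt p G i j * x j := by
  have h1 := hx.sum_neighbors hs
  rw [Finset.sum_union hd] at h1
  have h2 : pSomborRadius p G * ∑ j ∈ P, edgeWt p G i j * x j
      = P.card * wt p (deg G i) 1 ^ 2 * x i := by
    rw [Finset.mul_sum, Finset.sum_congr rfl fun j hj => ?_, Finset.sum_const, nsmul_eq_mul,
      mul_assoc]
    have hj' : ∀ y, G.Adj j y ↔ y ∈ ({i} : Finset V) := by simpa using hP j hj
    have h3 := hx.sum_neighbors hj'
    have h4 : deg G j = 1 := by rw [deg_eq_card hj', Finset.card_singleton]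
    rw [Finset.sum_singleton, edgeWt_comm] at h3
    have h5 : edgeWt p G i j = wt p (deg G i) 1 := by rw [edgeWt, h4, Nat.cast_one]
    rw [← h5]
    linear_combination (-edgeWt p G i j) * h3
  linear_combination (-pSomborRadius p G) * h1 + h2

/-- The Perron equations of `U_4` at the centre, at the vertex of degree four and at the third
vertex of the triangle, with the pendent vertices eliminated. -/
lemma exists_radius_U4_equations {n : ℕ} (hn : 7 ≤ n) (hp : 2 ≤ p) :
    ∃ lam xc xa xb : ℝ, lam = pSomborRadius p (U4 n) ∧ 0 ≤ lam ∧ 0 < xc ∧ 0 < xa ∧ 0 < xb ∧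
      (lam ^ 2 - (n - 5) * wt p (n - 3) 1 ^ 2) * xc
        = lam * (wt p (n - 3) 4 * xa + wt p (n - 3) 2 * xb) ∧
      (lam ^ 2 - 2 * wt p 4 1 ^ 2) * xa = lam * (wt p (n - 3) 4 * xc + wt p 4 2 * xb) ∧
      wt p (n - 3) 2 * xc + wt p 4 2 * xa = lam * xb := by
  have hU := isUnicyclic_U4 hn
  obtain ⟨x, hx⟩ := exists_isPerron hp hU.1
  set c : Fin n := ⟨0, by omega⟩ with hc
  set a : Fin n := ⟨1, by omega⟩ with ha
  set b : Fin n := ⟨2, by omega⟩ with hb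
  set z : Fin n := ⟨3, by omega⟩ with hz
  set t : Fin n := ⟨4, by omega⟩ with ht
  have hab : a ≠ b := by simp [ha, hb]
  have hcb : c ≠ b := by simp [hc, hb]
  have hca : c ≠ a := by simp [hc, ha]
  have hzt : z ≠ t := by simp [hz, ht]
  set P : Finset (Fin n) := {c, a, b, z, t}ᶜ with hP
  have hPcard : P.card = n - 5 := by
    have h5 : ({c, a, b, z, t} : Finset (Fin n)).card = 5 := by
      simp [hc, ha, hb, hz, ht]
    rw [hP, Finset.card_compl, h5, Fintype.card_fin]
  have hNc : ∀ j, (U4 n).Adj c j ↔ j ∈ P ∪ {a, b} := by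
    intro j
    simp only [hP, U4, SimpleGraph.fromRel_adj, ha, hc, hz, hb, ht, ne_eq, Fin.ext_iff,
      Finset.mem_union, Finset.mem_compl, Finset.mem_insert, Finset.mem_singleton]
    grind
  have hNa : ∀ j, (U4 n).Adj a j ↔ j ∈ ({z, t} : Finset (Fin n)) ∪ {c, b} := by
    intro j
    simp only [U4, SimpleGraph.fromRel_adj, ha, hc, hz, hb, ht, ne_eq, Fin.ext_iff,
      Finset.mem_union, Finset.mem_insert, Finset.mem_singleton]
    grind
  have hNb : ∀ j, (U4 n).Adj b j ↔ j ∈ ({c, a} : Finset (Fin n)) := by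
    intro j
    simp only [U4, SimpleGraph.fromRel_adj, ha, hc, hb, ne_eq, Fin.ext_iff,
      Finset.mem_insert, Finset.mem_singleton]
    grind
  have hNP : ∀ j ∈ P, ∀ y, (U4 n).Adj j y ↔ y = c := by
    intro j hj y
    simp only [hP, U4, SimpleGraph.fromRel_adj, ha, hc, hz, hb, ht, ne_eq, Fin.ext_iff,
      Finset.mem_compl, Finset.mem_insert, Finset.mem_singleton] at *
    grind
  have hNz : ∀ j ∈ ({z, t} : Finset (Fin n)), ∀ y, (U4 n).Adj j y ↔ y = a := by
    intro j hj y
    simp only [U4, SimpleGraph.fromRel_adj, ha, hz, ht, ne_eq, Fin.ext_iff,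
      Finset.mem_insert, Finset.mem_singleton] at *
    grind
  have hd1 : Disjoint P {a, b} := by
    rw [Finset.disjoint_left]; intro y hy; simp only [hP, Finset.mem_compl] at hy; aesop
  have hd2 : Disjoint ({z, t} : Finset (Fin n)) {c, b} := by
    simp [hz, ht, hc, hb]
  have hdc : deg (U4 n) c = n - 3 := by
    rw [deg_eq_card hNc, Finset.card_union_of_disjoint hd1, hPcard, Finset.card_pair hab]; omega
  have hda : deg (U4 n) a = 4 := by
    rw [deg_eq_card hNa, Finset.card_union_of_disjoint hd2, Finset.card_pair hzt,
      Finset.card_pair hcb]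
  have hdb : deg (U4 n) b = 2 := by rw [deg_eq_card hNb, Finset.card_pair hca]
  have e1 := hx.sum_neighbors_pendant hNc hd1 hNP
  have e2 := hx.sum_neighbors_pendant hNa hd2 hNz
  have e3 := hx.sum_neighbors hNb
  rw [Finset.sum_pair hab, hPcard] at e1
  rw [Finset.sum_pair hcb, Finset.card_pair hzt] at e2
  rw [Finset.sum_pair hca] at e3
  simp only [edgeWt, hdc, hda, hdb] at e1 e2 e3
  rw [Nat.cast_sub (by omega), Nat.cast_sub (by omega)] at e1
  rw [Nat.cast_sub (by omega)] at e2 e3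
  push_cast at e1 e2 e3
  refine ⟨_, x c, x a, x b, rfl, hx.radius_nonneg c, hx.pos c, hx.pos a, hx.pos b, e1, ?_, ?_⟩
  · rw [wt_comm p (n - 3 : ℝ) 4]; exact e2
  · rw [wt_comm p (n - 3 : ℝ) 2, wt_comm p 4 2]; exact e3

/-- The spectral radius of `U_3` satisfies a quadratic equation in its square. -/
lemma radius_U3_equation {n : ℕ} (hn : 7 ≤ n) (hp : 2 ≤ p) :
    ∃ mu : ℝ, mu = pSomborRadius p (U3 n) ∧ 0 ≤ mu ∧ ((n : ℝ) - 2) ^ 3 ≤ mu ^ 2 ∧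
      (mu ^ 2 - (n - 4) * wt p (n - 2) 1 ^ 2) * (mu ^ 2 - 2 * wt p 2 2 ^ 2)
        = 2 * mu ^ 2 * wt p (n - 2) 2 ^ 2 := by
  have hU := isUnicyclic_U3 hn
  obtain ⟨x, hx⟩ := exists_isPerron hp hU.1
  have hdc := deg_U3_zero hn
  set c : Fin n := ⟨0, by omega⟩ with hc
  set a : Fin n := ⟨1, by omega⟩ with ha
  set b : Fin n := ⟨2, by omega⟩ with hb
  set z : Fin n := ⟨3, by omega⟩ with hz
  have hab : a ≠ b := by simp [ha, hb]
  have hcz : c ≠ z := by simp [hc, hz]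
  set P : Finset (Fin n) := {c, a, b, z}ᶜ with hP
  have hPcard : P.card = n - 4 := by
    have h5 : ({c, a, b, z} : Finset (Fin n)).card = 4 := by
      simp [hc, ha, hb, hz]
    rw [hP, Finset.card_compl, h5, Fintype.card_fin]
  have hNc : ∀ j, (U3 n).Adj c j ↔ j ∈ P ∪ {a, b} := by
    intro j
    simp only [hP, U3, SimpleGraph.fromRel_adj, ha, hc, hz, hb, ne_eq, Fin.ext_iff,
      Finset.mem_union, Finset.mem_compl, Finset.mem_insert, Finset.mem_singleton]
    grind
  have hNa : ∀ j, (U3 n).Adj a j ↔ j ∈ ({c, z} : Finset (Fin n)) := by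
    intro j
    simp only [U3, SimpleGraph.fromRel_adj, ha, hc, hz, ne_eq, Fin.ext_iff, Finset.mem_insert,
      Finset.mem_singleton]
    grind
  have hNb : ∀ j, (U3 n).Adj b j ↔ j ∈ ({c, z} : Finset (Fin n)) := by
    intro j
    simp only [U3, SimpleGraph.fromRel_adj, hb, hc, hz, ne_eq, Fin.ext_iff, Finset.mem_insert,
      Finset.mem_singleton]
    grind
  have hNz : ∀ j, (U3 n).Adj z j ↔ j ∈ ({a, b} : Finset (Fin n)) := by
    intro j
    simp only [U3, SimpleGraph.fromRel_adj, ha, hb, hz, ne_eq, Fin.ext_iff, Finset.mem_insert,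
      Finset.mem_singleton]
    grind
  have hNP : ∀ j ∈ P, ∀ y, (U3 n).Adj j y ↔ y = c := by
    intro j hj y
    simp only [hP, U3, SimpleGraph.fromRel_adj, ha, hc, hz, hb, ne_eq, Fin.ext_iff,
      Finset.mem_compl, Finset.mem_insert, Finset.mem_singleton] at *
    grind
  have hd1 : Disjoint P {a, b} := by
    rw [Finset.disjoint_left]; intro y hy; simp only [hP, Finset.mem_compl] at hy; aesop
  have hda : deg (U3 n) a = 2 := by rw [deg_eq_card hNa, Finset.card_pair hcz]
  have hdb : deg (U3 n) b = 2 := by rw [deg_eq_card hNb, Finset.card_pair hcz]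
  have hdz : deg (U3 n) z = 2 := by rw [deg_eq_card hNz, Finset.card_pair hab]
  have e1 := hx.sum_neighbors_pendant hNc hd1 hNP
  have e2 := hx.sum_neighbors hNa
  have e3 := hx.sum_neighbors hNb
  have e4 := hx.sum_neighbors hNz
  have hlam := hx.deg_pow_three_le hp c
  rw [Finset.sum_pair hab, hPcard] at e1
  rw [Finset.sum_pair hcz] at e2 e3
  rw [Finset.sum_pair hab] at e4
  simp only [edgeWt, hdc, hda, hdb, hdz] at e1 e2 e3 e4 hlam
  rw [Nat.cast_sub (by omega), Nat.cast_sub (by omega)] at e1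
  rw [Nat.cast_sub (by omega)] at e2 e3 hlam
  push_cast at e1 e2 e3 e4 hlam
  rw [wt_comm p 2 (n - 2 : ℝ)] at e2 e3
  refine ⟨_, rfl, hx.radius_nonneg c, hlam, ?_⟩
  set mu := pSomborRadius p (U3 n)
  set W := wt p (n - 2 : ℝ) 2
  set w := wt p 2 2
  have h1 : (mu ^ 2 - 2 * w ^ 2) * (x a + x b) = 2 * mu * W * x c := by
    linear_combination (-mu) * e2 - mu * e3 - 2 * w * e4
  refine mul_right_cancel₀ (hx.pos c).ne' ?_
  linear_combination (mu ^ 2 - 2 * w ^ 2) * e1 + mu * W * h1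

lemma le_of_sq_le {x y : ℝ} (hy : 0 ≤ y) (h : x ^ 2 ≤ y ^ 2) : x ≤ y :=
  le_of_pow_le_pow_left₀ two_ne_zero hy h

/-- For `n ≥ 8`, where `m = n - 3` is the degree of the centre of `U_4`, the lower bound from the
star at the centre of `U_3` exceeds the spectral radius of `U_4`, already when the weights are
replaced by their upper bounds at `p = 2`. -/
lemma lt_of_center_equations_of_five_le {m lam mu xc xa xb W1 w4 w2 A w : ℝ} (hm : 5 ≤ m)
    (hlam0 : 0 ≤ lam) (hmu0 : 0 ≤ mu) (hmu : (m + 1) ^ 3 ≤ mu ^ 2) (hxc : 0 < xc) (hxa : 0 < xa)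
    (hxb : 0 < xb)
    (hW1 : W1 ^ 2 ≤ m ^ 2 + 1) (hw4 : w4 ^ 2 ≤ m ^ 2 + 16) (hw2 : w2 ^ 2 ≤ m ^ 2 + 4)
    (hw40 : 0 ≤ w4) (hw20 : 0 ≤ w2) (hA : A ^ 2 ≤ 17) (hw : w ^ 2 ≤ 20)
    (e1 : (lam ^ 2 - (m - 2) * W1 ^ 2) * xc = lam * (w4 * xa + w2 * xb))
    (e2 : (lam ^ 2 - 2 * A ^ 2) * xa = lam * (w4 * xc + w * xb))
    (e3 : w2 * xc + w * xa = lam * xb) : lam < mu := by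
  by_contra hcon
  push Not at hcon
  have hX : (m + 1) ^ 3 ≤ lam ^ 2 := hmu.trans (pow_le_pow_left₀ hmu0 hcon 2)
  have h216 : 216 ≤ lam ^ 2 := by
    calc (216 : ℝ) = (5 + 1) ^ 3 := by norm_num
      _ ≤ (m + 1) ^ 3 := by gcongr
      _ ≤ _ := hX
  have hlam : 14.69 ≤ lam := le_of_sq_le hlam0 (by linarith)
  have hwl : w ≤ 0.305 * lam := by
    have : w ≤ 4.48 := le_of_sq_le (by norm_num) (by linarith)
    linarith
  set P := lam * xa with hP
  set Q := lam * xb with hQ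
  have hP0 : 0 < P := by positivity
  have hQ0 : 0 < Q := by positivity
  -- `w * xa ≤ 0.305 * P` and `w * xb ≤ 0.305 * Q`
  have hQle : Q ≤ w2 * xc + 0.305 * P := by
    have : w * xa ≤ 0.305 * lam * xa := by gcongr
    linarith
  have hPle : 0.842 * P ≤ w4 * xc + 0.305 * Q := by
    have h1 : w * xb ≤ 0.305 * lam * xb := by gcongr
    have h2 : 2 * A ^ 2 ≤ 0.158 * lam ^ 2 := by linarith
    have h3 : 0.842 * lam ^ 2 * xa ≤ (lam ^ 2 - 2 * A ^ 2) * xa := by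
      gcongr; linarith
    rw [e2] at h3
    have h4 : lam * (0.842 * P) ≤ lam * (w4 * xc + 0.305 * Q) := by
      calc lam * (0.842 * P) = 0.842 * lam ^ 2 * xa := by rw [hP]; ring
        _ ≤ lam * (w4 * xc + w * xb) := h3
        _ ≤ lam * (w4 * xc + 0.305 * Q) :=
            mul_le_mul_of_nonneg_left (by linarith) hlam0
    exact le_of_mul_le_mul_left h4 (by linarith)
  have hP' : P ≤ (1.336 * w4 + 0.408 * w2) * xc := by
    have := mul_nonneg hw40 hxc.le
    have := mul_nonneg hw20 hxc.le
    linarith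
  have hQ' : Q ≤ (0.408 * w4 + 1.125 * w2) * xc := by
    have := mul_nonneg hw40 hxc.le
    have := mul_nonneg hw20 hxc.le
    linarith
  have hsum : w4 * P + w2 * Q ≤ (3.29 * m ^ 2 + 35) * xc := by
    have h1 := mul_le_mul_of_nonneg_left hP' hw40
    have h2 := mul_le_mul_of_nonneg_left hQ' hw20
    have h3 : 1.336 * w4 ^ 2 + 0.816 * (w4 * w2) + 1.125 * w2 ^ 2 ≤ 3.29 * m ^ 2 + 35 := by
      linarith [sq_nonneg (w4 - w2), sq_nonneg m]
    have h4 := mul_le_mul_of_nonneg_right h3 hxc.le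
    linarith
  have e1' : (lam ^ 2 - (m - 2) * W1 ^ 2) * xc = w4 * P + w2 * Q := by
    rw [e1, hP, hQ]; ring
  have h5 : (lam ^ 2 - (m - 2) * W1 ^ 2) * xc ≤ (3.29 * m ^ 2 + 35) * xc := by
    rw [e1']; exact hsum
  have h6 := le_of_mul_le_mul_right h5 hxc
  have h7 : (m - 2) * W1 ^ 2 ≤ (m - 2) * (m ^ 2 + 1) := by gcongr; linarith
  linarith [sq_nonneg (m - 5)]

lemma rpow_div_le {x q : ℝ} (a b : ℕ) (hb : b ≠ 0) (hx : 0 ≤ x) (hq : 0 ≤ q)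
    (h : x ^ a ≤ q ^ b) : x ^ ((a : ℝ) / b) ≤ q := by
  refine le_of_pow_le_pow_left₀ hb hq ?_
  rwa [← Real.rpow_natCast (x ^ ((a : ℝ) / b)), ← Real.rpow_mul hx,
    div_mul_cancel₀ _ (by exact_mod_cast hb), Real.rpow_natCast]

lemma le_rpow_div {x q : ℝ} (a b : ℕ) (hb : b ≠ 0) (hx : 0 ≤ x)
    (h : q ^ b ≤ x ^ a) : q ≤ x ^ ((a : ℝ) / b) := by
  refine le_of_pow_le_pow_left₀ hb (by positivity) ?_
  rwa [← Real.rpow_natCast (x ^ ((a : ℝ) / b)), ← Real.rpow_mul hx,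
    div_mul_cancel₀ _ (by exact_mod_cast hb), Real.rpow_natCast]

/-- An upper bound of the weight at the exponent `q` holds for all larger exponents. -/
lemma wt_le_of_le_rpow {p q a b r : ℝ} (hq : 2 ≤ q) (hqp : q ≤ p) (ha : 0 ≤ a) (hb : 0 ≤ b)
    (hr : 0 ≤ r) (h : a ^ q + b ^ q ≤ r ^ q) : wt p a b ≤ r := by
  refine (wt_antitone (by linarith) hqp ha hb).trans ?_
  unfold wt
  calc (a ^ q + b ^ q) ^ (1 / q) ≤ (r ^ q) ^ (1 / q) := by
        have : 0 ≤ q := by linarith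
        gcongr
    _ = r := by
        rw [← Real.rpow_mul hr, mul_one_div_cancel (by linarith), Real.rpow_one]

/-- A lower bound of the weight at the exponent `q` holds for all smaller exponents. -/
lemma le_wt_of_rpow_le {p q a b r : ℝ} (hp : 2 ≤ p) (hpq : p ≤ q) (ha : 0 ≤ a) (hb : 0 ≤ b)
    (hr : 0 ≤ r) (h : r ^ q ≤ a ^ q + b ^ q) : r ≤ wt p a b := by
  refine le_trans ?_ (wt_antitone (by linarith) hpq ha hb)
  unfold wt
  calc r = (r ^ q) ^ (1 / q) := by
        rw [← Real.rpow_mul hr, mul_one_div_cancel (by linarith), Real.rpow_one]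
    _ ≤ _ := by
        have : 0 ≤ q := by linarith
        gcongr

/-- For `n = 7` the two spectral radii are separated by a number `l`, given bounds of the weights
that hold for all `p` in an interval. -/
lemma lt_of_center_equations_of_four {lam mu xc xa xb A w w4 B1 B2 C : ℝ} (l a a' a4 b1 b2 g : ℝ)
    (hmu0 : 0 ≤ mu) (hxc : 0 < xc) (hxa : 0 < xa) (hxb : 0 < xb)
    (hmu : 125 ≤ mu ^ 2)
    (e1 : (lam ^ 2 - 2 * A ^ 2) * xc = lam * (w4 * xa + w * xb))
    (e2 : (lam ^ 2 - 2 * A ^ 2) * xa = lam * (w4 * xc + w * xb))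
    (e3 : w * xc + w * xa = lam * xb)
    (e4 : (mu ^ 2 - 3 * B1 ^ 2) * (mu ^ 2 - 2 * C ^ 2) = 2 * mu ^ 2 * B2 ^ 2)
    (hA0 : 0 ≤ A) (hw0 : 0 ≤ w) (hw40 : 4 ≤ w4) (hA : A ≤ a) (hw : w ≤ a') (hw4 : w4 ≤ a4)
    (hb1 : 0 ≤ b1) (hB1 : b1 ≤ B1) (hb2 : 0 ≤ b2) (hB2 : b2 ≤ B2) (hg : 0 ≤ g) (hC : g ≤ C)
    (hC8 : C ^ 2 ≤ 8) (hl : 11 ≤ l) (ha4 : a4 ≤ 6)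
    (h1 : 2 * a ^ 2 + 2 * a' ^ 2 < l ^ 2 - a4 * l)
    (h2 : (l ^ 2 - 3 * b1 ^ 2) * (l ^ 2 - 2 * g ^ 2) ≤ 2 * l ^ 2 * b2 ^ 2) : lam < mu := by
  have hmul : l ≤ mu := by
    by_contra hcon
    push Not at hcon
    have hlt : mu ^ 2 < l ^ 2 := by gcongr
    have k1 : b1 ^ 2 ≤ B1 ^ 2 := by gcongr
    have k2 : b2 ^ 2 ≤ B2 ^ 2 := by gcongr
    have k3 : g ^ 2 ≤ C ^ 2 := by gcongr
    set X := mu ^ 2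
    set Y := l ^ 2
    have hX0 : 0 < X - 2 * C ^ 2 := by linarith
    have s1 : 2 * X * b2 ^ 2 ≤ (X - 3 * b1 ^ 2) * (X - 2 * C ^ 2) := by
      calc 2 * X * b2 ^ 2 ≤ 2 * X * B2 ^ 2 := by gcongr
        _ = (X - 3 * B1 ^ 2) * (X - 2 * C ^ 2) := e4.symm
        _ ≤ _ := by gcongr
    have hpos : 0 ≤ X - 3 * b1 ^ 2 :=
      nonneg_of_mul_nonneg_left (le_trans (by positivity) s1) hX0
    have s2 : 2 * X * b2 ^ 2 ≤ (X - 3 * b1 ^ 2) * (X - 2 * g ^ 2) :=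
      s1.trans (by gcongr)
    -- `t ↦ (t - 3 b1²) (t - 2 g²) / t` increases
    have s3 : X * ((Y - 3 * b1 ^ 2) * (Y - 2 * g ^ 2)) ≤
        Y * ((X - 3 * b1 ^ 2) * (X - 2 * g ^ 2)) := by
      have t1 := mul_le_mul_of_nonneg_left h2 (by linarith : 0 ≤ X)
      have t2 := mul_le_mul_of_nonneg_left s2 (by linarith : 0 ≤ Y)
      linarith
    have s4 : 0 < (Y - X) * (X * Y - 6 * b1 ^ 2 * g ^ 2) := by
      refine mul_pos (by linarith) ?_
      have t1 : 3 * b1 ^ 2 * (2 * g ^ 2) ≤ X * (2 * g ^ 2) := by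
        gcongr; linarith
      have t2 : X * (2 * g ^ 2) < X * Y := by
        refine mul_lt_mul_of_pos_left ?_ (by linarith)
        linarith
      linarith
    linarith
  refine lt_of_lt_of_le ?_ hmul
  by_contra hcon
  push Not at hcon
  have hl0 : 0 < lam := by linarith
  have hX : 0 < lam ^ 2 - 2 * A ^ 2 + lam * w4 := by
    have : 0 < (lam ^ 2 - 2 * A ^ 2) * xc := by
      rw [e1]
      have : 0 < w4 := by linarith
      positivity
    have := pos_of_mul_pos_left this hxc.le
    have : 0 ≤ lam * w4 := by positivity
    linarith
  -- the two hubs of the triangle are interchangeable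
  have hsym : xa = xc := by
    have : (lam ^ 2 - 2 * A ^ 2 + lam * w4) * (xa - xc) = 0 := by
      linear_combination e2 - e1
    have := (mul_eq_zero.1 this).resolve_left hX.ne'
    linarith
  subst hsym
  have key : lam ^ 2 - 2 * A ^ 2 = lam * w4 + 2 * w ^ 2 := by
    refine mul_right_cancel₀ hxa.ne' ?_
    linear_combination e1 - w * e3
  have k1 : A ^ 2 ≤ a ^ 2 := by gcongr
  have k2 : w ^ 2 ≤ a' ^ 2 := by gcongr
  have k3 : lam * w4 ≤ lam * a4 := by gcongr
  have k4 := mul_nonneg (sub_nonneg.2 hcon) (by linarith : 0 ≤ lam + l - a4)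
  linarith

/-- For `n ≥ 8` crude estimates suffice. For `n = 7` the two radii are close; the half-line `p ≥ 2`
is cut at `25/12`, `9/4` and `8/3`, and on each piece the weights are bounded by their values at
its ends. -/
lemma radius_U4_lt {n : ℕ} (hn : 7 ≤ n) (hp : 2 ≤ p) :
    pSomborRadius p (U4 n) < pSomborRadius p (U3 n) := by
  obtain ⟨lam, xc, xa, xb, hlam, hlam0, hxc, hxa, hxb, e1, e2, e3⟩ :=
    exists_radius_U4_equations hn hp
  obtain ⟨mu, hmu, hmu0, hmu3, e4⟩ := radius_U3_equation hn hp
  rw [← hlam, ← hmu]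
  rcases hn.eq_or_lt with rfl | hn8
  · norm_num at e1 e2 e3 e4 hmu3
    have hw0 : 0 ≤ wt p 4 2 := wt_nonneg p (by norm_num) (by norm_num)
    have hA0 : 0 ≤ wt p 4 1 := wt_nonneg p (by norm_num) (by norm_num)
    have hw4 : 4 ≤ wt p 4 4 := le_wt hp (by norm_num) (by norm_num)
    have hC8 : wt p 2 2 ^ 2 ≤ 8 := (wt_sq_le hp (by norm_num) (by norm_num)).trans (by norm_num)
    have separate := fun l a a' a4 b1 b2 g => lt_of_center_equations_of_four l a a' a4 b1 b2 g
      hmu0 hxc hxa hxb hmu3 e1 e2 e3 e4 hA0 hw0 hw4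
    have up : ∀ (q a b A B R r : ℝ), 2 ≤ q → q ≤ p → 0 ≤ a → 0 ≤ b → 0 ≤ r → a ^ q ≤ A →
        b ^ q ≤ B → R ≤ r ^ q → A + B ≤ R → wt p a b ≤ r := fun q a b A B R r hq hqp ha hb hr h1 h2
        h3 h4 => wt_le_of_le_rpow hq hqp ha hb hr (by linarith)
    have dn : ∀ (q a b A B R r : ℝ), p ≤ q → 0 ≤ a → 0 ≤ b → 0 ≤ r → A ≤ a ^ q →
        B ≤ b ^ q → r ^ q ≤ R → R ≤ A + B → r ≤ wt p a b := fun q a b A B R r hqp ha hb hr h1 h2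
        h3 h4 => le_wt_of_rpow_le hp hqp ha hb hr (by linarith)
    rcases le_total p (25 / 12) with h1 | h1
    · -- `p ∈ [2, 25/12]`
      have u1 : wt p 4 1 ≤ 4.1232 := le_of_sq_le (by norm_num)
        ((wt_sq_le hp (by norm_num) (by norm_num)).trans (by norm_num))
      have u2 : wt p 4 2 ≤ 4.4722 := le_of_sq_le (by norm_num)
        ((wt_sq_le hp (by norm_num) (by norm_num)).trans (by norm_num))
      have u3 : wt p 4 4 ≤ 5.6569 := le_of_sq_le (by norm_num)
        ((wt_sq_le hp (by norm_num) (by norm_num)).trans (by norm_num))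
      have h' := h1
      have d1 : 5.082 ≤ wt p 5 1 :=
        dn (25 / 12) 5 1 28.5881 1 29.5738 5.082 h' (by norm_num) (by norm_num) (by norm_num)
          (le_rpow_div 25 12 (by norm_num) (by norm_num) (by norm_num))
          (by norm_num)
          (rpow_div_le 25 12 (by norm_num) (by norm_num) (by norm_num) (by norm_num)) (by norm_num)
      have d2 : 5.342 ≤ wt p 5 2 :=
        dn (25 / 12) 5 2 28.5881 4.2377 32.8134 5.342 h' (by norm_num) (by norm_num) (by norm_num)
          (le_rpow_div 25 12 (by norm_num) (by norm_num) (by norm_num))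
          (le_rpow_div 25 12 (by norm_num) (by norm_num) (by norm_num))
          (rpow_div_le 25 12 (by norm_num) (by norm_num) (by norm_num) (by norm_num)) (by norm_num)
      have d3 : 2.788 ≤ wt p 2 2 :=
        dn (25 / 12) 2 2 4.2377 4.2377 8.4664 2.788 h' (by norm_num) (by norm_num) (by norm_num)
          (le_rpow_div 25 12 (by norm_num) (by norm_num) (by norm_num))
          (le_rpow_div 25 12 (by norm_num) (by norm_num) (by norm_num))
          (rpow_div_le 25 12 (by norm_num) (by norm_num) (by norm_num) (by norm_num)) (by norm_num)
      exact separate 11.89 4.1232 4.4722 5.6569 5.082 5.342 2.788 u1 u2 u3 (by norm_num) d1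
        (by norm_num) d2 (by norm_num) d3 hC8 (by norm_num) (by norm_num) (by norm_num)
        (by norm_num)
    rcases le_total p (9 / 4) with h2 | h2
    · -- `p ∈ [25/12, 9/4]`
      have h := h1
      have h' := h2
      have u1 : wt p 4 1 ≤ 4.107 :=
        up (25 / 12) 4 1 17.9595 1 18.9746 4.107 (by norm_num) h (by norm_num) (by norm_num)
          (by norm_num) (rpow_div_le 25 12 (by norm_num) (by norm_num) (by norm_num) (by norm_num))
          (by norm_num)
          (le_rpow_div 25 12 (by norm_num) (by norm_num) (by norm_num)) (by norm_num)
      have u2 : wt p 4 2 ≤ 4.43 :=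
        up (25 / 12) 4 2 17.9595 4.238 22.2163 4.43 (by norm_num) h (by norm_num) (by norm_num)
          (by norm_num) (rpow_div_le 25 12 (by norm_num) (by norm_num) (by norm_num) (by norm_num))
          (rpow_div_le 25 12 (by norm_num) (by norm_num) (by norm_num) (by norm_num))
          (le_rpow_div 25 12 (by norm_num) (by norm_num) (by norm_num)) (by norm_num)
      have u3 : wt p 4 4 ≤ 5.58 :=
        up (25 / 12) 4 4 17.9595 17.9595 35.9324 5.58 (by norm_num) h (by norm_num) (by norm_num)
          (by norm_num) (rpow_div_le 25 12 (by norm_num) (by norm_num) (by norm_num) (by norm_num))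
          (rpow_div_le 25 12 (by norm_num) (by norm_num) (by norm_num) (by norm_num))
          (le_rpow_div 25 12 (by norm_num) (by norm_num) (by norm_num)) (by norm_num)
      have d1 : 5.058 ≤ wt p 5 1 :=
        dn (9 / 4) 5 1 37.3836 1 38.3667 5.058 h' (by norm_num) (by norm_num) (by norm_num)
          (le_rpow_div 9 4 (by norm_num) (by norm_num) (by norm_num))
          (by norm_num)
          (rpow_div_le 9 4 (by norm_num) (by norm_num) (by norm_num) (by norm_num)) (by norm_num)
      have d2 : 5.272 ≤ wt p 5 2 :=
        dn (9 / 4) 5 2 37.3836 4.7567 42.1159 5.272 h' (by norm_num) (by norm_num) (by norm_num)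
          (le_rpow_div 9 4 (by norm_num) (by norm_num) (by norm_num))
          (le_rpow_div 9 4 (by norm_num) (by norm_num) (by norm_num))
          (rpow_div_le 9 4 (by norm_num) (by norm_num) (by norm_num) (by norm_num)) (by norm_num)
      have d3 : 2.72 ≤ wt p 2 2 :=
        dn (9 / 4) 2 2 4.7567 4.7567 9.5014 2.72 h' (by norm_num) (by norm_num) (by norm_num)
          (le_rpow_div 9 4 (by norm_num) (by norm_num) (by norm_num))
          (le_rpow_div 9 4 (by norm_num) (by norm_num) (by norm_num))
          (rpow_div_le 9 4 (by norm_num) (by norm_num) (by norm_num) (by norm_num)) (by norm_num)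
      exact separate 11.782 4.107 4.43 5.58 5.058 5.272 2.72 u1 u2 u3 (by norm_num) d1
        (by norm_num) d2 (by norm_num) d3 hC8 (by norm_num) (by norm_num) (by norm_num)
        (by norm_num)
    rcases le_total p (8 / 3) with h3 | h3
    · -- `p ∈ [9/4, 8/3]`
      have h := h2
      have h' := h3
      have u1 : wt p 4 1 ≤ 4.079 :=
        up (9 / 4) 4 1 22.6276 1 23.6452 4.079 (by norm_num) h (by norm_num) (by norm_num)
          (by norm_num) (rpow_div_le 9 4 (by norm_num) (by norm_num) (by norm_num) (by norm_num))
          (by norm_num)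
          (le_rpow_div 9 4 (by norm_num) (by norm_num) (by norm_num)) (by norm_num)
      have u2 : wt p 4 2 ≤ 4.356 :=
        up (9 / 4) 4 2 22.6276 4.757 27.4123 4.356 (by norm_num) h (by norm_num) (by norm_num)
          (by norm_num) (rpow_div_le 9 4 (by norm_num) (by norm_num) (by norm_num) (by norm_num))
          (rpow_div_le 9 4 (by norm_num) (by norm_num) (by norm_num) (by norm_num))
          (le_rpow_div 9 4 (by norm_num) (by norm_num) (by norm_num)) (by norm_num)
      have u3 : wt p 4 4 ≤ 5.445 :=
        up (9 / 4) 4 4 22.6276 22.6276 45.2891 5.445 (by norm_num) h (by norm_num) (by norm_num)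
          (by norm_num) (rpow_div_le 9 4 (by norm_num) (by norm_num) (by norm_num) (by norm_num))
          (rpow_div_le 9 4 (by norm_num) (by norm_num) (by norm_num) (by norm_num))
          (le_rpow_div 9 4 (by norm_num) (by norm_num) (by norm_num)) (by norm_num)
      have d1 : 5.024 ≤ wt p 5 1 :=
        dn (8 / 3) 5 1 73.1003 1 74.04 5.024 h' (by norm_num) (by norm_num) (by norm_num)
          (le_rpow_div 8 3 (by norm_num) (by norm_num) (by norm_num))
          (by norm_num)
          (rpow_div_le 8 3 (by norm_num) (by norm_num) (by norm_num) (by norm_num)) (by norm_num)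
      have d2 : 5.157 ≤ wt p 5 2 :=
        dn (8 / 3) 5 2 73.1003 6.3495 79.3828 5.157 h' (by norm_num) (by norm_num) (by norm_num)
          (le_rpow_div 8 3 (by norm_num) (by norm_num) (by norm_num))
          (le_rpow_div 8 3 (by norm_num) (by norm_num) (by norm_num))
          (rpow_div_le 8 3 (by norm_num) (by norm_num) (by norm_num) (by norm_num)) (by norm_num)
      have d3 : 2.592 ≤ wt p 2 2 :=
        dn (8 / 3) 2 2 6.3495 6.3495 12.6774 2.592 h' (by norm_num) (by norm_num) (by norm_num)
          (le_rpow_div 8 3 (by norm_num) (by norm_num) (by norm_num))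
          (le_rpow_div 8 3 (by norm_num) (by norm_num) (by norm_num))
          (rpow_div_le 8 3 (by norm_num) (by norm_num) (by norm_num) (by norm_num)) (by norm_num)
      exact separate 11.6 4.079 4.356 5.445 5.024 5.157 2.592 u1 u2 u3 (by norm_num) d1
        (by norm_num) d2 (by norm_num) d3 hC8 (by norm_num) (by norm_num) (by norm_num)
        (by norm_num)
    · -- `p ≥ 8/3`
      have h := h3
      have u1 : wt p 4 1 ≤ 4.038 :=
        up (8 / 3) 4 1 40.3176 1 41.3468 4.038 (by norm_num) h (by norm_num) (by norm_num)
          (by norm_num) (rpow_div_le 8 3 (by norm_num) (by norm_num) (by norm_num) (by norm_num))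
          (by norm_num)
          (le_rpow_div 8 3 (by norm_num) (by norm_num) (by norm_num)) (by norm_num)
      have u2 : wt p 4 2 ≤ 4.227 :=
        up (8 / 3) 4 2 40.3176 6.3498 46.7109 4.227 (by norm_num) h (by norm_num) (by norm_num)
          (by norm_num) (rpow_div_le 8 3 (by norm_num) (by norm_num) (by norm_num) (by norm_num))
          (rpow_div_le 8 3 (by norm_num) (by norm_num) (by norm_num) (by norm_num))
          (le_rpow_div 8 3 (by norm_num) (by norm_num) (by norm_num)) (by norm_num)
      have u3 : wt p 4 4 ≤ 5.189 :=
        up (8 / 3) 4 4 40.3176 40.3176 80.7029 5.189 (by norm_num) h (by norm_num) (by norm_num)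
          (by norm_num) (rpow_div_le 8 3 (by norm_num) (by norm_num) (by norm_num) (by norm_num))
          (rpow_div_le 8 3 (by norm_num) (by norm_num) (by norm_num) (by norm_num))
          (le_rpow_div 8 3 (by norm_num) (by norm_num) (by norm_num)) (by norm_num)
      have d1 : 5 ≤ wt p 5 1 := le_wt hp (by norm_num) (by norm_num)
      have d2 : 5 ≤ wt p 5 2 := le_wt hp (by norm_num) (by norm_num)
      have d3 : 2 ≤ wt p 2 2 := le_wt hp (by norm_num) (by norm_num)
      exact separate 11.3 4.038 4.227 5.189 5 5 2 u1 u2 u3 (by norm_num) d1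
        (by norm_num) d2 (by norm_num) d3 hC8 (by norm_num) (by norm_num) (by norm_num)
        (by norm_num)
  · have h8 : (8 : ℝ) ≤ n := by exact_mod_cast hn8
    have h3 : (0 : ℝ) ≤ n - 3 := by linarith
    refine lt_of_center_equations_of_five_le (m := n - 3) (W1 := wt p (n - 3) 1)
      (w4 := wt p (n - 3) 4) (w2 := wt p (n - 3) 2) (A := wt p 4 1) (w := wt p 4 2)
      (by linarith) hlam0 hmu0 ?_ hxc hxa hxb ?_ ?_ ?_
      (wt_nonneg p h3 (by norm_num)) (wt_nonneg p h3 (by norm_num)) ?_ ?_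
      ?_ e2 e3
    · convert hmu3 using 2; ring
    · exact (wt_sq_le hp h3 (by norm_num)).trans (by norm_num)
    · exact (wt_sq_le hp h3 (by norm_num)).trans (by norm_num)
    · exact (wt_sq_le hp h3 (by norm_num)).trans (by norm_num)
    · exact (wt_sq_le hp (by norm_num) (by norm_num)).trans (by norm_num)
    · exact (wt_sq_le hp (by norm_num) (by norm_num)).trans (by norm_num)
    · convert e1 using 3; ring

end PSombor

namespace PSombor

open scoped Matrix

/-! ### Two special moves -/

variable {V : Type*} [Fintype V] {p : ℝ} {G : SimpleGraph V}

/-- In a triangle with pendent vertices at two of its vertices `c` and `v` only, the Perron entry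
is at least as large at the vertex of larger degree. -/
lemma le_of_triangle_equations {lam k l W A A' B B' xc xv xa : ℝ} (hlam : 0 < lam)
    (hxc : 0 < xc) (hxv : 0 < xv) (hxa : 0 < xa) (hW : 0 < W) (hB' : 0 < B')
    (hk : l * A' ^ 2 ≤ k * A ^ 2) (hB : B' ≤ B)
    (e1 : (lam ^ 2 - k * A ^ 2) * xc = lam * (W * xv + B * xa))
    (e2 : (lam ^ 2 - l * A' ^ 2) * xv = lam * (W * xc + B' * xa)) : xv ≤ xc := by
  by_contra hcon
  push Not at hcon
  have h1 : 0 ≤ lam ^ 2 - l * A' ^ 2 := by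
    refine nonneg_of_mul_nonneg_left (b := xv) ?_ hxv
    rw [e2]; positivity
  have h2 : (lam ^ 2 - k * A ^ 2) * xc ≤ (lam ^ 2 - l * A' ^ 2) * xc := by gcongr
  have h3 := mul_le_mul_of_nonneg_left hcon.le h1
  have h4 : lam * (W * xv + B * xa) ≤ lam * (W * xc + B' * xa) := by linarith
  have h5 := le_of_mul_le_mul_left h4 hlam
  have h6 := mul_lt_mul_of_pos_left hcon hW
  have h7 := mul_le_mul_of_nonneg_right hB hxa.le
  linarith

/-- In a triangle with at least as many pendent vertices at `c` as at `v`, and none at the third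
vertex, moving a pendent vertex from `v` to `c` increases the spectral radius: each pendent edge
left at `v` loses no more than a pendent edge at `c` gains. -/
lemma radius_lt_shift_pendant [DecidableEq V] (hp : 2 ≤ p) {x : V → ℝ} (hx : IsPerron p G x)
    {c v a z : V} {P K : Finset V}
    (hca : c ≠ a) (hva : v ≠ a) (hcv : c ≠ v)
    (hdP : Disjoint P {v, a}) (hdK : Disjoint K {c, a}) (hdPK : Disjoint P K) (hz : z ∈ K)
    (hNc : ∀ j, G.Adj c j ↔ j ∈ P ∪ {v, a}) (hNv : ∀ j, G.Adj v j ↔ j ∈ K ∪ {c, a})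
    (hNP : ∀ j ∈ P, ∀ y, G.Adj j y ↔ y = c) (hNK : ∀ j ∈ K, ∀ y, G.Adj j y ↔ y = v)
    (hNa : ∀ j, G.Adj a j ↔ j ∈ ({c, v} : Finset V)) (hPK : K.card ≤ P.card) :
    pSomborRadius p G < pSomborRadius p (shift G c v {z}) := by
  have hdc : deg G c = P.card + 2 := by
    rw [deg_eq_card hNc, Finset.card_union_of_disjoint hdP, Finset.card_pair hva]
  have hdv : deg G v = K.card + 2 := by
    rw [deg_eq_card hNv, Finset.card_union_of_disjoint hdK, Finset.card_pair hca]
  have hda : deg G a = 2 := by rw [deg_eq_card hNa, Finset.card_pair hcv]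
  have hNP' : ∀ j ∈ P, ∀ y, G.Adj j y ↔ y ∈ ({c} : Finset V) := by simpa using hNP
  have hNK' : ∀ j ∈ K, ∀ y, G.Adj j y ↔ y ∈ ({v} : Finset V) := by simpa using hNK
  have hdeg1P : ∀ j ∈ P, deg G j = 1 := fun j hj => by
    rw [deg_eq_card (hNP' j hj), Finset.card_singleton]
  have hdeg1K : ∀ j ∈ K, deg G j = 1 := fun j hj => by
    rw [deg_eq_card (hNK' j hj), Finset.card_singleton]
  have hcz : ¬ G.Adj c z := by
    rw [hNc]
    have h1 := Finset.disjoint_right.1 hdPK hz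
    have h2 := Finset.disjoint_left.1 hdK hz
    simp only [Finset.mem_insert, Finset.mem_singleton, not_or] at h2
    have h3 : z ≠ v := by
      rintro rfl
      exact ((hNv z).2 (Finset.mem_union_left _ hz)).ne rfl
    simp [h1, h2, h3]
  have hs : Shiftable G c v {z} := by
    refine ⟨hcv, ?_, ?_, ?_⟩
    · intro w hw
      rw [Set.mem_singleton_iff.1 hw]
      exact (hNv z).2 (Finset.mem_union_left _ hz)
    · intro w hw
      rwa [Set.mem_singleton_iff.1 hw]
    · intro h'
      exact Finset.disjoint_left.1 hdK hz (by simp [← Set.mem_singleton_iff.1 h'])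
  have e1 := hx.sum_neighbors_pendant hNc hdP hNP
  have e2 := hx.sum_neighbors_pendant hNv hdK hNK
  rw [Finset.sum_pair hva] at e1
  rw [Finset.sum_pair hca] at e2
  have hlam0 := hx.radius_nonneg c
  have hlam1 : 0 < pSomborRadius p G := by
    have h := hx.deg_pow_three_le hp a
    rw [hda] at h
    norm_num at h
    nlinarith
  have hdcv : (deg G v : ℝ) ≤ deg G c := by exact_mod_cast (by omega : deg G v ≤ deg G c)
  have hPK' : (K.card : ℝ) ≤ P.card := by exact_mod_cast hPK
  have hxvc : x v ≤ x c := by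
    have hwv : 0 ≤ wt p (deg G v) 1 := wt_nonneg p (by positivity) (by norm_num)
    refine le_of_triangle_equations hlam1 (hx.pos c) (hx.pos v) (hx.pos a)
      (edgeWt_pos hp ((hNc v).2 (by simp))) (edgeWt_pos hp ((hNv a).2 (by simp))) ?_ ?_ e1 (by
        rw [edgeWt_comm p G c v]; exact e2)
    · have := wt_le_wt hp (by positivity) zero_le_one hdcv (le_refl (1 : ℝ))
      gcongr
    · exact wt_le_wt hp (by positivity) (by positivity) hdcv le_rfl
  -- entries at the pendent vertices
  have hPx : ∀ j ∈ P, x j = wt p (deg G c) 1 * x c / pSomborRadius p G := by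
    intro j hj
    have h := hx.sum_neighbors (hNP' j hj)
    rw [Finset.sum_singleton, edgeWt_comm, edgeWt, hdeg1P j hj, Nat.cast_one] at h
    rw [h]; field_simp
  have hKx : ∀ j ∈ K, x j = wt p (deg G v) 1 * x v / pSomborRadius p G := by
    intro j hj
    have h := hx.sum_neighbors (hNK' j hj)
    rw [Finset.sum_singleton, edgeWt_comm, edgeWt, hdeg1K j hj, Nat.cast_one] at h
    rw [h]; field_simp
  have hA1 : ({z} : Set V).ncard = 1 := Set.ncard_singleton _
  refine hs.radius_lt_of_gain hp hx (by omega) ?_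
  set g := wt p (deg G c + 1) 1 - wt p (deg G c) 1 with hg
  set h := wt p (deg G v) 1 - wt p (deg G v - 1) 1 with hh
  have hdv2 : (2 : ℝ) ≤ deg G v := by exact_mod_cast (by omega : 2 ≤ deg G v)
  have hg0 : 0 < g := sub_pos.2 (wt_lt_wt hp (by positivity) zero_le_one (by linarith))
  have hh0 : 0 ≤ h := sub_nonneg.2 (wt_le_wt hp (by linarith) zero_le_one (by linarith) le_rfl)
  have hgh : h ≤ g := by
    have := wt_increment_mono (p := p) (c := 1) (a := deg G v - 1) (b := deg G c) (k := 1) hp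
      zero_le_one (by linarith) (by linarith) zero_le_one
    rwa [sub_add_cancel] at this
  have hgainP : ∀ w ∈ P, shiftGain p G c v {z} x w * x w
      = g * x c * (wt p (deg G c) 1 * x c / pSomborRadius p G) := by
    intro w hw
    have hcw : G.Adj c w := (hNc w).2 (Finset.mem_union_left _ hw)
    have hwv : w ≠ v := by rintro rfl; exact Finset.disjoint_left.1 hdP hw (by simp)
    have hvw : ¬ G.Adj v w := fun h' => hcv ((hNP w hw v).1 h'.symm).symm
    rw [shiftGain, hs.shift_matrix_left hcw.ne' hwv (Or.inl hcw), pSomborMatrix_of_adj hcw, edgeWt,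
      pSomborMatrix_of_not_adj hvw,
      pSomborMatrix_of_not_adj (mt (hs.shift_adj_right w).1 fun h' => hvw h'.1), hA1,
      hdeg1P w hw, hPx w hw]
    push_cast
    ring
  have hgainK : ∀ w ∈ K.erase z, shiftGain p G c v {z} x w * x w
      = -(h * x v * (wt p (deg G v) 1 * x v / pSomborRadius p G)) := by
    intro w hw
    obtain ⟨hwz, hw⟩ := Finset.mem_erase.1 hw
    have hvw : G.Adj v w := (hNv w).2 (Finset.mem_union_left _ hw)
    have hwc : w ≠ c := by rintro rfl; exact Finset.disjoint_left.1 hdK hw (by simp)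
    have hcw : ¬ G.Adj c w := fun h' => hcv ((hNK w hw c).1 h'.symm)
    rw [shiftGain, hs.shift_matrix_right hwc hvw.ne' hvw hwz, pSomborMatrix_of_adj hvw, edgeWt,
      pSomborMatrix_of_not_adj hcw,
      pSomborMatrix_of_not_adj (mt (hs.shift_adj_left w).1 (not_or.2 ⟨hcw, hwz⟩)), hA1,
      hdeg1K w hw, hKx w hw]
    push_cast
    ring
  have hsub : P ∪ K.erase z ⊆ ({c, v} : Finset V)ᶜ := by
    intro w hw
    simp only [Finset.mem_compl, Finset.mem_insert, Finset.mem_singleton, not_or]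
    rcases Finset.mem_union.1 hw with hw | hw
    · exact ⟨((hNc w).2 (Finset.mem_union_left _ hw)).ne', by
        rintro rfl; exact Finset.disjoint_left.1 hdP hw (by simp)⟩
    · have hw := Finset.mem_of_mem_erase hw
      exact ⟨by rintro rfl; exact Finset.disjoint_left.1 hdK hw (by simp),
        ((hNv w).2 (Finset.mem_union_left _ hw)).ne'⟩
  have hrest : ∀ w ∈ ({c, v} : Finset V)ᶜ, w ∉ P ∪ K.erase z →
      0 ≤ shiftGain p G c v {z} x w * x w := by
    intro w hw hwn
    simp only [Finset.mem_compl, Finset.mem_insert, Finset.mem_singleton, not_or] at hw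
    simp only [Finset.mem_union, Finset.mem_erase, not_or, not_and] at hwn
    refine mul_nonneg ?_ (hx.pos w).le
    unfold shiftGain
    by_cases hwz : w = z
    · subst hwz
      rw [hs.shift_matrix_left hw.1 hw.2 (Or.inr rfl), pSomborMatrix_of_not_adj hcz,
        pSomborMatrix_of_not_adj (mt (hs.shift_adj_right w).1 fun h' => h'.2 rfl),
        pSomborMatrix_of_adj ((hNv w).2 (Finset.mem_union_left _ hz)), edgeWt, hA1]
      have h1 : wt p (deg G v) (deg G w) ≤ wt p (deg G c + (1 : ℕ)) (deg G w) :=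
        wt_le_wt hp (by positivity) (by positivity) (by push_cast; linarith) le_rfl
      have h2 := mul_le_mul h1 hxvc (hx.pos v).le (wt_nonneg p (by positivity) (by positivity))
      linarith
    by_cases hwa : w = a
    · subst hwa
      have hcw : G.Adj c w := (hNc w).2 (by simp)
      have hvw : G.Adj v w := (hNv w).2 (by simp)
      rw [hs.shift_matrix_left hw.1 hw.2 (Or.inl hcw), pSomborMatrix_of_adj hcw,
        hs.shift_matrix_right hw.1 hw.2 hvw hwz, pSomborMatrix_of_adj hvw, edgeWt, edgeWt, hA1]
      have h1 := wt_increment_mono (p := p) (c := deg G w) (a := deg G v - 1) (b := deg G c)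
        (k := 1) hp (by positivity) (by linarith) (by linarith) zero_le_one
      have h2 : 0 ≤ wt p (deg G c + 1) (deg G w) - wt p (deg G c) (deg G w) :=
        sub_nonneg.2 (wt_le_wt hp (by positivity) (by positivity) (by linarith) le_rfl)
      rw [sub_add_cancel] at h1
      push_cast
      have h3 := mul_le_mul_of_nonneg_left hxvc h2
      have h4 := mul_le_mul_of_nonneg_right h1 (hx.pos v).le
      linarith
    · have hcw : ¬ G.Adj c w := by rw [hNc]; simp [hwn.1, hw.2, hwa]
      have hvw : ¬ G.Adj v w := by rw [hNv]; simp [hwn.2 hwz, hw.1, hwa]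
      rw [pSomborMatrix_of_not_adj hcw, pSomborMatrix_of_not_adj hvw,
        pSomborMatrix_of_not_adj (mt (hs.shift_adj_left w).1 (not_or.2 ⟨hcw, hwz⟩)),
        pSomborMatrix_of_not_adj (mt (hs.shift_adj_right w).1 fun h' => hvw h'.1)]
      simp
  refine lt_of_lt_of_le ?_ (Finset.sum_le_sum_of_subset_of_nonneg hsub hrest)
  rw [Finset.sum_union (hdPK.mono_right (Finset.erase_subset _ _)), Finset.sum_congr rfl hgainP,
    Finset.sum_congr rfl hgainK, Finset.sum_const, Finset.sum_const, nsmul_eq_mul, nsmul_eq_mul,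
    Finset.card_erase_of_mem hz, Nat.cast_sub (Finset.card_pos.2 ⟨z, hz⟩), Nat.cast_one]
  set y := wt p (deg G c) 1 * x c / pSomborRadius p G with hy
  set y' := wt p (deg G v) 1 * x v / pSomborRadius p G with hy'
  have hwv0 : 0 ≤ wt p (deg G v) 1 := wt_nonneg p (by positivity) (by norm_num)
  have hwvc : wt p (deg G v) 1 ≤ wt p (deg G c) 1 :=
    wt_le_wt hp (by positivity) zero_le_one hdcv le_rfl
  have hv0 := (hx.pos v).le
  have hc0 := hx.pos c
  have hwc0 : 0 < wt p (deg G c) 1 :=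
    lt_of_lt_of_le (by linarith) (le_wt hp (by positivity) zero_le_one)
  have hyy : y' ≤ y := by
    rw [hy, hy']
    gcongr
  have hy'0 : 0 ≤ y' := by rw [hy']; positivity
  have hy0 : 0 < y := by
    rw [hy]
    positivity
  have h1 : h * x v * y' ≤ g * x c * y := by gcongr
  have h2 : 0 < g * x c * y := by positivity
  have hK1 : (1 : ℝ) ≤ K.card := by exact_mod_cast Finset.card_pos.2 ⟨z, hz⟩
  have h3 : ((K.card : ℝ) - 1) * (h * x v * y') ≤ (P.card - 1) * (g * x c * y) := by
    have : 0 ≤ h * x v * y' := by positivity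
    gcongr
    linarith
  linarith

/-- The numerical heart of `radius_lt_rotate`: `xh` is the entry at the hub, `xc` at its neighbour
on the triangle, `xa` at the two remaining vertices of the triangle and `xq` at a pendent vertex
of the hub. -/
lemma lt_of_pendant_triangle_equations {m lam W w1 t c w42 xh xc xa xq : ℝ} (hm : 4 ≤ m)
    (hlam0 : 0 ≤ lam) (hlam : (m - 1) * m ^ 2 + W ^ 2 ≤ lam ^ 2) (hW : m ≤ W) (hw1 : m ≤ w1)
    (ht : t ^ 2 ≤ 13) (ht0 : 0 < t) (hc : c ^ 2 ≤ 8) (hw42 : 4 ≤ w42)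
    (hxh : 0 < xh) (hxc : 0 < xc) (hxa : 0 < xa)
    (e1 : W * xh + 2 * t * xa = lam * xc) (e2 : t * xc + c * xa = lam * xa)
    (e3 : w1 * xh = lam * xq) : c * (xa * xa) < w42 * (xc * xq) := by
  have hc' : c ≤ 2.83 := le_of_sq_le (by norm_num) (by linarith)
  have ht' : t ≤ 3.606 := le_of_sq_le (by norm_num) (by linarith)
  have hm0 : 0 ≤ m - 1 := by linarith
  have h48 : 48 ≤ (m - 1) * m ^ 2 := by
    calc (48 : ℝ) = (4 - 1) * 4 ^ 2 := by norm_num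
      _ ≤ (m - 1) * m ^ 2 := by gcongr
  have hW16 : 16 ≤ W ^ 2 := by
    calc (16 : ℝ) = 4 ^ 2 := by norm_num
      _ ≤ W ^ 2 := by gcongr; linarith
  have hlam8 : 8 ≤ lam := le_of_sq_le hlam0 (by linarith)
  have e2' : (lam - c) * xa = t * xc := by linear_combination -e2
  have hha : xa ≤ xh := by
    by_contra hcon
    push Not at hcon
    have h1 : lam * xc ≤ (W + 2 * t) * xa := by
      have : W * xh ≤ W * xa := by gcongr; linarith
      linarith
    have h2 : lam * (lam - c) * xc ≤ (W + 2 * t) * t * xc := by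
      have h3 := mul_le_mul_of_nonneg_left h1 (by linarith : 0 ≤ lam - c)
      calc lam * (lam - c) * xc = (lam - c) * (lam * xc) := by ring
        _ ≤ (lam - c) * ((W + 2 * t) * xa) := h3
        _ = (W + 2 * t) * ((lam - c) * xa) := by ring
        _ = _ := by rw [e2']; ring
    have h3 := le_of_mul_le_mul_right h2 hxc
    have h4 : W * t ≤ W * 3.606 := by gcongr; linarith
    have h5 : lam * c ≤ lam * 2.83 := by gcongr
    -- tangent lines to the squares at `8.3` and `4.5`
    linarith [sq_nonneg (lam - 8.3), sq_nonneg (W - 4.5)]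
  have hct : c * t ≤ 2.83 * 3.606 := by gcongr
  have h1 : c * t * lam < 16 * (lam - c) := by
    have : c * t * lam ≤ 2.83 * 3.606 * lam := by gcongr
    linarith
  have h2 : c * lam * xa < 16 * xc := by
    have h3 : t * (c * lam * xa) < t * (16 * xc) := by
      calc t * (c * lam * xa) = c * t * lam * xa := by ring
        _ < 16 * (lam - c) * xa := mul_lt_mul_of_pos_right h1 hxa
        _ = t * (16 * xc) := by linear_combination 16 * e2'
    exact lt_of_mul_lt_mul_left h3 ht0.le
  have h3 : lam * (c * (xa * xa)) < lam * (w42 * (xc * xq)) := by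
    calc lam * (c * (xa * xa)) = c * lam * xa * xa := by ring
      _ < 16 * xc * xa := mul_lt_mul_of_pos_right h2 hxa
      _ ≤ 16 * xc * xh := by gcongr
      _ = 4 * xc * (4 * xh) := by ring
      _ ≤ w42 * xc * (w1 * xh) := by gcongr; linarith
      _ = _ := by rw [e3]; ring
  exact lt_of_mul_lt_mul_left h3 hlam0

/-- The graph obtained from `G` by replacing the edge `ab` by the edge `cq`. -/
def rotate (G : SimpleGraph V) (a b c q : V) : SimpleGraph V :=
  G.deleteEdges {s(a, b)} ⊔ SimpleGraph.fromEdgeSet {s(c, q)}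

omit [Fintype V] in
lemma rotate_adj {a b c q : V} (hcq : c ≠ q) (x y : V) :
    (rotate G a b c q).Adj x y ↔ (G.Adj x y ∧ ¬ (x = a ∧ y = b) ∧ ¬ (x = b ∧ y = a)) ∨
      (x = c ∧ y = q) ∨ (x = q ∧ y = c) := by
  simp only [rotate, SimpleGraph.sup_adj, SimpleGraph.deleteEdges_adj, Set.mem_singleton_iff,
    Sym2.eq_iff, SimpleGraph.fromEdgeSet_adj, not_or]
  constructor
  · rintro (h | ⟨h, -⟩)
    · exact Or.inl h
    · exact Or.inr h
  · rintro (h | h)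
    · exact Or.inl h
    · refine Or.inr ⟨h, ?_⟩
      rcases h with ⟨rfl, rfl⟩ | ⟨rfl, rfl⟩
      · exact hcq
      · exact hcq.symm

omit [Fintype V] in
/-- The quadratic form of the matrix with entries `α` at `(c, q)` and `-β` at `(a, b)`,
symmetrized. -/
lemma sum_sum_two_edges [Fintype V] [DecidableEq V] (α β : ℝ) (x : V → ℝ) (a b c q : V) :
    ∑ i, ∑ j, (α * ((if i = c then 1 else 0) * (if j = q then 1 else 0)
        + (if i = q then 1 else 0) * (if j = c then 1 else 0))
      - β * ((if i = a then 1 else 0) * (if j = b then 1 else 0)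
        + (if i = b then 1 else 0) * (if j = a then 1 else 0))) * (x i * x j)
      = 2 * (α * (x c * x q) - β * (x a * x b)) := by
  have key : ∀ u w : V, ∑ i, ∑ j, ((if i = u then (1 : ℝ) else 0) * (if j = w then 1 else 0))
      * (x i * x j) = x u * x w := by
    intro u w
    rw [Finset.sum_eq_single u, Finset.sum_eq_single w]
    · simp
    · intro j _ hj; simp [hj]
    · simp
    · intro i _ hi; simp [hi]
    · simp
  have h1 := key c q
  have h2 := key q c
  have h3 := key a b
  have h4 := key b a
  calc _ = α * (∑ i, ∑ j, ((if i = c then (1 : ℝ) else 0) * (if j = q then 1 else 0))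
      * (x i * x j) + ∑ i, ∑ j, ((if i = q then (1 : ℝ) else 0) * (if j = c then 1 else 0))
      * (x i * x j)) - β * (∑ i, ∑ j, ((if i = a then (1 : ℝ) else 0) * (if j = b then 1 else 0))
      * (x i * x j) + ∑ i, ∑ j, ((if i = b then (1 : ℝ) else 0) * (if j = a then 1 else 0))
      * (x i * x j)) := by
        simp only [Finset.mul_sum, ← Finset.sum_add_distrib, ← Finset.sum_sub_distrib]
        exact Finset.sum_congr rfl fun i _ => Finset.sum_congr rfl fun j _ => by ring
    _ = _ := by rw [h1, h2, h3, h4]; ring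

omit [Fintype V] in
/-- The neighbourhoods after the move of `radius_lt_rotate`. -/
lemma rotate_star_adj [DecidableEq V] {h c a b q : V}
    {P : Finset V} (hhc : h ≠ c) (hha : h ≠ a) (hhb : h ≠ b)
    (hca : c ≠ a) (hcb : c ≠ b) (hab : a ≠ b) (hcP : c ∉ P) (hq : q ∈ P)
    (hNh : ∀ j, G.Adj h j ↔ j ∈ P ∪ {c}) (hNc : ∀ j, G.Adj c j ↔ j ∈ ({h, a, b} : Finset V))
    (hNa : ∀ j, G.Adj a j ↔ j ∈ ({c, b} : Finset V))
    (hNb : ∀ j, G.Adj b j ↔ j ∈ ({c, a} : Finset V))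
    (hNP : ∀ j ∈ P, ∀ y, G.Adj j y ↔ y = h) :
    (∀ j, (rotate G a b c q).Adj h j ↔ j ∈ P ∪ {c}) ∧
    (∀ j, (rotate G a b c q).Adj c j ↔ j ∈ ({h, a, b, q} : Finset V)) ∧
    (∀ j, (rotate G a b c q).Adj a j ↔ j ∈ ({c} : Finset V)) ∧
    (∀ j, (rotate G a b c q).Adj b j ↔ j ∈ ({c} : Finset V)) ∧
    (∀ j, (rotate G a b c q).Adj q j ↔ j ∈ ({h, c} : Finset V)) ∧
    (∀ j ∈ P, j ≠ q → ∀ y, (rotate G a b c q).Adj j y ↔ y ∈ ({h} : Finset V)) ∧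
    h ∉ P ∧ a ∉ P ∧ b ∉ P := by
  have hhP : h ∉ P := fun hh => ((hNh h).2 (Finset.mem_union_left _ hh)).ne rfl
  have haP : a ∉ P := fun ha => hhc ((hNP a ha c).1 ((hNa c).2 (by simp))).symm
  have hbP : b ∉ P := fun hb => hhc ((hNP b hb c).1 ((hNb c).2 (by simp))).symm
  have hcq : c ≠ q := by rintro rfl; exact hcP hq
  have hadj := fun x y => rotate_adj (G := G) (a := a) (b := b) hcq x y
  simp only [Finset.mem_union, Finset.mem_insert, Finset.mem_singleton] at *
  refine ⟨?_, ?_, ?_, ?_, ?_, ?_, hhP, haP, hbP⟩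
  · intro j; rw [hadj, hNh]; grind
  · intro j; rw [hadj, hNc]; grind
  · intro j; rw [hadj, hNa]; grind
  · intro j; rw [hadj, hNb]; grind
  · intro j; rw [hadj, hNP q hq]; grind
  · intro j hj hjq y; rw [hadj, hNP j hj]; grind

lemma isUnicyclic_rotate [DecidableEq V] {h c a b q : V}
    {P : Finset V} (hhc : h ≠ c) (hha : h ≠ a) (hhb : h ≠ b)
    (hca : c ≠ a) (hcb : c ≠ b) (hab : a ≠ b) (hcP : c ∉ P) (hq : q ∈ P)
    (hNh : ∀ j, G.Adj h j ↔ j ∈ P ∪ {c}) (hNc : ∀ j, G.Adj c j ↔ j ∈ ({h, a, b} : Finset V))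
    (hNa : ∀ j, G.Adj a j ↔ j ∈ ({c, b} : Finset V))
    (hNb : ∀ j, G.Adj b j ↔ j ∈ ({c, a} : Finset V))
    (hNP : ∀ j ∈ P, ∀ y, G.Adj j y ↔ y = h)
    (hcover : ∀ y, y = h ∨ y = c ∨ y = a ∨ y = b ∨ y ∈ P) :
    IsUnicyclic (rotate G a b c q) := by
  obtain ⟨hNh', hNc', hNa', hNb', hNq', hNP', hhP, haP, hbP⟩ :=
    rotate_star_adj hhc hha hhb hca hcb hab hcP hq hNh hNc hNa hNb hNP
  have hcq : c ≠ q := by rintro rfl; exact hcP hq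
  have hhq : h ≠ q := by rintro rfl; exact hhP hq
  have haq : a ≠ q := by rintro rfl; exact haP hq
  have hbq : b ≠ q := by rintro rfl; exact hbP hq
  have hf : IsParentMap (rotate G a b c q) h (fun y => if y = a ∨ y = b then c else h)
      (fun y => if y = h then 0 else if y = a ∨ y = b then 2 else 1) := by
    intro y hy
    rcases hcover y with rfl | rfl | rfl | rfl | hyP
    · exact absurd rfl hy
    · simpa [hca, hcb, hhc.symm] using ((hNh' y).2 (by simp)).symm
    · simpa [hy, hca, hcb, hhc.symm] using ((hNc' y).2 (by simp)).symm
    · simpa [hy, hca, hcb, hhc.symm] using ((hNc' y).2 (by simp)).symm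
    · have h2 : y ≠ a := fun e => haP (e ▸ hyP)
      have h3 : y ≠ b := fun e => hbP (e ▸ hyP)
      simpa [hy, h2, h3] using ((hNh' y).2 (Finset.mem_union_left _ hyP)).symm
  refine hf.isUnicyclic (a := c) (b := q) ((hNc' q).2 (by simp)) ?_ ?_
  · simp [TreeAdj, hca, hcb, hhc.symm, haq.symm, hbq.symm, hhq.symm]
  · intro x y hxy
    have hx := hcover x
    simp only [Finset.mem_insert, Finset.mem_singleton, Finset.mem_union] at hNh' hNc' hNa' hNb'
    simp only [Finset.mem_insert, Finset.mem_singleton] at hNq' hNP'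
    simp only [TreeAdj]
    grind

omit [Fintype V] in
lemma rotate_deg [DecidableEq V] {h c a b q : V}
    {P : Finset V} (hhc : h ≠ c) (hha : h ≠ a) (hhb : h ≠ b)
    (hca : c ≠ a) (hcb : c ≠ b) (hab : a ≠ b) (hcP : c ∉ P) (hq : q ∈ P)
    (hNh : ∀ j, G.Adj h j ↔ j ∈ P ∪ {c}) (hNc : ∀ j, G.Adj c j ↔ j ∈ ({h, a, b} : Finset V))
    (hNa : ∀ j, G.Adj a j ↔ j ∈ ({c, b} : Finset V))
    (hNb : ∀ j, G.Adj b j ↔ j ∈ ({c, a} : Finset V))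
    (hNP : ∀ j ∈ P, ∀ y, G.Adj j y ↔ y = h) :
    deg (rotate G a b c q) h = P.card + 1 ∧ deg (rotate G a b c q) c = 4 ∧
    deg (rotate G a b c q) a = 1 ∧ deg (rotate G a b c q) b = 1 ∧
    deg (rotate G a b c q) q = 2 ∧ ∀ j ∈ P, j ≠ q → deg (rotate G a b c q) j = 1 := by
  obtain ⟨hNh', hNc', hNa', hNb', hNq', hNP', hhP, haP, hbP⟩ :=
    rotate_star_adj hhc hha hhb hca hcb hab hcP hq hNh hNc hNa hNb hNP
  have hcq : c ≠ q := by rintro rfl; exact hcP hq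
  have hhq : h ≠ q := by rintro rfl; exact hhP hq
  have haq : a ≠ q := by rintro rfl; exact haP hq
  have hbq : b ≠ q := by rintro rfl; exact hbP hq
  have hdisj : Disjoint P {c} := by simpa using hcP
  refine ⟨?_, ?_, ?_, ?_, ?_, ?_⟩
  · rw [deg_eq_card hNh', Finset.card_union_of_disjoint hdisj, Finset.card_singleton]
  · rw [deg_eq_card hNc']
    simp [hha, hhb, hhq, hab, haq, hbq]
  · rw [deg_eq_card hNa', Finset.card_singleton]
  · rw [deg_eq_card hNb', Finset.card_singleton]
  · rw [deg_eq_card hNq', Finset.card_pair hhc]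
  · intro j hj hjq
    rw [deg_eq_card (hNP' j hj hjq), Finset.card_singleton]

/-- The graph in which a triangle `cab` hangs by an edge `ch` on the centre of a star: opening the
triangle by replacing `ab` with an edge from `c` to a leaf `q` of the star, which creates the
triangle `chq`, keeps the graph unicyclic and increases the spectral radius. -/
lemma radius_lt_rotate [DecidableEq V] (hp : 2 ≤ p) (hG : IsUnicyclic G) {h c a b q : V}
    {P : Finset V} (hhc : h ≠ c) (hha : h ≠ a) (hhb : h ≠ b)
    (hca : c ≠ a) (hcb : c ≠ b) (hab : a ≠ b) (hcP : c ∉ P) (hq : q ∈ P)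
    (hNh : ∀ j, G.Adj h j ↔ j ∈ P ∪ {c}) (hNc : ∀ j, G.Adj c j ↔ j ∈ ({h, a, b} : Finset V))
    (hNa : ∀ j, G.Adj a j ↔ j ∈ ({c, b} : Finset V))
    (hNb : ∀ j, G.Adj b j ↔ j ∈ ({c, a} : Finset V))
    (hNP : ∀ j ∈ P, ∀ y, G.Adj j y ↔ y = h)
    (hP3 : 3 ≤ P.card) (hcover : ∀ y, y = h ∨ y = c ∨ y = a ∨ y = b ∨ y ∈ P) :
    pSomborRadius p G < pSomborRadius p (rotate G a b c q) := by
  obtain ⟨hNh', hNc', hNa', hNb', hNq', hNP', hhP, haP, hbP⟩ :=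
    rotate_star_adj hhc hha hhb hca hcb hab hcP hq hNh hNc hNa hNb hNP
  obtain ⟨hdh', hdc', hda', hdb', hdq', hdP'⟩ :=
    rotate_deg hhc hha hhb hca hcb hab hcP hq hNh hNc hNa hNb hNP
  have hcq : c ≠ q := by rintro rfl; exact hcP hq
  have haq : a ≠ q := by rintro rfl; exact haP hq
  have hbq : b ≠ q := by rintro rfl; exact hbP hq
  have hdisj : Disjoint P {c} := by simpa using hcP
  have hdh : deg G h = P.card + 1 := by
    rw [deg_eq_card hNh, Finset.card_union_of_disjoint hdisj, Finset.card_singleton]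
  have hdc : deg G c = 3 := by
    rw [deg_eq_card hNc, Finset.card_eq_three]
    exact ⟨h, a, b, hha, hhb, hab, rfl⟩
  have hda : deg G a = 2 := by rw [deg_eq_card hNa, Finset.card_pair hcb]
  have hdb : deg G b = 2 := by rw [deg_eq_card hNb, Finset.card_pair hca]
  have hNP1 : ∀ j ∈ P, ∀ y, G.Adj j y ↔ y ∈ ({h} : Finset V) := by simpa using hNP
  have hdP : ∀ j ∈ P, deg G j = 1 := fun j hj => by
    rw [deg_eq_card (hNP1 j hj), Finset.card_singleton]
  obtain ⟨x, hx⟩ := exists_isPerron hp hG.1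
  have : Nonempty V := ⟨h⟩
  have e1 := hx.sum_neighbors hNc
  have e2 := hx.sum_neighbors hNa
  have e3 := hx.sum_neighbors hNb
  have e4 := hx.sum_neighbors (hNP1 q hq)
  have hlam0 := hx.radius_nonneg h
  rw [Finset.sum_insert (by simp [hha, hhb]), Finset.sum_pair hab] at e1
  rw [Finset.sum_pair hcb] at e2
  rw [Finset.sum_pair hca] at e3
  rw [Finset.sum_singleton] at e4
  have hsq := hx.sum_sq_le h
  have hsq' : (P.card : ℝ) * wt p (P.card + 1) 1 ^ 2 + wt p (P.card + 1) 3 ^ 2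
      ≤ pSomborRadius p G ^ 2 := by
    refine le_trans (le_of_eq ?_) (le_trans (Finset.sum_le_sum_of_subset_of_nonneg
      (Finset.subset_univ (P ∪ {c})) fun _ _ _ => sq_nonneg _) hsq)
    rw [Finset.sum_union hdisj, Finset.sum_singleton, pSomborMatrix_of_adj ((hNh c).2 (by simp)),
      edgeWt, hdh, hdc, Finset.sum_congr rfl fun j hj => by
        rw [pSomborMatrix_of_adj ((hNh j).2 (Finset.mem_union_left _ hj)), edgeWt, hdh,
          hdP j hj], Finset.sum_const, nsmul_eq_mul]
    push_cast
    ring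
  simp only [edgeWt, hdh, hdc, hda, hdb, hdP q hq] at e1 e2 e3 e4
  push_cast at e1 e2 e3 e4
  have hm : (4 : ℝ) ≤ P.card + 1 := by
    have : (3 : ℝ) ≤ P.card := by exact_mod_cast hP3
    linarith
  set m : ℝ := P.card + 1 with hm_def
  have hcard : (P.card : ℝ) = m - 1 := by rw [hm_def]; ring
  rw [hcard] at hsq'
  have hw1 : m ≤ wt p m 1 := le_wt hp (by linarith) zero_le_one
  have hc0 : 2 ≤ wt p 2 2 := le_wt hp (by norm_num) (by norm_num)
  have hxab : x b = x a := by
    have h1 : (pSomborRadius p G + wt p 2 2) * (x b - x a) = 0 := by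
      linear_combination e2 - e3
    have := (mul_eq_zero.1 h1).resolve_left (by positivity)
    linarith
  rw [hxab] at e1 e2
  have h23 : wt p 2 3 ^ 2 ≤ 2 ^ 2 + 3 ^ 2 := wt_sq_le hp (by norm_num) (by norm_num)
  have h22 : wt p 2 2 ^ 2 ≤ 2 ^ 2 + 2 ^ 2 := wt_sq_le hp (by norm_num) (by norm_num)
  have key := lt_of_pendant_triangle_equations (m := m) (lam := pSomborRadius p G)
    (W := wt p m 3) (w1 := wt p m 1) (t := wt p 2 3) (c := wt p 2 2) (w42 := wt p 4 2)
    (xh := x h) (xc := x c) (xa := x a) (xq := x q) hm hlam0 (by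
      refine le_trans ?_ hsq'
      have h1 : 0 ≤ m - 1 := by linarith
      have h2 : m ^ 2 ≤ wt p m 1 ^ 2 := pow_le_pow_left₀ (by linarith) hw1 2
      exact add_le_add_left (mul_le_mul_of_nonneg_left h2 h1) _)
    (le_wt hp (by linarith) (by norm_num)) hw1
    (h23.trans (by norm_num))
    (lt_of_lt_of_le two_pos (le_wt hp (by norm_num) (by norm_num)))
    (h22.trans (by norm_num))
    (le_wt hp (by norm_num) (by norm_num)) (hx.pos h) (hx.pos c) (hx.pos a) (by
      rw [wt_comm p m 3, wt_comm p 2 3]; linear_combination e1) e2 (by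
      rw [wt_comm p m 1]; exact e4)
  refine hx.lt_of_sum_pos (lt_of_lt_of_le ?_ (Finset.sum_le_sum fun i _ =>
    Finset.sum_le_sum fun j _ => mul_le_mul_of_nonneg_right (?_ :
      wt p 4 2 * ((if i = c then 1 else 0) * (if j = q then 1 else 0)
        + (if i = q then 1 else 0) * (if j = c then 1 else 0))
      - wt p 2 2 * ((if i = a then 1 else 0) * (if j = b then 1 else 0)
        + (if i = b then 1 else 0) * (if j = a then 1 else 0)) ≤ _)
      (mul_pos (hx.pos i) (hx.pos j)).le))
  · rw [sum_sum_two_edges, hxab]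
    linarith
  · -- no other entry decreases: only the degrees of `a` and `b` drop
    have hle : ∀ y, y ≠ a → y ≠ b → deg G y ≤ deg (rotate G a b c q) y := by
      intro y hya hyb
      rcases hcover y with rfl | rfl | rfl | rfl | hyP
      · rw [hdh, hdh']
      · rw [hdc, hdc']; norm_num
      · exact absurd rfl hya
      · exact absurd rfl hyb
      · rw [hdP y hyP]
        by_cases hyq : y = q
        · rw [hyq, hdq']; norm_num
        · rw [hdP' y hyP hyq]
    have hca' : wt p 2 3 ≤ wt p 1 4 := by
      have := wt_le_wt_of_spread (a := 3) (b := 2) (k := 1) hp (by norm_num) (by norm_num)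
        (by norm_num) (by norm_num)
      rw [wt_comm p 2 3, wt_comm p 1 4]
      norm_num at this
      exact this
    have hend : ∀ y z, y = a ∨ y = b → z = c →
        pSomborMatrix p G y z ≤ pSomborMatrix p (rotate G a b c q) y z := by
      rintro y z (rfl | rfl) rfl
      · rw [pSomborMatrix_of_adj ((hNa z).2 (by simp)), pSomborMatrix_of_adj ((hNa' z).2 (by simp)),
          edgeWt, edgeWt, hda, hdc, hda', hdc']
        exact_mod_cast hca'
      · rw [pSomborMatrix_of_adj ((hNb z).2 (by simp)), pSomborMatrix_of_adj ((hNb' z).2 (by simp)),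
          edgeWt, edgeWt, hdb, hdc, hdb', hdc']
        exact_mod_cast hca'
    have hnbr : ∀ y z, y = a ∨ y = b → G.Adj y z → z = c ∨ (y = a ∧ z = b) ∨ (y = b ∧ z = a) := by
      rintro y z (rfl | rfl) hyz
      · have := (hNa z).1 hyz
        simp only [Finset.mem_insert, Finset.mem_singleton] at this
        exact this.imp_right fun e => Or.inl ⟨rfl, e⟩
      · have := (hNb z).1 hyz
        simp only [Finset.mem_insert, Finset.mem_singleton] at this
        exact this.imp_right fun e => Or.inr ⟨rfl, e⟩
    have hmono : ¬ (i = a ∧ j = b) → ¬ (i = b ∧ j = a) →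
        pSomborMatrix p G i j ≤ pSomborMatrix p (rotate G a b c q) i j := by
      intro h1 h2
      by_cases hij : G.Adj i j
      · by_cases hi : i = a ∨ i = b
        · exact hend i j hi ((hnbr i j hi hij).resolve_right (not_or.2 ⟨h1, h2⟩))
        by_cases hj : j = a ∨ j = b
        · rw [pSomborMatrix_comm i j, pSomborMatrix_comm i j]
          refine hend j i hj ((hnbr j i hj hij.symm).resolve_right ?_)
          rintro (⟨e1, e2⟩ | ⟨e1, e2⟩)
          · exact h2 ⟨e2, e1⟩
          · exact h1 ⟨e2, e1⟩
        push Not at hi hj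
        rw [pSomborMatrix_of_adj hij, pSomborMatrix_of_adj
          ((rotate_adj hcq i j).2 (Or.inl ⟨hij, h1, h2⟩)), edgeWt, edgeWt]
        exact wt_le_wt hp (Nat.cast_nonneg _) (Nat.cast_nonneg _)
          (Nat.cast_le.2 (hle i hi.1 hi.2)) (Nat.cast_le.2 (hle j hj.1 hj.2))
      · rw [pSomborMatrix_of_not_adj hij]
        exact pSomborMatrix_nonneg _ _
    have hcq0 : ¬ G.Adj c q := fun hh => hhc ((hNP q hq c).1 hh.symm).symm
    have hab0 : ¬ (rotate G a b c q).Adj a b :=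
      fun hh => hcb (by simpa using (hNa' b).1 hh : b = c).symm
    have hcq1 : (rotate G a b c q).Adj c q := (hNc' q).2 (by simp)
    have hab1 : G.Adj a b := (hNa b).2 (by simp)
    by_cases g1 : i = c ∧ j = q
    · obtain ⟨rfl, rfl⟩ := g1
      rw [pSomborMatrix_of_adj hcq1, pSomborMatrix_of_not_adj hcq0, edgeWt, hdc', hdq']
      simp [hca, hcb, hcq]
    by_cases g2 : i = q ∧ j = c
    · obtain ⟨rfl, rfl⟩ := g2
      rw [pSomborMatrix_of_adj hcq1.symm, pSomborMatrix_of_not_adj (fun hh => hcq0 hh.symm), edgeWt,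
        hdc', hdq']
      simp [hca, hcb, hcq.symm, wt_comm p 2 4]
    by_cases g3 : i = a ∧ j = b
    · obtain ⟨rfl, rfl⟩ := g3
      rw [pSomborMatrix_of_adj hab1, pSomborMatrix_of_not_adj hab0, edgeWt, hda, hdb]
      simp [hca.symm, hab, haq]
    by_cases g4 : i = b ∧ j = a
    · obtain ⟨rfl, rfl⟩ := g4
      rw [pSomborMatrix_of_adj hab1.symm, pSomborMatrix_of_not_adj (fun hh => hab0 hh.symm), edgeWt,
        hda, hdb]
      simp [hcb.symm, hab.symm, hbq]
    have key0 : ∀ u w : V, ¬ (i = u ∧ j = w) →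
        ((if i = u then (1 : ℝ) else 0) * (if j = w then 1 else 0)) = 0 := by
      intro u w huw
      by_cases hi : i = u
      · rw [if_neg fun hj => huw ⟨hi, hj⟩, mul_zero]
      · rw [if_neg hi, zero_mul]
    rw [key0 _ _ g1, key0 _ _ g2, key0 _ _ g3, key0 _ _ g4]
    have := hmono g3 g4
    linarith

end PSombor

namespace PSombor

/-! ### Extremal graphs with bounded degrees -/

variable {V : Type*} [Fintype V] {p : ℝ} {G : SimpleGraph V}

/-- `G` has the largest spectral radius among the unicyclic graphs on its vertex set all of whose
degrees are at most `n - 3`, where `n` is the order. -/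
structure IsExtremal (p : ℝ) (G : SimpleGraph V) : Prop where
  unicyclic : IsUnicyclic G
  deg_le : ∀ v, deg G v + 3 ≤ Fintype.card V
  radius_le : ∀ G' : SimpleGraph V, IsUnicyclic G' → (∀ v, deg G' v + 3 ≤ Fintype.card V) →
    pSomborRadius p G' ≤ pSomborRadius p G

lemma deg_add_ncard_privateNbrs_le {u v y z : V} (hyz : y ≠ z) (hyu : y ≠ u) (hzu : z ≠ u)
    (huy : ¬ G.Adj u y) (huz : ¬ G.Adj u z) (hvy : ¬ G.Adj v y) (hvz : ¬ G.Adj v z) :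
    deg G u + (privateNbrs G u v).ncard + 3 ≤ Fintype.card V := by
  have h1 : Disjoint (G.neighborSet u) (privateNbrs G u v) := by
    rw [Set.disjoint_left]
    exact fun w hw hw' => hw'.2.1 hw
  have h2 : Disjoint (G.neighborSet u ∪ privateNbrs G u v) {u, y, z} := by
    rw [Set.disjoint_right]
    rintro w (rfl | rfl | rfl) (hw | hw)
    · exact hw.ne rfl
    · exact hw.2.2 rfl
    · exact huy hw
    · exact hvy hw.1
    · exact huz hw
    · exact hvz hw.1
  have h3 : ({u, y, z} : Set V).ncard = 3 :=
    Set.ncard_eq_three.2 ⟨u, y, z, hyu.symm, hzu.symm, hyz, rfl⟩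
  rw [← Nat.card_eq_fintype_card, deg, ← Set.ncard_union_eq h1, ← h3, ← Set.ncard_union_eq h2]
  exact Set.ncard_le_card _

namespace IsExtremal

lemma radius_shift_le (hE : IsExtremal p G) {u v : V} {A : Set V} (h : Shiftable G u v A)
    (hlink : G.Adj u v ∨ ∃ w, G.Adj u w ∧ G.Adj v w)
    (hd : deg G u + A.ncard + 3 ≤ Fintype.card V) :
    pSomborRadius p (shift G u v A) ≤ pSomborRadius p G := by
  refine hE.radius_le _ (h.shift_isUnicyclic hE.unicyclic hlink) fun y => ?_
  by_cases hyu : y = u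
  · rw [hyu, h.deg_shift_left]
    exact hd
  by_cases hyv : y = v
  · have h1 := h.deg_shift_right
    have h2 := hE.deg_le v
    rw [hyv]
    omega
  · rw [h.deg_shift_of_ne hyu hyv]
    exact hE.deg_le y

/-- Moving the private neighbours between two vertices at distance at most two must create a
degree above the bound. -/
lemma card_lt (hE : IsExtremal p G) (hp : 2 ≤ p) {u v a b : V} (huv : u ≠ v)
    (hlink : G.Adj u v ∨ ∃ w, G.Adj u w ∧ G.Adj v w)
    (ha : a ∈ privateNbrs G u v) (hb : b ∈ privateNbrs G v u) :
    Fintype.card V < deg G u + (privateNbrs G u v).ncard + 3 ∨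
      Fintype.card V < deg G v + (privateNbrs G v u).ncard + 3 := by
  have key : ∀ u v a b : V, u ≠ v → (G.Adj u v ∨ ∃ w, G.Adj u w ∧ G.Adj v w) →
      a ∈ privateNbrs G u v → b ∈ privateNbrs G v u →
      ∀ x, IsPerron p G x → x v ≤ x u →
      Fintype.card V < deg G u + (privateNbrs G u v).ncard + 3 := by
    intro u v a b huv hlink ha hb x hx hxuv
    by_contra! hcon
    exact absurd (hE.radius_shift_le (shiftable_privateNbrs huv) hlink hcon)
      (not_le.2 (radius_lt_shift_privateNbrs hp hx huv hxuv ha hb))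
  obtain ⟨x, hx⟩ := exists_isPerron hp hE.unicyclic.1
  rcases le_total (x v) (x u) with h | h
  · exact Or.inl (key u v a b huv hlink ha hb x hx h)
  · exact Or.inr (key v u b a huv.symm (hlink.imp (fun h => h.symm)
      fun ⟨w, h1, h2⟩ => ⟨w, h2, h1⟩) hb ha x hx h)

/-- In an extremal graph, two adjacent vertices with private neighbours on both sides dominate all
but at most one vertex. -/
lemma false_of_adj (hE : IsExtremal p G) (hp : 2 ≤ p) {u v : V} (huv : G.Adj u v) (a b y z : V)
    (hva : G.Adj v a) (hua : ¬ G.Adj u a) (hau : a ≠ u)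
    (hub : G.Adj u b) (hvb : ¬ G.Adj v b) (hbv : b ≠ v)
    (hyz : y ≠ z) (hyu : y ≠ u) (hyv : y ≠ v) (hzu : z ≠ u) (hzv : z ≠ v)
    (huy : ¬ G.Adj u y) (huz : ¬ G.Adj u z) (hvy : ¬ G.Adj v y) (hvz : ¬ G.Adj v z) : False := by
  have h1 := deg_add_ncard_privateNbrs_le hyz hyu hzu huy huz hvy hvz
  have h2 := deg_add_ncard_privateNbrs_le hyz hyv hzv hvy hvz huy huz
  have := hE.card_lt hp huv.ne (Or.inl huv) (a := a) (b := b) ⟨hva, hua, hau⟩ ⟨hub, hvb, hbv⟩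
  omega

/-- In an extremal graph, two vertices at distance two with private neighbours on both sides
dominate all other vertices. -/
lemma false_of_not_adj (hE : IsExtremal p G) (hp : 2 ≤ p) {u v w : V} (huv : u ≠ v)
    (huv' : ¬ G.Adj u v) (huw : G.Adj u w) (hvw : G.Adj v w) (a b y : V)
    (hva : G.Adj v a) (hua : ¬ G.Adj u a) (hub : G.Adj u b) (hvb : ¬ G.Adj v b)
    (hyu : y ≠ u) (hyv : y ≠ v) (huy : ¬ G.Adj u y) (hvy : ¬ G.Adj v y) : False := by
  have hvu : ¬ G.Adj v u := fun h => huv' h.symm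
  have h1 := deg_add_ncard_privateNbrs_le hyv hyu huv.symm huy huv' hvy (G.loopless.irrefl v)
  have h2 := deg_add_ncard_privateNbrs_le hyu hyv huv hvy hvu huy (G.loopless.irrefl u)
  have := hE.card_lt hp huv (Or.inr ⟨w, huw, hvw⟩) (a := a) (b := b)
    ⟨hva, hua, fun h => hvu (h ▸ hva)⟩ ⟨hub, hvb, fun h => huv' (h ▸ hub)⟩
  omega

end IsExtremal

end PSombor

namespace PSombor

/-! ### Structure of the extremal graphs -/

variable {V : Type*} [Fintype V] {p : ℝ} {G : SimpleGraph V}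

lemma exists_adj_notMem {c : V} (s : Finset V) (h : s.card < deg G c) :
    ∃ t, G.Adj c t ∧ t ∉ s := by
  by_contra! hcon
  have : G.neighborSet c ⊆ s := fun t ht => hcon t ht
  have := Set.ncard_le_ncard this
  rw [Set.ncard_coe_finset] at this
  exact absurd h (not_lt.2 this)

lemma card_le_deg {v : V} (s : Finset V) (h : ∀ y ∈ s, G.Adj v y) : s.card ≤ deg G v := by
  rw [← Set.ncard_coe_finset]
  exact Set.ncard_le_ncard (fun y hy => h y hy)

lemma card_le_of_cover [DecidableEq V] {c v : V} (s : Finset V)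
    (h : ∀ y, G.Adj c y ∨ G.Adj v y ∨ y ∈ s) :
    Fintype.card V ≤ deg G c + deg G v + s.card := by
  have h1 : (Set.univ : Set V) ⊆ G.neighborSet c ∪ G.neighborSet v ∪ s := by
    intro y _
    rcases h y with h | h | h
    · exact Or.inl (Or.inl h)
    · exact Or.inl (Or.inr h)
    · exact Or.inr h
  rw [← Nat.card_eq_fintype_card, ← Set.ncard_univ, ← Set.ncard_coe_finset s]
  refine (Set.ncard_le_ncard h1).trans ((Set.ncard_union_le _ _).trans ?_)
  exact Nat.add_le_add_right (Set.ncard_union_le _ _) _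

open Classical in
lemma card_filter_not_adj_add_deg (c : V) :
    (Finset.univ.filter fun y => y ≠ c ∧ ¬ G.Adj c y).card + deg G c + 1 = Fintype.card V := by
  have h1 : deg G c = (Finset.univ.filter fun y => G.Adj c y).card := deg_eq_card (by simp)
  have h2 : (Finset.univ.filter fun y => y ≠ c ∧ ¬ G.Adj c y) ∪
      (Finset.univ.filter fun y => G.Adj c y) = Finset.univ.erase c := by
    ext y
    simp only [Finset.mem_union, Finset.mem_filter, Finset.mem_univ, true_and, Finset.mem_erase,
      and_true]
    constructor
    · rintro (h | h)
      · exact h.1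
      · exact h.ne'
    · intro h
      by_cases hy : G.Adj c y
      · exact Or.inr hy
      · exact Or.inl ⟨h, hy⟩
  have h3 : Disjoint (Finset.univ.filter fun y => y ≠ c ∧ ¬ G.Adj c y)
      (Finset.univ.filter fun y => G.Adj c y) := by
    rw [Finset.disjoint_left]
    intro y hy hy'
    simp only [Finset.mem_filter, Finset.mem_univ, true_and] at hy hy'
    exact hy.2 hy'
  rw [h1, ← Finset.card_union_of_disjoint h3, h2, Finset.card_erase_add_one (Finset.mem_univ c),
    Finset.card_univ]

lemma exists_not_adj_notMem {c : V} (s : Finset V) (h : s.card + deg G c + 1 < Fintype.card V) :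
    ∃ y, y ≠ c ∧ ¬ G.Adj c y ∧ y ∉ s := by
  classical
  by_contra! hcon
  have h1 := card_filter_not_adj_add_deg (G := G) c
  have h2 : (Finset.univ.filter fun y => y ≠ c ∧ ¬ G.Adj c y) ⊆ s := by
    intro y hy
    simp only [Finset.mem_filter, Finset.mem_univ, true_and] at hy
    exact hcon y hy.1 hy.2
  have := Finset.card_le_card h2
  omega

omit [Fintype V] in
/-- The tree when every vertex is within distance one of `c` or of its neighbour `v`. -/
lemma isParentMap_of_forall_adj [DecidableRel G.Adj] [DecidableEq V] {c v : V} (hcv : G.Adj c v)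
    (hZ : ∀ y, y ≠ c → ¬ G.Adj c y → G.Adj v y) :
    IsParentMap G c (fun x => if G.Adj c x then c else v)
      (fun x => if x = c then 0 else if G.Adj c x then 1 else 2) := by
  intro x hx
  by_cases h : G.Adj c x
  · simp [hx, h, h.symm]
  · simp [hx, h, hcv, hcv.ne', (hZ x hx h).symm]

namespace IsExtremal

variable {c v : V}

/-- The only extremal graph consisting of a triangle with pendent vertices at two of its vertices
has two pendent vertices at the vertex of smaller degree: with more than two of them, one could be
moved without violating the bound on the degrees. -/
lemma nonempty_iso_U4_of_triangle {n : ℕ} (hn : 7 ≤ n) (hV : Fintype.card V = n)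
    (hE : IsExtremal p G) (hp : 2 ≤ p) (hmax : deg G v ≤ deg G c) {a : V} (hcv : G.Adj c v)
    (hZ : ∀ y, y ≠ c → ¬ G.Adj c y → G.Adj v y) (hca : G.Adj c a) (hva : G.Adj v a)
    (hall : ∀ x y, G.Adj x y → x ≠ c → y ≠ c → (x = v ∧ ¬ G.Adj c y) ∨ (y = v ∧ ¬ G.Adj c x) ∨
      (x = v ∧ y = a) ∨ (x = a ∧ y = v)) : Nonempty (G ≃g U4 n) := by
  classical
  set K : Finset V := Finset.univ.filter fun y => y ≠ c ∧ ¬ G.Adj c y with hK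
  set P : Finset V := Finset.univ.filter fun y => G.Adj c y ∧ y ≠ v ∧ y ≠ a with hP
  have mK : ∀ y, y ∈ K ↔ y ≠ c ∧ ¬ G.Adj c y := by simp [hK]
  have mP : ∀ y, y ∈ P ↔ G.Adj c y ∧ y ≠ v ∧ y ≠ a := by simp [hP]
  have hcard := card_filter_not_adj_add_deg (G := G) c
  rw [← hK, hV] at hcard
  have hdeg := hE.deg_le c
  have h1 := hcv.ne
  have h2 := hca.ne
  have h3 := hva.ne
  have hNc : ∀ j, G.Adj c j ↔ j ∈ P ∪ {v, a} := by
    intro j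
    simp only [Finset.mem_union, mP, Finset.mem_insert, Finset.mem_singleton]
    grind
  have hNv : ∀ j, G.Adj v j ↔ j ∈ K ∪ {c, a} := by
    intro j
    simp only [Finset.mem_union, mK, Finset.mem_insert, Finset.mem_singleton]
    constructor
    · intro hj
      have := hall v j hj h1.symm
      have := hj.ne
      grind
    · rintro (hj | rfl | rfl)
      · exact hZ j hj.1 hj.2
      · exact hcv.symm
      · exact hva
  have hNa : ∀ j, G.Adj a j ↔ j ∈ ({c, v} : Finset V) := by
    intro j
    simp only [Finset.mem_insert, Finset.mem_singleton]
    constructor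
    · intro hj
      have := hall a j hj h2.symm
      grind
    · rintro (rfl | rfl)
      · exact hca.symm
      · exact hva.symm
  have hNP : ∀ j ∈ P, ∀ y, G.Adj j y ↔ y = c := by
    intro j hj y
    rw [mP] at hj
    constructor
    · intro hjy
      have := hall j y hjy hj.1.ne'
      grind
    · rintro rfl
      exact hj.1.symm
  have hNK : ∀ j ∈ K, ∀ y, G.Adj j y ↔ y = v := by
    intro j hj y
    rw [mK] at hj
    constructor
    · intro hjy
      have := hall j y hjy hj.1
      have : y ≠ c := by rintro rfl; exact hj.2 hjy.symm
      grind
    · rintro rfl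
      exact (hZ j hj.1 hj.2).symm
  have hdP : Disjoint P {v, a} := by
    rw [Finset.disjoint_left]
    intro y hy hy'
    simp only [Finset.mem_insert, Finset.mem_singleton] at hy'
    exact hy'.elim ((mP y).1 hy).2.1 ((mP y).1 hy).2.2
  have hdK : Disjoint K {c, a} := by
    rw [Finset.disjoint_left]
    intro y hy hy'
    simp only [Finset.mem_insert, Finset.mem_singleton] at hy'
    exact hy'.elim ((mK y).1 hy).1 fun e => ((mK y).1 hy).2 (e ▸ hca)
  have hdPK : Disjoint P K := by
    rw [Finset.disjoint_left]
    exact fun y hy hy' => ((mK y).1 hy').2 ((mP y).1 hy).1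
  have hdc : deg G c = P.card + 2 := by
    rw [deg_eq_card hNc, Finset.card_union_of_disjoint hdP, Finset.card_pair h3]
  have hdv : deg G v = K.card + 2 := by
    rw [deg_eq_card hNv, Finset.card_union_of_disjoint hdK, Finset.card_pair h2]
  rcases lt_or_ge 2 K.card with h | h
  · obtain ⟨x, hx⟩ := exists_isPerron hp hE.unicyclic.1
    obtain ⟨z, hz⟩ := Finset.card_pos.1 (by omega : 0 < K.card)
    have hz' := (mK z).1 hz
    have hs : Shiftable G c v {z} := by
      refine ⟨h1, ?_, ?_, fun h => hz'.1 h.symm⟩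
      · rintro w rfl
        exact hZ w hz'.1 hz'.2
      · rintro w rfl
        exact hz'.2
    exact absurd (hE.radius_shift_le hs (Or.inl hcv) (by rw [Set.ncard_singleton]; omega))
      (not_le.2 (radius_lt_shift_pendant hp hx h2 h3 h1 hdP hdK hdPK hz hNc hNv hNP hNK hNa
        (by omega)))
  · obtain ⟨z, z', hzz, hKz⟩ := Finset.card_eq_two.1 (by omega : K.card = 2)
    have hz := (mK z).1 (by rw [hKz]; simp)
    have hz' := (mK z').1 (by rw [hKz]; simp)
    refine nonempty_iso_U4 hn hV hE.unicyclic (c := c) (a := v) (b := a) (z := z) (z' := z') ?_ ?_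
      hva (hZ z hz.1 hz.2) (hZ z' hz'.1 hz'.2)
    · have e1 : v ≠ z := fun e => hz.2 (e ▸ hcv)
      have e2 : v ≠ z' := fun e => hz'.2 (e ▸ hcv)
      have e3 : a ≠ z := fun e => hz.2 (e ▸ hca)
      have e4 : a ≠ z' := fun e => hz'.2 (e ▸ hca)
      simp [h1, h2, h3, hz.1.symm, hz'.1.symm, hzz, e1, e2, e3, e4]
    · intro y hyc hyz hyz'
      by_contra hy
      have := (mK y).2 ⟨hyc, hy⟩
      rw [hKz] at this
      simp [hyz, hyz'] at this

/-- When `v` is adjacent to all non-neighbours of `c`, the extra edge `ab` does not join two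
neighbours of `c` other than `v`: one could move edges between `a` and `v`. As in the following
lemmas, `hall` says that every edge avoiding `c` is either an edge from `v` to a non-neighbour
of `c` or the edge `ab`. -/
lemma false_of_adj_neighbors (hE : IsExtremal p G) (hp : 2 ≤ p) {a b z : V} (hcv : G.Adj c v)
    (hd : 4 ≤ deg G c) (hz : z ≠ c) (hcz : ¬ G.Adj c z) (hvz : G.Adj v z) (hca : G.Adj c a)
    (hcb : G.Adj c b) (hav : a ≠ v) (hbv : b ≠ v) (hab : G.Adj a b)
    (hall : ∀ x y, G.Adj x y → x ≠ c → y ≠ c → (x = v ∧ ¬ G.Adj c y) ∨ (y = v ∧ ¬ G.Adj c x) ∨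
      (x = a ∧ y = b) ∨ (x = b ∧ y = a)) : False := by
  classical
  obtain ⟨t, hct, ht⟩ := exists_adj_notMem {v, a, b} (lt_of_le_of_lt Finset.card_le_three hd)
  simp only [Finset.mem_insert, Finset.mem_singleton, not_or] at ht
  have h1 := hall a v
  have h2 := hall a z
  have h3 := hall v b
  have h4 := hall a t
  have h5 := hall v t
  have := hca.ne
  have := hcb.ne
  have := hcv.ne
  have := hct.ne
  exact hE.false_of_not_adj hp (u := a) (v := v) (w := c) hav (by grind) hca.symm hcv.symm z b t
    hvz (by grind) hab (by grind) (by grind) (by grind) (by grind) (by grind)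

/-- The extra edge `ab` does not join a neighbour of `c` to a non-neighbour of `c`: one could move
edges between its ends. -/
lemma false_of_adj_neighbor_nonneighbor (hE : IsExtremal p G) (hp : 2 ≤ p) {a b : V}
    (hcv : G.Adj c v) (hd : 4 ≤ deg G c) (hbc : b ≠ c) (hcb : ¬ G.Adj c b) (hvb : G.Adj v b)
    (hca : G.Adj c a) (hav : a ≠ v) (hab : G.Adj a b)
    (hall : ∀ x y, G.Adj x y → x ≠ c → y ≠ c → (x = v ∧ ¬ G.Adj c y) ∨ (y = v ∧ ¬ G.Adj c x) ∨
      (x = a ∧ y = b) ∨ (x = b ∧ y = a)) : False := by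
  classical
  obtain ⟨t, hct, ht⟩ := exists_adj_notMem {v, a}
    (lt_of_le_of_lt Finset.card_le_two (lt_of_lt_of_le (by norm_num) hd))
  obtain ⟨s, hcs, hs⟩ := exists_adj_notMem {v, a, t} (lt_of_le_of_lt Finset.card_le_three hd)
  simp only [Finset.mem_insert, Finset.mem_singleton, not_or] at ht hs
  have h1 := hall a v
  have h2 := hall a t
  have h3 := hall a s
  have h4 := hall b t
  have h5 := hall b s
  have := hca.ne
  have := hcv.ne
  have := hct.ne
  have := hcs.ne
  have h6 : ¬ G.Adj b c := fun h => hcb h.symm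
  exact hE.false_of_adj hp (u := a) (v := b) hab v c t s hvb.symm (by grind) hav.symm hca.symm h6
    hbc.symm (by grind) (by grind) (by grind) (by grind) (by grind) (by grind) (by grind)
    (by grind) (by grind)

/-- The extra edge `ab` does not join two non-neighbours of `c`: if there is a third non-neighbour,
one can move edges between `c` and `a`, and otherwise the graph is a triangle hanging by an edge on
the centre of a star, to which `radius_lt_rotate` applies. -/
lemma false_of_adj_nonneighbors (hE : IsExtremal p G) (hp : 2 ≤ p) {a b : V}
    (hcv : G.Adj c v) (hd : 4 ≤ deg G c) (hac : a ≠ c) (hca : ¬ G.Adj c a) (hbc : b ≠ c)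
    (hcb : ¬ G.Adj c b) (hZ : ∀ y, y ≠ c → ¬ G.Adj c y → G.Adj v y) (hab : G.Adj a b)
    (hall : ∀ x y, G.Adj x y → x ≠ c → y ≠ c → (x = v ∧ ¬ G.Adj c y) ∨ (y = v ∧ ¬ G.Adj c x) ∨
      (x = a ∧ y = b) ∨ (x = b ∧ y = a)) : False := by
  classical
  have hva := hZ a hac hca
  have hvb := hZ b hbc hcb
  have hcv' := hcv.ne
  have hva' := hva.ne
  have hvb' := hvb.ne
  have hab' := hab.ne
  -- any further vertex outside the closed neighbourhood of `c` is dominated by neither `c` nor `a`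
  have hab_only : ∀ y, y ≠ c → ¬ G.Adj c y → y = a ∨ y = b := by
    intro y hyc hcy
    by_contra! hy
    obtain ⟨t, hct, ht⟩ := exists_adj_notMem {v}
      (lt_of_le_of_lt (Finset.card_singleton v).le (lt_of_lt_of_le (by norm_num) hd))
    rw [Finset.mem_singleton] at ht
    have h1 := hall a t
    have h2 := hall a y
    have := hct.ne
    have : y ≠ v := by rintro rfl; exact hcy hcv
    exact hE.false_of_not_adj hp (u := c) (v := a) (w := v) hac.symm hca hcv hva.symm b t y hab hcb
      hct (by grind) hyc hy.1 hcy (by grind)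
  set P : Finset V := Finset.univ.filter fun y => G.Adj c y ∧ y ≠ v with hP
  have mP : ∀ y, y ∈ P ↔ G.Adj c y ∧ y ≠ v := by simp [hP]
  have hvP : v ∉ P := by simp [mP]
  have hNc : ∀ j, G.Adj c j ↔ j ∈ P ∪ {v} := by
    intro j
    rw [Finset.mem_union, mP, Finset.mem_singleton]
    grind
  have hdc : deg G c = P.card + 1 := by
    rw [deg_eq_card hNc, Finset.card_union_of_disjoint (by simpa using hvP),
      Finset.card_singleton]
  have hNv : ∀ j, G.Adj v j ↔ j ∈ ({c, a, b} : Finset V) := by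
    intro j
    simp only [Finset.mem_insert, Finset.mem_singleton]
    constructor
    · intro hj
      have := hall v j hj
      have := hab_only j
      grind
    · rintro (rfl | rfl | rfl)
      · exact hcv.symm
      · exact hva
      · exact hvb
  have hNa : ∀ j, G.Adj a j ↔ j ∈ ({v, b} : Finset V) := by
    intro j
    simp only [Finset.mem_insert, Finset.mem_singleton]
    constructor
    · intro hj
      have := hall a j hj
      have : j ≠ c := by rintro rfl; exact hca hj.symm
      grind
    · rintro (rfl | rfl)
      · exact hva.symm
      · exact hab
  have hNb : ∀ j, G.Adj b j ↔ j ∈ ({v, a} : Finset V) := by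
    intro j
    simp only [Finset.mem_insert, Finset.mem_singleton]
    constructor
    · intro hj
      have := hall b j hj
      have : j ≠ c := by rintro rfl; exact hcb hj.symm
      grind
    · rintro (rfl | rfl)
      · exact hvb.symm
      · exact hab.symm
  have hNP : ∀ j ∈ P, ∀ y, G.Adj j y ↔ y = c := by
    intro j hj y
    rw [mP] at hj
    constructor
    · intro hjy
      have := hall j y hjy hj.1.ne'
      grind
    · rintro rfl
      exact hj.1.symm
  have hcover : ∀ y, y = c ∨ y = v ∨ y = a ∨ y = b ∨ y ∈ P := by
    intro y
    have := hab_only y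
    have := mP y
    grind
  obtain ⟨q, hq⟩ := Finset.card_pos.1 (by omega : 0 < P.card)
  obtain ⟨h1, h2, h3, h4, h5, h6⟩ := rotate_deg hcv' hac.symm hbc.symm hva' hvb' hab' hvP hq hNc
    hNv hNa hNb hNP
  have hdeg := hE.deg_le c
  refine absurd (hE.radius_le _ (isUnicyclic_rotate hcv' hac.symm hbc.symm hva' hvb' hab' hvP hq hNc
    hNv hNa hNb hNP hcover) fun y => ?_) (not_le.2 (radius_lt_rotate hp hE.unicyclic hcv' hac.symm
    hbc.symm hva' hvb' hab' hvP hq hNc hNv hNa hNb hNP (by omega) hcover))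
  rcases hcover y with rfl | rfl | rfl | rfl | hyP
  · omega
  · omega
  · omega
  · omega
  · by_cases hyq : y = q
    · rw [hyq]; omega
    · have := h6 y hyP hyq
      omega

/-- An extremal graph in which some neighbour of a vertex `c` of maximum degree is adjacent to all
non-neighbours of `c` is isomorphic to `U4`. -/
lemma nonempty_iso_U4_of_forall_adj {n : ℕ} (hn : 7 ≤ n) (hV : Fintype.card V = n)
    (hE : IsExtremal p G) (hp : 2 ≤ p) (hmax : deg G v ≤ deg G c) (hcv : G.Adj c v)
    (hZ : ∀ y, y ≠ c → ¬ G.Adj c y → G.Adj v y) : Nonempty (G ≃g U4 n) := by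
  classical
  have hd : 4 ≤ deg G c := by
    have := card_le_of_cover (G := G) (c := c) (v := v) ∅ fun y => by
      by_cases hyc : y = c
      · subst hyc; exact Or.inr (Or.inl hcv.symm)
      by_cases hy : G.Adj c y
      · exact Or.inl hy
      · exact Or.inr (Or.inl (hZ y hyc hy))
    rw [Finset.card_empty] at this
    omega
  obtain ⟨a, b, hab, hT, hall⟩ :=
    (isParentMap_of_forall_adj hcv hZ).exists_extra_edge hE.unicyclic.2
  have hcc : ¬ G.Adj c c := G.loopless.irrefl c
  have hac : a ≠ c := by
    rintro rfl
    exact hT (Or.inr ⟨hab.ne', by simp [hab]⟩)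
  have hbc : b ≠ c := by
    rintro rfl
    exact hT (Or.inl ⟨hab.ne, by simp [hab.symm]⟩)
  have hva : ¬ (a = v ∧ ¬ G.Adj c b) := by
    rintro ⟨rfl, h⟩
    exact hT (Or.inr ⟨hbc, by simp [h]⟩)
  have hvb : ¬ (b = v ∧ ¬ G.Adj c a) := by
    rintro ⟨rfl, h⟩
    exact hT (Or.inl ⟨hac, by simp [h]⟩)
  have hall' : ∀ x y, G.Adj x y → x ≠ c → y ≠ c → (x = v ∧ ¬ G.Adj c y) ∨
      (y = v ∧ ¬ G.Adj c x) ∨ (x = a ∧ y = b) ∨ (x = b ∧ y = a) := by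
    intro x y hxy hx hy
    have := hall x y hxy
    simp only [TreeAdj] at this
    grind
  have hall'' : ∀ x y, G.Adj x y → x ≠ c → y ≠ c → (x = v ∧ ¬ G.Adj c y) ∨
      (y = v ∧ ¬ G.Adj c x) ∨ (x = b ∧ y = a) ∨ (x = a ∧ y = b) := by
    intro x y hxy hx hy
    have := hall' x y hxy hx hy
    tauto
  obtain ⟨z, hzc, hcz, -⟩ := exists_not_adj_notMem (G := G) (c := c) ∅ (by
    have := hE.deg_le c
    rw [Finset.card_empty]
    omega)
  by_cases hca : G.Adj c a <;> by_cases hcb : G.Adj c b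
  · by_cases hav : a = v
    · subst hav
      exact nonempty_iso_U4_of_triangle hn hV hE hp hmax hcv hZ hcb hab hall'
    by_cases hbv : b = v
    · subst hbv
      exact nonempty_iso_U4_of_triangle hn hV hE hp hmax hcv hZ hca hab.symm hall''
    · exact (hE.false_of_adj_neighbors hp hcv hd hzc hcz (hZ z hzc hcz) hca hcb hav hbv hab
        hall').elim
  · exact (hE.false_of_adj_neighbor_nonneighbor hp hcv hd hbc hcb (hZ b hbc hcb) hca
      (fun e => hva ⟨e, hcb⟩) hab hall').elim
  · exact (hE.false_of_adj_neighbor_nonneighbor hp hcv hd hac hca (hZ a hac hca) hcb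
      (fun e => hvb ⟨e, hca⟩) hab.symm hall'').elim
  · exact (hE.false_of_adj_nonneighbors hp hcv hd hac hca hbc hcb hZ hab hall').elim

/-- A neighbour `v` of a vertex `c` of maximum degree which has a neighbour outside the closed
neighbourhood of `c` is adjacent to all but at most one of the non-neighbours of `c`. -/
lemma false_of_two_not_adj (hE : IsExtremal p G) (hp : 2 ≤ p) (hmax : deg G v ≤ deg G c)
    (hcv : G.Adj c v) {w y z : V} (hwc : w ≠ c) (hcw : ¬ G.Adj c w) (hvw : G.Adj v w)
    (hyc : y ≠ c) (hcy : ¬ G.Adj c y) (hvy : ¬ G.Adj v y) (hzc : z ≠ c) (hcz : ¬ G.Adj c z)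
    (hvz : ¬ G.Adj v z) (hyz : y ≠ z) : False := by
  classical
  have hb : ∃ b, G.Adj c b ∧ ¬ G.Adj v b ∧ b ≠ v := by
    by_contra! hcon
    have h1 : insert w (insert c (G.neighborSet c \ {v})) ⊆ G.neighborSet v := by
      rintro t (rfl | rfl | ⟨ht, htv⟩)
      · exact hvw
      · exact hcv.symm
      · by_contra hvt
        exact htv (hcon t ht hvt)
    have h2 := Set.ncard_le_ncard h1
    have h3 : c ∉ G.neighborSet c \ {v} := fun h => h.1.ne rfl
    have h4 : w ∉ insert c (G.neighborSet c \ {v}) := by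
      rintro (h | h)
      · exact hwc h
      · exact hcw h.1
    rw [Set.ncard_insert_of_notMem h4, Set.ncard_insert_of_notMem h3,
      Set.ncard_sdiff_singleton_add_one (show v ∈ G.neighborSet c from hcv)] at h2
    unfold deg at hmax
    omega
  obtain ⟨b, hcb, hvb, hbv⟩ := hb
  have hyv : y ≠ v := by rintro rfl; exact hcy hcv
  have hzv : z ≠ v := by rintro rfl; exact hcz hcv
  exact hE.false_of_adj hp hcv w b y z hvw hcw hwc hcb hvb hbv hyz hyc hyv hzc hzv hcy hcz hvy hvz

/-- The case of `false_of_two_hubs` in which `b` is adjacent to a second non-neighbour `z₁` of `c`,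
while there are at least three of them: one could move edges between `b` and `z₁`. By `hall`, the
edges avoiding `c` are those of a tree and one extra edge `e₁e₂`. -/
lemma false_of_adj_two_hubs (hE : IsExtremal p G) (hp : 2 ≤ p) (hmax : deg G v ≤ deg G c)
    {b z₀ z₁ z₂ e₁ e₂ : V} (hcv : G.Adj c v) (hcb : G.Adj c b) (hbv : b ≠ v)
    (hcz₀ : ¬ G.Adj c z₀)
    (hZ : ∀ y, y ≠ c → ¬ G.Adj c y → y ≠ z₀ → G.Adj v y)
    (hall : ∀ x y, G.Adj x y → x ≠ c → y ≠ c → (x = v ∧ ¬ G.Adj c y ∧ y ≠ z₀) ∨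
      (y = v ∧ ¬ G.Adj c x ∧ x ≠ z₀) ∨ (x = z₀ ∧ y = b) ∨ (x = b ∧ y = z₀) ∨
      (x = e₁ ∧ y = e₂) ∨ (x = e₂ ∧ y = e₁))
    (hz₁ : z₁ ≠ c) (hcz₁ : ¬ G.Adj c z₁) (hz₁₀ : z₁ ≠ z₀)
    (hz₂ : z₂ ≠ c) (hcz₂ : ¬ G.Adj c z₂) (hz₂₀ : z₂ ≠ z₀) (hz₁₂ : z₁ ≠ z₂)
    (hbz₁ : G.Adj b z₁) : False := by
  classical
  have hvz₁ := hZ z₁ hz₁ hcz₁ hz₁₀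
  have hd : 3 ≤ deg G v := by
    rw [← Finset.card_eq_three.2 ⟨c, z₁, z₂, hz₁.symm, hz₂.symm, hz₁₂, rfl⟩]
    refine card_le_deg _ fun y hy => ?_
    simp only [Finset.mem_insert, Finset.mem_singleton] at hy
    rcases hy with rfl | rfl | rfl
    · exact hcv.symm
    · exact hvz₁
    · exact hZ _ hz₂ hcz₂ hz₂₀
  obtain ⟨t, hct, ht⟩ := exists_adj_notMem {v, b}
    (lt_of_le_of_lt Finset.card_le_two (lt_of_lt_of_le (by norm_num) (hd.trans hmax)))
  simp only [Finset.mem_insert, Finset.mem_singleton, not_or] at ht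
  have := hcv.ne
  have := hcb.ne
  have := hct.ne
  have h0 := hall b z₁ hbz₁
  have h1 := hall b v
  have h2 := hall b z₂
  have h3 := hall b t
  have h4 := hall z₁ z₂
  have h5 := hall z₁ t
  have h6 : ¬ G.Adj z₁ c := fun h => hcz₁ h.symm
  exact hE.false_of_adj hp hbz₁ v c z₂ t hvz₁.symm (by grind) hbv.symm hcb.symm h6 hz₁.symm
    (by grind) (by grind) (by grind) (by grind) (by grind) (by grind) (by grind) (by grind)
    (by grind)

/-- The exceptional non-neighbour `z₀` of `c`, the only one not adjacent to `v`, is not adjacent to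
another neighbour `b` of `c`. -/
lemma false_of_two_hubs (hE : IsExtremal p G) (hp : 2 ≤ p) (hn : 7 ≤ Fintype.card V)
    (hmax : ∀ v, deg G v ≤ deg G c)
    {b z₀ : V} (hcv : G.Adj c v) (hcb : G.Adj c b) (hz₀ : z₀ ≠ c) (hcz₀ : ¬ G.Adj c z₀)
    (hvz₀ : ¬ G.Adj v z₀) (hbz₀ : G.Adj b z₀)
    (hZ : ∀ y, y ≠ c → ¬ G.Adj c y → y ≠ z₀ → G.Adj v y) : False := by
  classical
  have hbv : b ≠ v := by rintro rfl; exact hvz₀ hbz₀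
  have hcv' := hcv.ne
  have hcb' := hcb.ne
  have hf : IsParentMap G c (fun x => if G.Adj c x then c else if x = z₀ then b else v)
      (fun x => if x = c then 0 else if G.Adj c x then 1 else 2) := by
    intro x hx
    by_cases h : G.Adj c x
    · simp [hx, h, h.symm]
    by_cases h' : x = z₀
    · simp [hcz₀, h', hcb, hcb'.symm, hz₀, hbz₀.symm]
    · simp [hx, h, h', hcv, hcv'.symm, (hZ x hx h h').symm]
  obtain ⟨e₁, e₂, -, -, hall⟩ := hf.exists_extra_edge hE.unicyclic.2
  have hall' : ∀ x y, G.Adj x y → x ≠ c → y ≠ c → (x = v ∧ ¬ G.Adj c y ∧ y ≠ z₀) ∨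
      (y = v ∧ ¬ G.Adj c x ∧ x ≠ z₀) ∨ (x = z₀ ∧ y = b) ∨ (x = b ∧ y = z₀) ∨
      (x = e₁ ∧ y = e₂) ∨ (x = e₂ ∧ y = e₁) := by
    intro x y hxy hx hy
    have := hall x y hxy
    simp only [TreeAdj] at this
    grind
  have hdc := hE.deg_le c
  obtain ⟨z₁, hz₁, hcz₁, hz₁₀⟩ := exists_not_adj_notMem (G := G) (c := c) {z₀} (by
    rw [Finset.card_singleton]; omega)
  rw [Finset.mem_singleton] at hz₁₀
  have hvz₁ := hZ z₁ hz₁ hcz₁ hz₁₀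
  by_cases hZ2 : ∃ z₂, z₂ ≠ c ∧ ¬ G.Adj c z₂ ∧ z₂ ≠ z₀ ∧ z₂ ≠ z₁
  · obtain ⟨z₂, hz₂, hcz₂, hz₂₀, hz₂₁⟩ := hZ2
    by_cases h1 : G.Adj b z₁
    · exact hE.false_of_adj_two_hubs hp (hmax v) hcv hcb hbv hcz₀ hZ hall' hz₁ hcz₁ hz₁₀ hz₂ hcz₂
        hz₂₀ hz₂₁.symm h1
    by_cases h2 : G.Adj b z₂
    · exact hE.false_of_adj_two_hubs hp (hmax v) hcv hcb hbv hcz₀ hZ hall' hz₂ hcz₂ hz₂₀ hz₁ hcz₁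
        hz₁₀ hz₂₁ h2
    exact hE.false_of_two_not_adj hp (hmax b) hcb hz₀ hcz₀ hbz₀ hz₁ hcz₁ h1 hz₂ hcz₂ h2 hz₂₁.symm
  have hd : 4 ≤ deg G c := by
    by_contra hlt
    obtain ⟨z₂, hz₂, hcz₂, hz₂'⟩ := exists_not_adj_notMem (G := G) (c := c) {z₀, z₁}
      (by have := Finset.card_le_two (a := z₀) (b := z₁); omega)
    simp only [Finset.mem_insert, Finset.mem_singleton, not_or] at hz₂'
    exact hZ2 ⟨z₂, hz₂, hcz₂, hz₂'⟩
  obtain ⟨t, hct, ht⟩ := exists_adj_notMem {v, b}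
    (lt_of_le_of_lt Finset.card_le_two (lt_of_lt_of_le (by norm_num) hd))
  obtain ⟨s, hcs, hs⟩ := exists_adj_notMem {v, b, t} (lt_of_le_of_lt Finset.card_le_three hd)
  simp only [Finset.mem_insert, Finset.mem_singleton, not_or] at ht hs
  have := hct.ne
  have := hcs.ne
  have h6 : ¬ G.Adj z₁ c := fun h => hcz₁ h.symm
  have h1 := hall' v b
  have h2 := hall' v t
  have h3 := hall' v s
  have h4 := hall' b z₁
  have h5 := hall' b v
  have h7 := hall' b t
  have h8 := hall' b s
  by_cases g1 : G.Adj b z₁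
  · have h9 := hall' z₁ t
    have h10 := hall' z₁ s
    exact hE.false_of_adj hp hvz₁ b c t s g1.symm (by grind) hbv hcv.symm h6 hz₁.symm (by grind)
      (by grind) (by grind) (by grind) (by grind) (by grind) (by grind) (by grind) (by grind)
  by_cases g2 : G.Adj v b
  · exact hE.false_of_adj hp g2 z₀ z₁ t s hbz₀ hvz₀ (by grind) hvz₁ g1 (by grind) (by grind)
      (by grind) (by grind) (by grind) (by grind) (by grind) (by grind) (by grind) (by grind)
  · have hts : (¬ G.Adj v t ∧ ¬ G.Adj b t) ∨ (¬ G.Adj v s ∧ ¬ G.Adj b s) := by grind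
    rcases hts with ⟨k1, k2⟩ | ⟨k1, k2⟩
    · exact hE.false_of_not_adj hp hbv.symm g2 hcv.symm hcb.symm z₀ z₁ t hbz₀ hvz₀ hvz₁ g1 ht.1 ht.2
        k1 k2
    · exact hE.false_of_not_adj hp hbv.symm g2 hcv.symm hcb.symm z₀ z₁ s hbz₀ hvz₀ hvz₁ g1 hs.1
        hs.2.1 k1 k2

/-- The exceptional non-neighbour `z₀` of `c` is not at distance three from `c`. -/
lemma false_of_dist_three (hE : IsExtremal p G) (hp : 2 ≤ p) (hn : 7 ≤ Fintype.card V)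
    (hmax : ∀ v, deg G v ≤ deg G c)
    {z₀ : V} (hcv : G.Adj c v) (hz₀ : z₀ ≠ c) (hcz₀ : ¬ G.Adj c z₀)
    (hNz₀ : ∀ b, G.Adj c b → ¬ G.Adj b z₀)
    (hZ : ∀ y, y ≠ c → ¬ G.Adj c y → y ≠ z₀ → G.Adj v y) : False := by
  classical
  have hcv' := hcv.ne
  obtain ⟨z₁, hz⟩ := exists_adj_of_ne hE.unicyclic.1 hz₀
  have hz₁₀ := hz.ne'
  have hcz₁ : ¬ G.Adj c z₁ := fun h => hNz₀ z₁ h hz.symm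
  have hz₁ : z₁ ≠ c := by rintro rfl; exact hcz₀ hz.symm
  have hvz₁ := hZ z₁ hz₁ hcz₁ hz₁₀
  have hvz₀ := hNz₀ v hcv
  have hf : IsParentMap G c (fun x => if G.Adj c x then c else if x = z₀ then z₁ else v)
      (fun x => if x = c then 0 else if G.Adj c x then 1 else if x = z₀ then 3 else 2) := by
    intro x hx
    by_cases h : G.Adj c x
    · simp [hx, h, h.symm]
    by_cases h' : x = z₀
    · simp [hcz₀, h', hcz₁, hz₁, hz₁₀, hz₀, hz]
    · simp [hx, h, h', hcv, hcv'.symm, (hZ x hx h h').symm]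
  obtain ⟨e₁, e₂, -, -, hall⟩ := hf.exists_extra_edge hE.unicyclic.2
  have hall' : ∀ x y, G.Adj x y → x ≠ c → y ≠ c → (x = v ∧ ¬ G.Adj c y ∧ y ≠ z₀) ∨
      (y = v ∧ ¬ G.Adj c x ∧ x ≠ z₀) ∨ (x = z₀ ∧ y = z₁) ∨ (x = z₁ ∧ y = z₀) ∨
      (x = e₁ ∧ y = e₂) ∨ (x = e₂ ∧ y = e₁) := by
    intro x y hxy hx hy
    have := hall x y hxy
    simp only [TreeAdj] at this
    grind
  have h6 : ¬ G.Adj z₁ c := fun h => hcz₁ h.symm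
  have hvz₁' := hvz₁.ne
  have hdc := hE.deg_le c
  -- two neighbours of `c` adjacent to neither `v` nor `z₁` are impossible
  have key : ∀ s t, G.Adj c s → G.Adj c t → s ≠ t → s ≠ v → t ≠ v → ¬ G.Adj v s → ¬ G.Adj v t →
      ¬ G.Adj z₁ s → ¬ G.Adj z₁ t → False := by
    intro s t hcs hct hst hsv htv g1 g2 g3 g4
    have hsz : s ≠ z₁ := by rintro rfl; exact hcz₁ hcs
    have htz : t ≠ z₁ := by rintro rfl; exact hcz₁ hct
    have hvz₀' : z₀ ≠ v := by rintro rfl; exact hcz₀ hcv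
    exact hE.false_of_adj hp hvz₁ z₀ c s t hz.symm hvz₀ hvz₀' hcv.symm h6 hz₁.symm hst hsv hsz htv
      htz g1 g2 g3 g4
  by_cases ha : ∃ a, G.Adj c a ∧ a ≠ v ∧ (G.Adj v a ∨ G.Adj z₁ a)
  · obtain ⟨a, hca, hav, hva⟩ := ha
    have hca' := hca.ne
    have hd : 4 ≤ deg G c := by
      by_contra! hlt
      obtain ⟨z₂, hz₂, hcz₂, hz₂'⟩ := exists_not_adj_notMem (G := G) (c := c) {z₀, z₁}
        (by have := Finset.card_le_two (a := z₀) (b := z₁); omega)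
      simp only [Finset.mem_insert, Finset.mem_singleton, not_or] at hz₂'
      obtain ⟨hz₂₀, hz₂₁⟩ : z₂ ≠ z₀ ∧ z₂ ≠ z₁ := hz₂'
      have hvz₂ := hZ z₂ hz₂ hcz₂ hz₂₀
      rcases hva with hva | hza
      · have h4 : ({c, a, z₁, z₂} : Finset V).card = 4 := by
          have k1 : a ≠ z₁ := by rintro rfl; exact hcz₁ hca
          have k2 : a ≠ z₂ := by rintro rfl; exact hcz₂ hca
          simp [hca', hz₁.symm, hz₂.symm, k1, k2, hz₂₁.symm]
        have h5 := card_le_deg (G := G) (v := v) {c, a, z₁, z₂} (by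
          simp [hcv.symm, hva, hvz₁, hvz₂])
        have := hmax v
        omega
      · have k1 := hall' z₁ a hza
        have k2 := hall' a v
        have k3 := hall' a z₂
        have k4 := hNz₀ a hca
        exact hE.false_of_adj hp hca z₁ v z₀ z₂ hza.symm hcz₁ hz₁ hcv (by grind) hav.symm
          hz₂₀.symm hz₀ (by grind) hz₂ (by grind) hcz₀ hcz₂ k4 (by grind)
    obtain ⟨t, hct, ht⟩ := exists_adj_notMem {v, a}
      (lt_of_le_of_lt Finset.card_le_two (lt_of_lt_of_le (by norm_num) hd))
    obtain ⟨s, hcs, hs⟩ := exists_adj_notMem {v, a, t} (lt_of_le_of_lt Finset.card_le_three hd)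
    simp only [Finset.mem_insert, Finset.mem_singleton, not_or] at ht hs
    have := hct.ne
    have := hcs.ne
    have k1 := hall' v a
    have k2 := hall' z₁ a
    have k3 := hall' v t
    have k4 := hall' v s
    have k5 := hall' z₁ t
    have k6 := hall' z₁ s
    exact key s t hcs hct hs.2.2 hs.1 ht.1 (by grind) (by grind) (by grind) (by grind)
  · push Not at ha
    have hd : 3 ≤ deg G c := by
      have := card_le_of_cover (G := G) (c := c) (v := v) {z₀} fun y => by
        by_cases hyc : y = c
        · subst hyc; exact Or.inr (Or.inl hcv.symm)
        by_cases hy : G.Adj c y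
        · exact Or.inl hy
        by_cases hyz : y = z₀
        · exact Or.inr (Or.inr (by simp [hyz]))
        · exact Or.inr (Or.inl (hZ y hyc hy hyz))
      rw [Finset.card_singleton] at this
      have := hmax v
      omega
    obtain ⟨t, hct, ht⟩ := exists_adj_notMem {v}
      (lt_of_le_of_lt (Finset.card_singleton v).le (lt_of_lt_of_le (by norm_num) hd))
    obtain ⟨s, hcs, hs⟩ := exists_adj_notMem {v, t} (lt_of_le_of_lt Finset.card_le_two hd)
    simp only [Finset.mem_insert, Finset.mem_singleton, not_or] at ht hs
    exact key s t hcs hct hs.2 hs.1 ht (ha s hcs hs.1).1 (ha t hct ht).1 (ha s hcs hs.1).2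
      (ha t hct ht).2

/-- An extremal graph is isomorphic to `U4`. -/
lemma nonempty_iso_U4 {n : ℕ} (hn : 7 ≤ n) (hV : Fintype.card V = n) (hE : IsExtremal p G)
    (hp : 2 ≤ p) : Nonempty (G ≃g U4 n) := by
  classical
  have : Nonempty V := Fintype.card_pos_iff.1 (by omega)
  obtain ⟨c, hc⟩ := Finite.exists_max (deg G)
  have hdc := hE.deg_le c
  -- a non-neighbour `w` of `c` at distance two
  obtain ⟨z, hzc, hcz, -⟩ := exists_not_adj_notMem (G := G) (c := c) ∅ (by
    rw [Finset.card_empty]; omega)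
  obtain ⟨W⟩ := hE.unicyclic.1.preconnected c z
  obtain ⟨⟨⟨v, w⟩, hvw⟩, -, hv, hw⟩ := W.exists_boundary_dart ({c} ∪ G.neighborSet c) (by simp)
    (by simp [hzc, hcz])
  simp only [Set.mem_union, Set.mem_singleton_iff, SimpleGraph.mem_neighborSet, not_or] at hv hw
  obtain ⟨hwc, hcw⟩ := hw
  have hcv : G.Adj c v := hv.resolve_left fun h => hcw (h ▸ hvw)
  by_cases hZ : ∀ y, y ≠ c → ¬ G.Adj c y → G.Adj v y
  · exact hE.nonempty_iso_U4_of_forall_adj hn hV hp (hc v) hcv hZ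
  push Not at hZ
  obtain ⟨z₀, hz₀, hcz₀, hvz₀⟩ := hZ
  have hZ' : ∀ y, y ≠ c → ¬ G.Adj c y → y ≠ z₀ → G.Adj v y := by
    intro y hy hcy hyz
    by_contra hvy
    exact hE.false_of_two_not_adj hp (hc v) hcv hwc hcw hvw hy hcy hvy hz₀ hcz₀ hvz₀ hyz
  by_cases hb : ∃ b, G.Adj c b ∧ G.Adj b z₀
  · obtain ⟨b, hcb, hbz₀⟩ := hb
    exact (hE.false_of_two_hubs hp (by omega) hc hcv hcb hz₀ hcz₀ hvz₀ hbz₀ hZ').elim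
  · push Not at hb
    exact (hE.false_of_dist_three hp (by omega) hc hcv hz₀ hcz₀ hb hZ').elim

end IsExtremal

/-- A unicyclic graph of order `n` with all degrees at most `n - 3` which is not isomorphic to `U4`
has a smaller spectral radius than `U4`. -/
lemma radius_lt_radius_U4 {n : ℕ} (hn : 7 ≤ n) (hV : Fintype.card V = n) (hp : 2 ≤ p)
    (hG : IsUnicyclic G) (hd : ∀ v, deg G v + 3 ≤ n) (h4 : IsEmpty (G ≃g U4 n)) :
    pSomborRadius p G < pSomborRadius p (U4 n) := by
  classical
  have : Nonempty V := Fintype.card_pos_iff.1 (by omega)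
  obtain ⟨H, ⟨hH, hHd⟩, hmax⟩ := Set.exists_max_image
    {H : SimpleGraph V | IsUnicyclic H ∧ ∀ v, deg H v + 3 ≤ n} (pSomborRadius p) (Set.toFinite _)
    ⟨G, hG, hd⟩
  have hHE : IsExtremal p H := ⟨hH, fun v => hV ▸ hHd v, fun G' h1 h2 => hmax G' ⟨h1, hV ▸ h2⟩⟩
  obtain ⟨e⟩ := hHE.nonempty_iso_U4 hn hV hp
  rw [← pSomborRadius_congr e]
  refine lt_of_le_of_ne (hmax G ⟨hG, hd⟩) fun heq => ?_
  have hGE : IsExtremal p G :=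
    ⟨hG, fun v => hV ▸ hd v, fun G' h1 h2 => heq ▸ hmax G' ⟨h1, hV ▸ h2⟩⟩
  exact (hGE.nonempty_iso_U4 hn hV hp).elim h4.elim

end PSombor

theorem mainTheorem3 (n : ℕ) (hn : 7 ≤ n) (p : ℝ) (hp : 2 ≤ p) :
    (PSombor.IsUnicyclic (PSombor.starPlusEdge n) ∧ PSombor.IsUnicyclic (PSombor.U1 n) ∧
      PSombor.IsUnicyclic (PSombor.U2 n) ∧ PSombor.IsUnicyclic (PSombor.U3 n) ∧
      PSombor.IsUnicyclic (PSombor.U4 n)) ∧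
    (PSombor.pSomborRadius p (PSombor.U1 n) < PSombor.pSomborRadius p (PSombor.starPlusEdge n) ∧
      PSombor.pSomborRadius p (PSombor.U2 n) < PSombor.pSomborRadius p (PSombor.U1 n) ∧
      PSombor.pSomborRadius p (PSombor.U3 n) < PSombor.pSomborRadius p (PSombor.U2 n) ∧
      PSombor.pSomborRadius p (PSombor.U4 n) < PSombor.pSomborRadius p (PSombor.U3 n)) ∧
    (∀ (V : Type*) [Fintype V] (G : SimpleGraph V), Fintype.card V = n →
      PSombor.IsUnicyclic G →
      IsEmpty (G ≃g PSombor.starPlusEdge n) → IsEmpty (G ≃g PSombor.U1 n) →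
      IsEmpty (G ≃g PSombor.U2 n) → IsEmpty (G ≃g PSombor.U3 n) →
      IsEmpty (G ≃g PSombor.U4 n) →
      PSombor.pSomborRadius p G < PSombor.pSomborRadius p (PSombor.U4 n)) := by
  refine ⟨⟨PSombor.isUnicyclic_starPlusEdge hn, PSombor.isUnicyclic_U1 hn,
    PSombor.isUnicyclic_U2 hn, PSombor.isUnicyclic_U3 hn, PSombor.isUnicyclic_U4 hn⟩,
    ⟨PSombor.radius_U1_lt hn hp, PSombor.radius_U2_lt hn hp, PSombor.radius_U3_lt hn hp,
      PSombor.radius_U4_lt hn hp⟩, ?_⟩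
  intro V _ G hV hG h0 h1 h2 h3 h4
  refine PSombor.radius_lt_radius_U4 hn hV hp hG (fun v => ?_) h4
  by_contra hv
  rcases PSombor.nonempty_iso_of_le_deg hn hV hG (c := v) (by omega) with e | e | e | e
  · exact e.elim h0.elim
  · exact e.elim h1.elim
  · exact e.elim h2.elim
  · exact e.elim h3.elim
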